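/- **Setting.** Let $d\ge 2$, let $\Omega\subset\mathbb R^d$ be a lattice with fundamental domain $F$ of measure $1$, and let $\Gamma=\{\gamma\in\mathbb R^d:(\gamma,\omega)\in 2\pi\mathbb Z\ \ \forall\omega\in\Omega\}$ be the dual lattice. Put $\varkappa=3^d+d+2$, $\alpha=1/\varkappa$, $\alpha_k=3^k\alpha$, and let $s\ge \frac{3d-1}{2}(3^d+d+2)+\frac{d3^d}{4}+d+6$, $p=s-d$, $p_1=[\frac p3]+1$. Let $q$ be a real $\Omega$-periodic potential in $L_2(F)$ with $\int_F q=0$ and $q\in W_2^s(F)$, i.e. $\sum_{\gamma\in\Gamma}|q_\gamma|^2(1+|\gamma|^{2s})<\infty$, where $q_\gamma=\int_F q(x)e^{-i(\gamma,x)}dx$. For $t\in\mathbb R^d$ let $L_t(q)$ be the self-adjoint operator in $L_2(F)$ generated by $-\Delta+q$ and the conditions $u(x+\omega)=e^{i(t,\omega)}u(x)$, $\omega\in\Omega$. If $\Psi_{N,t}$ is a normalized eigenfunction with eigenvalue $\Lambda_N(t)$, write $b(N,\gamma)=\int_F\Psi_{N,t}(x)e^{-i(\gamma+t,x)}dx$.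 For $\rho>0$ let $R(r)=\{|x|<r\}$, $\Gamma(r)=\{\gamma\in\Gamma:0<|\gamma|<r\}$, $$V_{g}(r)=\{x:\ \big||x|^2-|x+g|^2\big|\le r\}\cap\big(R(\tfrac32\rho)\setminus R(\tfrac12\rho)\big),$$ let $E_k$ be the union of $\bigcap_{i=1}^kV_{\gamma_i}(\rho^{\alpha_k})$ over all linearly independent $\gamma_1,\dots,\gamma_k\in\Gamma(p\rho^\alpha)$, and let $U=(R(\frac32\rho)\setminus R(\frac12\rho))\setminus E_1$. For linearly independent $\gamma_1,\dots,\gamma_k\in\Gamma(p\rho^\alpha)$ let $$B_k=\{v\in\Gamma\cap\operatorname{span}_{\mathbb R}\{\gamma_1,\dots,\gamma_k\}:\ |v|<\tfrac12\rho^{\alpha_{k+1}/2}\},$$ let $h_1,\dots,h_{b_k}$ be the distinct vectors of the form $\gamma+v+a$ with $v\in B_k$, $a\in\Gamma$, $|a|<p_1\rho^\alpha$, and let $C(\gamma+t,\gamma_1,\dots,\gamma_k)=(c_{ij})$ be the $b_k\times b_k$ Hermitian matrix with $c_{ii}=|h_i+t|^2$ and $c_{ij}=q_{h_i-h_j}$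 for $i\ne j$; let $\lambda_1(\gamma+t)\le\dots\le\lambda_{b_k}(\gamma+t)$ be its eigenvalues. Finally let $F_0=0$ and, for $m\ge1$, $F_m(x)=\sum_{k=1}^{m}S_k(|x|^2+F_{m-1}(x),x)$, where $$S_k(a,x)=\sum\frac{q_{\gamma_1}\cdots q_{\gamma_k}\,q_{-\gamma_1-\dots-\gamma_k}}{\prod_{j=1}^k\big(a-|x-\gamma_1-\dots-\gamma_j|^2\big)},$$ the sum being over $\gamma_1,\dots,\gamma_k\in\Gamma(\rho^\alpha)$ with $\gamma_1+\dots+\gamma_j\ne0$ for $j=1,\dots,k$. **Theorem 2.2.** (a) Let $0\le c<p-\frac14d3^d$ and $c_5>0$. There are constants $K,\rho_0>0$ (depending only on $\Omega,q,s,c,c_5$) such that the following holds for all $\rho\ge\rho_0$, $1\le k\le d-1$, $t\in\mathbb R^d$, $\gamma\in\Gamma$ and all linearly independent $\gamma_1,\dots,\gamma_k\in\Gamma(p\rho^\alpha)$. If $\gamma+t\in\big(\bigcap_{i=1}^kV_{\gamma_i}(\rho^{\alpha_k})\big)\setminus E_{k+1}$ and $\Lambda_N(t)$ is an eigenvalue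 of $L_t(q)$ with a normalized eigenfunction $\Psi_{N,t}$ satisfying $$|\Lambda_N(t)-|\gamma+t|^2|<\tfrac12\rho^{\alpha_1}\quad(1.15),\qquad |b(N,\gamma)|>c_5\rho^{-c\alpha}\quad(1.16),$$ then for some $j$ $$|\Lambda_N(t)-\lambda_j(\gamma+t)|\le K|\gamma+t|^{-(p-c-\frac14d3^d)\alpha}.\tag{1.17}$$ (b) There are constants $K,\rho_0>0$ (depending only on $\Omega,q,s$) such that for all $\rho\ge\rho_0$ and $t\in\mathbb R^d$, every eigenvalue $\Lambda_N(t)$ of $L_t(q)$ in $(\frac34\rho^2,\frac54\rho^2)$ satisfies one of the following for some $\gamma\in\Gamma$: either $\gamma+t\in U$ and, with $m=[\frac13(p-\frac12\varkappa(d-1))]$, $$|\Lambda_N(t)-|\gamma+t|^2-F_{m-1}(\gamma+t)|\le K|\gamma+t|^{-m\alpha_1};\tag{1.14}$$ or there are $1\le k\le d-1$ and linearly independent $\gamma_1,\dots,\gamma_k\in\Gamma(p\rho^\alpha)$ with $\gamma+t\in\big(\bigcap_{i=1}^kV_{\gamma_i}(\rho^{\alpha_k})\big)\setminus E_{k+1}$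 such that (1.17) holds for some $j$ with $c=\frac12\varkappa(d-1)$. -/

import Mathlib

open MeasureTheory

noncomputable section

namespace PeriodicSchrodinger

variable {d : ℕ}

/-! ### The lattice, its dual, and functions on the fundamental domain

A lattice `Ω ⊂ ℝᵈ` is given by a basis `b`: it is the `ℤ`-span of `b`, and
`F = ZSpan.fundamentalDomain b` is its fundamental domain. -/

/-- The period lattice `Ω`. -/
def periodLattice (b : Module.Basis (Fin d) ℝ (EuclideanSpace ℝ (Fin d))) :
    Set (EuclideanSpace ℝ (Fin d)) :=
  Submodule.span ℤ (Set.range b)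

/-- The dual lattice `Γ = {γ : (γ, ω) ∈ 2πℤ for all ω ∈ Ω}`. -/
def dualLattice (b : Module.Basis (Fin d) ℝ (EuclideanSpace ℝ (Fin d))) :
    Set (EuclideanSpace ℝ (Fin d)) :=
  {γ | ∀ ω ∈ periodLattice b, ∃ n : ℤ, inner ℝ γ ω = 2 * Real.pi * n}

/-- `Γ(r) = {γ ∈ Γ : 0 < |γ| < r}`. -/
def dualBall (b : Module.Basis (Fin d) ℝ (EuclideanSpace ℝ (Fin d))) (r : ℝ) :
    Set (EuclideanSpace ℝ (Fin d)) :=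
  {γ | γ ∈ dualLattice b ∧ 0 < ‖γ‖ ∧ ‖γ‖ < r}

/-- `(f, e^{i(ξ,x)}) = ∫_F f(x) e^{-i(ξ,x)} dx`.  For `ξ = γ ∈ Γ` and `f = q` this is the Fourier
coefficient `q_γ`; for `ξ = γ + t` and `f = Ψ_{N,t}` it is `b(N, γ)`. -/
def planeWaveCoeff (b : Module.Basis (Fin d) ℝ (EuclideanSpace ℝ (Fin d)))
    (f : EuclideanSpace ℝ (Fin d) → ℂ) (ξ : EuclideanSpace ℝ (Fin d)) : ℂ :=
  ∫ x in ZSpan.fundamentalDomain b, f x * Complex.exp (-(Complex.I * ((inner ℝ ξ x : ℝ) : ℂ)))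

/-- The Fourier coefficient `q_γ` of a real potential. -/
def potCoeff (b : Module.Basis (Fin d) ℝ (EuclideanSpace ℝ (Fin d)))
    (q : EuclideanSpace ℝ (Fin d) → ℝ) (γ : EuclideanSpace ℝ (Fin d)) : ℂ :=
  planeWaveCoeff b (fun x => (q x : ℂ)) γ

/-- A real, `Ω`-periodic potential `q ∈ W₂ˢ(F)` with `∫_F q = 0`; membership in `W₂ˢ(F)` means
`∑_γ |q_γ|² (1 + |γ|^{2s}) < ∞`. -/
structure IsPotential (b : Module.Basis (Fin d) ℝ (EuclideanSpace ℝ (Fin d))) (s : ℝ)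
    (q : EuclideanSpace ℝ (Fin d) → ℝ) : Prop where
  periodic : ∀ x, ∀ ω ∈ periodLattice b, q (x + ω) = q x
  memLp : MemLp q 2 (volume.restrict (ZSpan.fundamentalDomain b))
  sobolev : Summable fun γ : dualLattice b =>
    ‖potCoeff b q γ‖ ^ 2 * (1 + ‖(γ : EuclideanSpace ℝ (Fin d))‖ ^ (2 * s))
  mean_zero : ∫ x in ZSpan.fundamentalDomain b, q x = 0

/-- The quasiperiodic condition `u(x + ω) = e^{i(t,ω)} u(x)` for all `ω ∈ Ω`. -/
def IsQuasiperiodic (b : Module.Basis (Fin d) ℝ (EuclideanSpace ℝ (Fin d)))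
    (t : EuclideanSpace ℝ (Fin d)) (u : EuclideanSpace ℝ (Fin d) → ℂ) : Prop :=
  ∀ x, ∀ ω ∈ periodLattice b,
    u (x + ω) = Complex.exp (Complex.I * ((inner ℝ t ω : ℝ) : ℂ)) * u x

/-- `Ψ` is a normalized eigenfunction, with eigenvalue `Λ`, of the operator `L_t(q)` generated in
`L₂(F)` by `-Δ + q` and the quasiperiodic conditions.  The operator is self-adjoint and the smooth
quasiperiodic functions are a core for it, so `L_t(q) Ψ = Λ Ψ` means
`(Ψ, (-Δ + q) φ) = Λ (Ψ, φ)` for every smooth quasiperiodic `φ`. -/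
structure IsBlochFunction (b : Module.Basis (Fin d) ℝ (EuclideanSpace ℝ (Fin d)))
    (q : EuclideanSpace ℝ (Fin d) → ℝ) (t : EuclideanSpace ℝ (Fin d)) (Λ : ℝ)
    (Ψ : EuclideanSpace ℝ (Fin d) → ℂ) : Prop where
  quasiperiodic : IsQuasiperiodic b t Ψ
  memLp : MemLp Ψ 2 (volume.restrict (ZSpan.fundamentalDomain b))
  normalized : ∫ x in ZSpan.fundamentalDomain b, ‖Ψ x‖ ^ 2 = 1
  weak_eq : ∀ φ : EuclideanSpace ℝ (Fin d) → ℂ, ContDiff ℝ (⊤ : ℕ∞) φ → IsQuasiperiodic b t φ →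
    ∫ x in ZSpan.fundamentalDomain b,
        Ψ x * (starRingEnd ℂ) (-(Laplacian.laplacian φ x) + (q x : ℂ) * φ x) =
      (Λ : ℂ) * ∫ x in ZSpan.fundamentalDomain b, Ψ x * (starRingEnd ℂ) (φ x)

/-- `Λ` is an eigenvalue of `L_t(q)`. -/
def IsBlochEigenvalue (b : Module.Basis (Fin d) ℝ (EuclideanSpace ℝ (Fin d)))
    (q : EuclideanSpace ℝ (Fin d) → ℝ) (t : EuclideanSpace ℝ (Fin d)) (Λ : ℝ) : Prop :=
  ∃ Ψ, IsBlochFunction b q t Λ Ψ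

/-! ### The numerical parameters -/

/-- `ϰ = 3ᵈ + d + 2`. -/
def kap (d : ℕ) : ℝ := 3 ^ d + d + 2

/-- `α = 1 / ϰ`. -/
def alpha (d : ℕ) : ℝ := 1 / kap d

/-- `α_k = 3ᵏ α`. -/
def alphaK (d k : ℕ) : ℝ := 3 ^ k * alpha d

/-- `p = s - d`. -/
def pOf (d : ℕ) (s : ℝ) : ℝ := s - d

/-- `p₁ = [p / 3] + 1`. -/
def pOne (d : ℕ) (s : ℝ) : ℕ := ⌊pOf d s / 3⌋₊ + 1

/-- The smoothness threshold `s₀ = (3d - 1)/2 · (3ᵈ + d + 2) + d 3ᵈ / 4 + d + 6`. -/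
def sZero (d : ℕ) : ℝ := (3 * d - 1) / 2 * (3 ^ d + d + 2) + d * 3 ^ d / 4 + d + 6

/-! ### Resonance and non-resonance domains -/

/-- The shell `R(3ρ/2) \ R(ρ/2)`, where `R(r)` is the open ball of radius `r` about `0`. -/
def shell (d : ℕ) (ρ : ℝ) : Set (EuclideanSpace ℝ (Fin d)) :=
  Metric.ball 0 (3 / 2 * ρ) \ Metric.ball 0 (1 / 2 * ρ)

/-- `V_g(r) = {x : ||x|² - |x + g|²| ≤ r} ∩ (R(3ρ/2) \ R(ρ/2))`. -/
def resonanceDomain (ρ r : ℝ) (g : EuclideanSpace ℝ (Fin d)) :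
    Set (EuclideanSpace ℝ (Fin d)) :=
  {x | |‖x‖ ^ 2 - ‖x + g‖ ^ 2| ≤ r} ∩ shell d ρ

/-- `E_k(ρ^{α_k}, p)`: the union, over linearly independent `γ₁, …, γ_k ∈ Γ(p ρ^α)`, of
`⋂ᵢ V_{γᵢ}(ρ^{α_k})`. -/
def resonanceUnion (b : Module.Basis (Fin d) ℝ (EuclideanSpace ℝ (Fin d))) (s ρ : ℝ) (k : ℕ) :
    Set (EuclideanSpace ℝ (Fin d)) :=
  {x | ∃ g : Fin k → EuclideanSpace ℝ (Fin d),
    (∀ i, g i ∈ dualBall b (pOf d s * ρ ^ alpha d)) ∧ LinearIndependent ℝ g ∧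
      ∀ i, x ∈ resonanceDomain ρ (ρ ^ alphaK d k) (g i)}

/-- The non-resonance domain `U(ρ^{α₁}, p) = (R(3ρ/2) \ R(ρ/2)) \ E₁(ρ^{α₁}, p)`. -/
def nonresonanceDomain (b : Module.Basis (Fin d) ℝ (EuclideanSpace ℝ (Fin d))) (s ρ : ℝ) :
    Set (EuclideanSpace ℝ (Fin d)) :=
  shell d ρ \ resonanceUnion b s ρ 1

/-! ### The non-resonance corrections `F_k` -/

/-- `S_k(a, x) = ∑ q_{γ₁} ⋯ q_{γ_k} q_{-γ₁-⋯-γ_k} / ∏_{j=1}^k (a - |x - ∑_{i ≤ j} γᵢ|²)`, summed over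
`γ₁, …, γ_k ∈ Γ(ρ^α)` all of whose partial sums `γ₁ + ⋯ + γ_j` (`j = 1, …, k`) are nonzero. -/
def corrS (b : Module.Basis (Fin d) ℝ (EuclideanSpace ℝ (Fin d)))
    (q : EuclideanSpace ℝ (Fin d) → ℝ) (ρ : ℝ) (k : ℕ) (a : ℂ)
    (x : EuclideanSpace ℝ (Fin d)) : ℂ :=
  ∑ᶠ g ∈ {g : Fin k → EuclideanSpace ℝ (Fin d) |
      (∀ i, g i ∈ dualBall b (ρ ^ alpha d)) ∧ ∀ j, ∑ i ∈ Finset.Iic j, g i ≠ 0},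
    ((∏ i, potCoeff b q (g i)) * potCoeff b q (-∑ i, g i)) /
      ∏ j, (a - ((‖x - ∑ i ∈ Finset.Iic j, g i‖ ^ 2 : ℝ) : ℂ))

/-- `F₀ = 0` and `F_s(x) = ∑_{k=1}^s S_k(|x|² + F_{s-1}(x), x)`. -/
def corrF (b : Module.Basis (Fin d) ℝ (EuclideanSpace ℝ (Fin d)))
    (q : EuclideanSpace ℝ (Fin d) → ℝ) (ρ : ℝ) (x : EuclideanSpace ℝ (Fin d)) : ℕ → ℂ
  | 0 => 0
  | n + 1 => ∑ k ∈ Finset.Icc 1 (n + 1),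
      corrS b q ρ k (((‖x‖ ^ 2 : ℝ) : ℂ) + corrF b q ρ x n) x

/-! ### The matrix `C(γ + t, γ₁, …, γ_k)` -/

/-- `B_k(γ₁, …, γ_k)`: the vectors `b` of `Γ` lying in the real span of `γ₁, …, γ_k`, with
`|b| < ½ ρ^{α_{k+1}/2}`.  (When `γ₁, …, γ_k` is a `ℤ`-basis of `Γ ∩ span {γ₁, …, γ_k}`, these are
the combinations `∑ nᵢ γᵢ`, `nᵢ ∈ ℤ`, with that bound.) -/
def resonanceBlock (b : Module.Basis (Fin d) ℝ (EuclideanSpace ℝ (Fin d))) (ρ : ℝ) {k : ℕ}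
    (g : Fin k → EuclideanSpace ℝ (Fin d)) : Set (EuclideanSpace ℝ (Fin d)) :=
  {v | v ∈ dualLattice b ∧ v ∈ Submodule.span ℝ (Set.range g) ∧
    ‖v‖ < 1 / 2 * ρ ^ (1 / 2 * alphaK d (k + 1))}

/-- The set `{h₁, …, h_{b_k}} = {γ + v + a : v ∈ B_k, a ∈ Γ, |a| < p₁ ρ^α}`, so that the vectors
`hᵢ + t` are those of `B_k(γ + t, p₁)`. -/
def indexSet (b : Module.Basis (Fin d) ℝ (EuclideanSpace ℝ (Fin d))) (s ρ : ℝ) {k : ℕ}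
    (g : Fin k → EuclideanSpace ℝ (Fin d)) (γ : EuclideanSpace ℝ (Fin d)) :
    Set (EuclideanSpace ℝ (Fin d)) :=
  {h | ∃ v ∈ resonanceBlock b ρ g, ∃ a ∈ dualLattice b,
    ‖a‖ < pOne d s * ρ ^ alpha d ∧ h = γ + v + a}

theorem dualLattice_ball_finite (b : Module.Basis (Fin d) ℝ (EuclideanSpace ℝ (Fin d)))
    (r : ℝ) : {γ | γ ∈ dualLattice b ∧ ‖γ‖ < r}.Finite := by
  have hint : ∀ i : Fin d, {y : ℝ | ∃ n : ℤ, y = 2 * Real.pi * n ∧ |y| ≤ r * ‖b i‖}.Finite := by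
    intro i
    refine ((Set.finite_Icc (-⌈r * ‖b i‖⌉) ⌈r * ‖b i‖⌉).image
      (fun n : ℤ => 2 * Real.pi * (n : ℝ))).subset ?_
    rintro y ⟨n, rfl, hn⟩
    refine ⟨n, ?_, rfl⟩
    have hpi : (1 : ℝ) ≤ 2 * Real.pi := by linarith [Real.pi_gt_three]
    have h1 : |(n : ℝ)| ≤ r * ‖b i‖ := by
      refine le_trans ?_ hn
      rw [abs_mul, abs_of_pos (by positivity : (0 : ℝ) < 2 * Real.pi)]
      nlinarith [abs_nonneg (n : ℝ)]
    have h2 : |(n : ℝ)| ≤ (⌈r * ‖b i‖⌉ : ℝ) := h1.trans (Int.le_ceil _)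
    rw [abs_le] at h2
    exact ⟨by exact_mod_cast h2.1, by exact_mod_cast h2.2⟩
  refine Set.Finite.of_finite_image (f := fun γ (i : Fin d) => (inner ℝ γ (b i) : ℝ))
    ((Set.Finite.pi' hint).subset ?_) ?_
  · rintro _ ⟨γ, ⟨hγ, hr⟩, rfl⟩ i
    obtain ⟨n, hn⟩ := hγ (b i) (Submodule.subset_span ⟨i, rfl⟩)
    refine ⟨n, hn, (abs_real_inner_le_norm _ _).trans ?_⟩
    exact mul_le_mul_of_nonneg_right hr.le (norm_nonneg _)
  · intro x _ y _ hxy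
    exact InnerProductSpace.ext_inner_right_basis b fun i => congrFun hxy i

theorem indexSet_finite (b : Module.Basis (Fin d) ℝ (EuclideanSpace ℝ (Fin d))) (s ρ : ℝ) {k : ℕ}
    (g : Fin k → EuclideanSpace ℝ (Fin d)) (γ : EuclideanSpace ℝ (Fin d)) :
    (indexSet b s ρ g γ).Finite := by
  refine (((dualLattice_ball_finite b (1 / 2 * ρ ^ (1 / 2 * alphaK d (k + 1)))).prod
    (dualLattice_ball_finite b (pOne d s * ρ ^ alpha d))).image
      (fun z => γ + z.1 + z.2)).subset ?_
  rintro h ⟨v, ⟨hv, -, hvn⟩, a, ha, han, rfl⟩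
  exact ⟨(v, a), ⟨⟨hv, hvn⟩, ⟨ha, han⟩⟩, rfl⟩

/-- The vectors `h₁, …, h_{b_k}` as a finite set. -/
def indexFinset (b : Module.Basis (Fin d) ℝ (EuclideanSpace ℝ (Fin d))) (s ρ : ℝ) {k : ℕ}
    (g : Fin k → EuclideanSpace ℝ (Fin d)) (γ : EuclideanSpace ℝ (Fin d)) :
    Finset (EuclideanSpace ℝ (Fin d)) :=
  (indexSet_finite b s ρ g γ).toFinset

open Classical in
/-- The matrix `C(γ + t, γ₁, …, γ_k)`, with rows and columns indexed by the vectors `hᵢ`: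
`c_{ii} = |hᵢ + t|²`, and `c_{ij} = q_{hᵢ - h_j}` for `i ≠ j`. -/
def resonanceMatrix (b : Module.Basis (Fin d) ℝ (EuclideanSpace ℝ (Fin d)))
    (q : EuclideanSpace ℝ (Fin d) → ℝ) (s ρ : ℝ) {k : ℕ}
    (g : Fin k → EuclideanSpace ℝ (Fin d)) (γ t : EuclideanSpace ℝ (Fin d)) :
    Matrix (indexFinset b s ρ g γ) (indexFinset b s ρ g γ) ℂ :=
  Matrix.of fun h h' =>
    if h = h' then ((‖(h : EuclideanSpace ℝ (Fin d)) + t‖ ^ 2 : ℝ) : ℂ)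
    else potCoeff b q ((h : EuclideanSpace ℝ (Fin d)) - (h' : EuclideanSpace ℝ (Fin d)))

/-- `μ` is an eigenvalue of the matrix `M`. -/
def IsMatrixEigenvalue {ι : Type*} [Fintype ι] (M : Matrix ι ι ℂ) (μ : ℝ) : Prop :=
  ∃ v : ι → ℂ, v ≠ 0 ∧ M.mulVec v = (μ : ℂ) • v

end PeriodicSchrodinger

end

/-!
The proof works with the Fourier coefficients `b(N, γ)` of a Bloch function. Testing the weak
eigenvalue equation against plane waves gives the convolution equation
`(Λ - |γ + t|²) b(N, γ) = ∑ q_{γ'} b(N, γ - γ')`, and the Sobolev condition makes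
`∑ |q_γ| |γ|^p` finite, so that restricting the sum to `|γ'| < ρ^α` costs `O(ρ^{-pα})`. These facts
are collected in `IsCoeffSystem`, and both asymptotic formulas are proved for such systems.

*Resonant case.* Let `x = γ + t` have resonance order exactly `k`, along `γ₁, …, γ_k`. Cramer's rule
over the integers shows that `x` is nearly orthogonal to the span of the `γᵢ`
(`exists_abs_inner_le_of_resonance`). Hence a lattice vector leaving the block `B_k` changes the
energy by order `ρ^{α_{k+1}}`: inside the span because of this near-orthogonality, transversally
because `x` is in no resonance domain of order `k + 1` (`exists_energy_gap`). Using the eigenvalue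
equation `p₁` times, each time dividing by this gap, makes the coefficients just outside the block
`O(ρ^{-pα})` (`exists_norm_coeff_le_off_block`). The coefficients inside it then form an approximate
eigenvector of the Hermitian matrix `C`, with an entry of size at least `c₅ ρ^{-cα}`, and the matrix
has size `O(ρ^{d 3^d α / 2})`; the spectral theorem gives an eigenvalue within the stated distance
(`exists_resonance_estimate`).

*Non-resonant case.* All energies `|x - σ|²` with `σ ≠ 0` short are at distance of order `ρ^{α₁}`
from `Λ`. Substituting the equation into itself `p₁` times and collecting the terms that return to
`γ` gives `Λ - |x|² = ∑ S_k(Λ, x)` up to a small error (`IsCoeffSystem.norm_expansion_le`). The right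
side is a contraction in its first argument, and each `F_j` is one more step of the fixed-point
iteration started at `|x|²`, gaining a factor `ρ^{-α₁}` (`norm_sub_corrF_le`,
`exists_nonresonance_estimate`).

*Choice of `γ`.* By Parseval's identity the coefficients at energies at distance at least
`ρ^{α₁} / 2` from `Λ` carry at most a quarter of the mass, while `O(ρ^{d-1})` lattice points remain;
one of them has a coefficient of order at least `ρ^{-(d-1)/2} = ρ^{-cα}` (`exists_large_coeff`). The
point found is either non-resonant or of some resonance order between `1` and `d - 1`, since a point
of order `d` would be nearly orthogonal to all of `ℝᵈ`, in particular to itself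
(`exists_resonanceUnion_top_eq_empty`).
-/

namespace PeriodicSchrodinger

section

/-! ### The dual lattice -/

/-- The Euclidean space `ℝᵈ`. -/
abbrev Space (d : ℕ) := EuclideanSpace ℝ (Fin d)

variable {d : ℕ} (b : Module.Basis (Fin d) ℝ (Space d))

/-- The vector `γ` of the dual lattice with `(γ, bᵢ) = 2π nᵢ`. -/
noncomputable def dualVec (n : Fin d → ℤ) : Space d :=
  (InnerProductSpace.toDual ℝ (Space d)).symm
    (LinearMap.toContinuousLinearMap (∑ i, (2 * Real.pi * n i) • b.coord i))

theorem inner_dualVec (n : Fin d → ℤ) (x : Space d) :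
    inner ℝ (dualVec b n) x = 2 * Real.pi * ∑ i, n i * b.repr x i := by
  rw [dualVec, InnerProductSpace.toDual_symm_apply]
  simp [Finset.mul_sum, mul_assoc]

theorem inner_dualVec_basis (n : Fin d → ℤ) (i : Fin d) :
    inner ℝ (dualVec b n) (b i) = 2 * Real.pi * n i := by
  rw [inner_dualVec]
  simp [Finsupp.single_apply]

theorem eq_of_inner_basis {x y : Space d} (h : ∀ i, inner ℝ x (b i) = inner ℝ y (b i)) : x = y :=
  InnerProductSpace.ext_inner_right_basis b h

theorem dualVec_mem (n : Fin d → ℤ) : dualVec b n ∈ dualLattice b := by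
  intro ω hω
  refine Submodule.span_induction (p := fun ω _ => ∃ m : ℤ, inner ℝ (dualVec b n) ω = 2 * Real.pi * m)
    ?_ ?_ ?_ ?_ hω
  · rintro _ ⟨i, rfl⟩
    exact ⟨n i, inner_dualVec_basis b n i⟩
  · exact ⟨0, by simp⟩
  · rintro x y - - ⟨m, hm⟩ ⟨m', hm'⟩
    exact ⟨m + m', by rw [inner_add_right, hm, hm']; push_cast; ring⟩
  · rintro a x - ⟨m, hm⟩
    refine ⟨a * m, ?_⟩
    rw [← Int.cast_smul_eq_zsmul ℝ a x, inner_smul_right, hm]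
    push_cast; ring

theorem exists_dualVec_eq {γ : Space d} (hγ : γ ∈ dualLattice b) : ∃ n, dualVec b n = γ := by
  choose n hn using fun i => hγ (b i) (Submodule.subset_span ⟨i, rfl⟩)
  exact ⟨n, eq_of_inner_basis b fun i => by rw [inner_dualVec_basis, hn]⟩

theorem dualVec_injective : Function.Injective (dualVec b) := by
  intro m n h
  funext i
  have h1 := inner_dualVec_basis b m i
  rw [h, inner_dualVec_basis] at h1
  have := mul_left_cancel₀ Real.two_pi_pos.ne' h1
  exact_mod_cast this.symm

/-- Integer coordinates on the dual lattice. -/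
noncomputable def dualEquiv : (Fin d → ℤ) ≃ dualLattice b :=
  Equiv.ofBijective (fun n => ⟨dualVec b n, dualVec_mem b n⟩)
    ⟨fun _ _ h => dualVec_injective b (congrArg Subtype.val h),
      fun γ => (exists_dualVec_eq b γ.2).imp fun _ h => Subtype.ext h⟩

variable {b}

theorem zero_mem_dualLattice : (0 : Space d) ∈ dualLattice b := fun _ _ => ⟨0, by simp⟩

theorem add_mem_dualLattice {x y : Space d} (hx : x ∈ dualLattice b) (hy : y ∈ dualLattice b) :
    x + y ∈ dualLattice b := by
  intro ω hω
  obtain ⟨m, hm⟩ := hx ω hω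
  obtain ⟨n, hn⟩ := hy ω hω
  exact ⟨m + n, by rw [inner_add_left, hm, hn]; push_cast; ring⟩

theorem neg_mem_dualLattice {x : Space d} (hx : x ∈ dualLattice b) : -x ∈ dualLattice b := by
  intro ω hω
  obtain ⟨m, hm⟩ := hx ω hω
  exact ⟨-m, by rw [inner_neg_left, hm]; push_cast; ring⟩

theorem sub_mem_dualLattice {x y : Space d} (hx : x ∈ dualLattice b) (hy : y ∈ dualLattice b) :
    x - y ∈ dualLattice b :=
  sub_eq_add_neg x y ▸ add_mem_dualLattice hx (neg_mem_dualLattice hy)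

theorem sum_mem_dualLattice {ι : Type*} (S : Finset ι) {f : ι → Space d}
    (h : ∀ i ∈ S, f i ∈ dualLattice b) : ∑ i ∈ S, f i ∈ dualLattice b := by
  classical
  induction S using Finset.induction_on with
  | empty => simpa using zero_mem_dualLattice
  | insert a S ha ih =>
    rw [Finset.sum_insert ha]
    exact add_mem_dualLattice (h a (by simp)) (ih fun i hi => h i (by simp [hi]))

variable (b)

/-- A common bound for the coordinates of a dual vector in terms of its norm. -/
noncomputable def coordConst : ℝ := 1 + ∑ i, ‖b i‖

theorem coordConst_pos : 0 < coordConst b := by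
  unfold coordConst; positivity

theorem abs_coord_le (n : Fin d → ℤ) (i : Fin d) :
    |(n i : ℝ)| ≤ coordConst b * ‖dualVec b n‖ := by
  have h1 : 2 * Real.pi * |(n i : ℝ)| ≤ ‖dualVec b n‖ * ‖b i‖ := by
    rw [← abs_of_pos Real.two_pi_pos, ← abs_mul, ← inner_dualVec_basis b]
    exact abs_real_inner_le_norm _ _
  have h2 : ‖b i‖ ≤ coordConst b := by
    have := Finset.single_le_sum (f := fun i => ‖b i‖) (fun i _ => norm_nonneg _)
      (Finset.mem_univ i)
    simp only [coordConst]; linarith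
  have h3 : |(n i : ℝ)| ≤ 2 * Real.pi * |(n i : ℝ)| :=
    le_mul_of_one_le_left (abs_nonneg _) (by linarith [Real.pi_gt_three])
  calc _ ≤ ‖dualVec b n‖ * ‖b i‖ := h3.trans h1
    _ ≤ ‖dualVec b n‖ * coordConst b := by gcongr
    _ = _ := mul_comm _ _

/-- Nonzero dual vectors, hence also distances of distinct ones, are bounded below in norm. -/
theorem exists_norm_lower_bound :
    ∃ δ : ℝ, 0 < δ ∧ ∀ γ ∈ dualLattice b, γ ≠ 0 → δ ≤ ‖γ‖ := by
  refine ⟨(coordConst b)⁻¹, inv_pos.2 (coordConst_pos b), ?_⟩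
  intro γ hγ h0
  obtain ⟨n, rfl⟩ := exists_dualVec_eq b hγ
  obtain ⟨i, hi⟩ : ∃ i, n i ≠ 0 := by
    by_contra! h
    exact h0 (eq_of_inner_basis b fun i => by rw [inner_dualVec_basis, h i]; simp)
  have h1 : (1 : ℝ) ≤ |(n i : ℝ)| := by exact_mod_cast Int.one_le_abs hi
  rw [inv_le_iff_one_le_mul₀' (coordConst_pos b)]
  exact h1.trans (abs_coord_le b n i)

/-- Volume comparison: disjoint balls of radius `δ` around the points of a `2δ`-separated set in
a spherical shell fit in the `δ`-neighbourhood of the shell. -/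
theorem card_mul_pow_le_of_separated [NeZero d] {S : Finset (Space d)} {δ r₁ r₂ : ℝ} (hδ : 0 < δ)
    (hr : 0 ≤ r₁) (hr2 : r₁ ≤ r₂)
    (hsep : ∀ x ∈ S, ∀ y ∈ S, x ≠ y → 2 * δ ≤ ‖x - y‖)
    (hlow : ∀ x ∈ S, r₁ + δ ≤ ‖x‖) (hup : ∀ x ∈ S, ‖x‖ + δ ≤ r₂) :
    (S.card : ℝ) * δ ^ d ≤ r₂ ^ d - r₁ ^ d := by
  have : Nontrivial (Space d) := by
    have : Nonempty (Fin d) := ⟨0⟩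
    infer_instance
  let μ : Measure (Space d) := volume
  set v := μ (Metric.ball 0 1) with hv
  have hv0 : v ≠ 0 := (Metric.measure_ball_pos μ _ one_pos).ne'
  have hvt : v ≠ ⊤ := measure_ball_lt_top.ne
  have hball : ∀ (x : Space d) {r : ℝ}, 0 ≤ r → μ (Metric.ball x r) = ENNReal.ofReal (r ^ d) * v := by
    intro x r hr
    rw [Measure.addHaar_ball μ x hr, finrank_euclideanSpace_fin]
  have hdisj : (S : Set (Space d)).PairwiseDisjoint fun x => Metric.ball x δ := by
    intro x hx y hy hxy
    apply Metric.ball_disjoint_ball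
    rw [dist_eq_norm]
    linarith [hsep x hx y hy hxy]
  have h1 : μ (⋃ x ∈ S, Metric.ball x δ) = S.card * (ENNReal.ofReal (δ ^ d) * v) := by
    rw [measure_biUnion_finset hdisj fun _ _ => measurableSet_ball]
    simp [hball _ hδ.le]
  have hsub : (⋃ x ∈ S, Metric.ball x δ) ∪ Metric.ball 0 r₁ ⊆ Metric.ball (0 : Space d) r₂ := by
    apply Set.union_subset
    · refine Set.iUnion₂_subset fun x hx y hy => ?_
      rw [mem_ball_zero_iff]
      rw [Metric.mem_ball, dist_eq_norm] at hy
      have : ‖y‖ ≤ ‖y - x‖ + ‖x‖ := by simpa using norm_add_le (y - x) x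
      linarith [hup x hx]
    · exact Metric.ball_subset_ball hr2
  have hd2 : Disjoint (⋃ x ∈ S, Metric.ball x δ) (Metric.ball (0 : Space d) r₁) := by
    rw [Set.disjoint_iUnion₂_left]
    intro x hx
    apply Metric.ball_disjoint_ball
    rw [dist_zero_right]
    linarith [hlow x hx]
  have h2 := measure_mono (μ := μ) hsub
  rw [measure_union hd2 measurableSet_ball, h1, hball _ hr, hball _ (hr.trans hr2), ← mul_assoc,
    ← add_mul, ENNReal.mul_le_mul_iff_left hv0 hvt, ← ENNReal.ofReal_natCast,
    ← ENNReal.ofReal_mul (by positivity), ← ENNReal.ofReal_add (by positivity) (by positivity),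
    ENNReal.ofReal_le_ofReal_iff (by have := hr.trans hr2; positivity)] at h2
  linarith

/-- The number of dual vectors in a ball of radius `r ≥ 1` is `O(rᵈ)`. -/
theorem exists_card_ball_le [NeZero d] : ∃ C : ℝ, 0 < C ∧ ∀ r : ℝ, 1 ≤ r → ∀ S : Finset (Space d),
    (∀ x ∈ S, x ∈ dualLattice b ∧ ‖x‖ ≤ r) → (S.card : ℝ) ≤ C * r ^ d := by
  classical
  obtain ⟨δ, hδ, hsep⟩ := exists_norm_lower_bound b
  refine ⟨1 + ((1 + δ / 2) / (δ / 2)) ^ d, by positivity, ?_⟩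
  intro r hr S hS
  have key := card_mul_pow_le_of_separated (S := S.erase 0) (δ := δ / 2) (r₁ := 0) (r₂ := r + δ / 2)
    (by positivity) le_rfl (by positivity)
    (fun x hx y hy hxy => by
      have := hsep (x - y) (sub_mem_dualLattice (hS x (Finset.mem_of_mem_erase hx)).1
        (hS y (Finset.mem_of_mem_erase hy)).1) (sub_ne_zero.2 hxy)
      linarith)
    (fun x hx => by
      have := hsep x (hS x (Finset.mem_of_mem_erase hx)).1 (Finset.ne_of_mem_erase hx)
      linarith)
    (fun x hx => by linarith [(hS x (Finset.mem_of_mem_erase hx)).2])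
  have h1 : ((S.erase 0).card : ℝ) ≤ (r * ((1 + δ / 2) / (δ / 2))) ^ d := by
    rw [← mul_div_assoc, div_pow, le_div_iff₀ (by positivity)]
    refine key.trans ?_
    have : (r + δ / 2) ^ d ≤ (r * (1 + δ / 2)) ^ d := by
      gcongr; nlinarith
    have : (0 : ℝ) ≤ 0 ^ d := by positivity
    linarith
  have h2 : (S.card : ℝ) ≤ (S.erase 0).card + 1 := by
    exact_mod_cast Nat.sub_le_iff_le_add.1 (Finset.pred_card_le_card_erase (a := (0 : Space d)))
  have h3 : (1 : ℝ) ≤ r ^ d := one_le_pow₀ hr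
  rw [mul_pow] at h1
  nlinarith

/-- The number of points of a translate of the dual lattice in a shell of radius `r` and bounded
width is `O(r^{d-1})`. -/
theorem exists_card_shell_le [NeZero d] : ∃ C : ℝ, 0 < C ∧ ∀ r : ℝ, 0 ≤ r → ∀ t : Space d,
    ∀ S : Finset (Space d),
    (∀ x ∈ S, x ∈ dualLattice b ∧ r ≤ ‖x + t‖ ∧ ‖x + t‖ ≤ r + 1) →
      (S.card : ℝ) ≤ C * (r + 1) ^ (d - 1) := by
  classical
  obtain ⟨δ₀, hδ₀, hsep₀⟩ := exists_norm_lower_bound b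
  obtain ⟨δ, hδ, hδ1, hsep⟩ : ∃ δ : ℝ, 0 < δ ∧ δ ≤ 1 ∧ ∀ γ ∈ dualLattice b, γ ≠ 0 → 2 * δ ≤ ‖γ‖ :=
    ⟨min (δ₀ / 2) 1, by positivity, min_le_right _ _, fun γ hγ h0 => by
      linarith [hsep₀ γ hγ h0, min_le_left (δ₀ / 2) 1]⟩
  refine ⟨4 * d * 4 ^ (d - 1) / δ ^ d, by have := NeZero.pos d; positivity, ?_⟩
  intro r hr t S hS
  have key : (S.card : ℝ) * δ ^ d ≤ 4 * d * (4 * (r + 1)) ^ (d - 1) := by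
    have hd : ∀ a c : ℝ, 0 ≤ a → a ≤ c → c ≤ a + 4 → c ≤ 4 * (r + 1) →
        c ^ d - a ^ d ≤ 4 * d * (4 * (r + 1)) ^ (d - 1) := by
      intro a c ha hac hca hc
      have hc0 : 0 ≤ c := ha.trans hac
      have h1 : c ^ d - a ^ d = (c - a) * ∑ i ∈ Finset.range d, c ^ i * a ^ (d - 1 - i) := by
        rw [mul_comm]; exact (Commute.geom_sum₂_mul (Commute.all c a) d).symm
      have h2 : ∑ i ∈ Finset.range d, c ^ i * a ^ (d - 1 - i) ≤
          ∑ i ∈ Finset.range d, (4 * (r + 1)) ^ (d - 1) := by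
        apply Finset.sum_le_sum
        intro i hi
        have : d - 1 = i + (d - 1 - i) := by have := Finset.mem_range.1 hi; omega
        conv_rhs => rw [this, pow_add]
        gcongr
        exact hac.trans hc
      rw [h1]
      calc _ ≤ 4 * ∑ i ∈ Finset.range d, (4 * (r + 1)) ^ (d - 1) := by
            gcongr
            linarith
        _ = _ := by simp [mul_assoc]
    -- The points are translated by `t`; close to the origin no inner ball is removed.
    have hinj : Function.Injective (fun x : Space d => x + t) := add_left_injective t
    have hsep' : ∀ x ∈ S.image (· + t), ∀ y ∈ S.image (· + t), x ≠ y → 2 * δ ≤ ‖x - y‖ := by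
      simp only [Finset.mem_image]
      rintro _ ⟨x, hx, rfl⟩ _ ⟨y, hy, rfl⟩ hxy
      have : x - y ≠ 0 := fun h => hxy (by rw [sub_eq_zero.1 h])
      simpa using hsep (x - y) (sub_mem_dualLattice (hS x hx).1 (hS y hy).1) this
    by_cases hrd : δ ≤ r
    · have := card_mul_pow_le_of_separated (S := S.image (· + t)) (r₁ := r - δ) (r₂ := r + 1 + δ)
        hδ (by linarith) (by linarith) hsep'
        (by simp only [Finset.mem_image]
            rintro _ ⟨x, hx, rfl⟩; linarith [(hS x hx).2.1])
        (by simp only [Finset.mem_image]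
            rintro _ ⟨x, hx, rfl⟩; linarith [(hS x hx).2.2])
      rw [Finset.card_image_of_injective _ hinj] at this
      exact this.trans (hd _ _ (by linarith) (by linarith) (by linarith) (by linarith))
    · have hcard := card_mul_pow_le_of_separated (S := (S.image (· + t)).filter (δ ≤ ‖·‖))
        (r₁ := 0) (r₂ := r + 1 + δ) hδ le_rfl (by linarith)
        (fun x hx y hy => hsep' x (Finset.mem_filter.1 hx).1 y (Finset.mem_filter.1 hy).1)
        (fun x hx => by simpa using (Finset.mem_filter.1 hx).2)
        (by simp only [Finset.mem_filter, Finset.mem_image]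
            rintro _ ⟨⟨x, hx, rfl⟩, -⟩; linarith [(hS x hx).2.2])
      have hone : ((S.image (· + t)).filter (¬ δ ≤ ‖·‖)).card ≤ 1 := by
        rw [Finset.card_le_one]
        intro x hx y hy
        by_contra hxy
        have h1 := hsep' x (Finset.mem_filter.1 hx).1 y (Finset.mem_filter.1 hy).1 hxy
        have h2 := (Finset.mem_filter.1 hx).2
        have h3 := (Finset.mem_filter.1 hy).2
        have h4 := norm_sub_le x y
        linarith
      have hsum := Finset.card_filter_add_card_filter_not (s := S.image (· + t)) (δ ≤ ‖·‖)
      rw [Finset.card_image_of_injective _ hinj] at hsum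
      have h5 : (S.card : ℝ) ≤ ((S.image (· + t)).filter (δ ≤ ‖·‖)).card + 1 := by
        exact_mod_cast hsum ▸ Nat.add_le_add_left hone _
      have h6 := hd 0 (r + 1 + δ + 1) le_rfl (by linarith) (by linarith) (by linarith)
      have h7 : (r + 1 + δ) ^ d + δ ^ d ≤ (r + 1 + δ + 1) ^ d := by
        have : (r + 1 + δ) ^ d + δ ^ d ≤ (r + 1 + δ + δ) ^ d :=
          pow_add_pow_le (by linarith) hδ.le (NeZero.ne d)
        refine this.trans ?_
        gcongr
      have h8 : (0 : ℝ) ^ d = 0 := zero_pow (NeZero.ne d)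
      have h9 : (0 : ℝ) < δ ^ d := by positivity
      nlinarith
  rw [div_mul_eq_mul_div, le_div_iff₀ (by positivity)]
  calc _ ≤ _ := key
    _ = _ := by rw [mul_pow]; ring

end

section

/-! ### Coefficients with respect to linearly independent lattice vectors -/

/-- Cramer's rule with integer data: the vectors are completed by unit vectors to `d` independent
integer vectors, whose determinant is a nonzero integer, so that a coefficient is bounded by the
determinant in which its vector has been replaced by the given combination. -/
theorem abs_coeff_le_of_linearIndependent_int {k d : ℕ} (z : Fin k → Fin d → ℤ)
    (hz : LinearIndependent ℝ (fun i j => (z i j : ℝ))) {R V : ℝ}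
    (hzR : ∀ i j, |(z i j : ℝ)| ≤ R) (c : Fin k → ℝ) (hV : ∀ j, |∑ i, c i * z i j| ≤ V)
    (i : Fin k) : |c i| ≤ d.factorial * (V * R ^ (k - 1)) := by
  classical
  set w : Fin k → Fin d → ℝ := fun i j => (z i j : ℝ) with hw
  have hwinj : Function.Injective w := hz.injective
  obtain ⟨B, hBt, hsB, hspan, hBind⟩ := exists_linearIndepOn_extension (v := id)
    (t := Set.range w ∪ Set.range (fun j : Fin d => (Pi.single j 1 : Fin d → ℝ)))
    hz.linearIndepOn_id Set.subset_union_left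
  have htop : ⊤ ≤ Submodule.span ℝ (Set.range ((↑) : B → Fin d → ℝ)) := by
    rw [Subtype.range_coe]
    have h1 : Submodule.span ℝ (Set.range (fun j : Fin d => (Pi.single j 1 : Fin d → ℝ))) = ⊤ := by
      have := (Pi.basisFun ℝ (Fin d)).span_eq
      rwa [show ⇑(Pi.basisFun ℝ (Fin d)) = fun j => (Pi.single j 1 : Fin d → ℝ) from
        funext fun j => Pi.basisFun_apply ℝ (Fin d) j] at this
    rw [← h1]
    simp only [Set.image_id] at hspan
    exact Submodule.span_le.2 (Set.subset_union_right.trans hspan)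
  let bas : Module.Basis B ℝ (Fin d → ℝ) := Module.Basis.mk hBind htop
  have hfin : Fintype B := FiniteDimensional.fintypeBasisIndex bas
  have hcard : Fintype.card (Fin d) = Fintype.card B := by
    rw [← Module.finrank_eq_card_basis bas]; simp
  let e : Fin d ≃ B := Fintype.equivOfCardEq hcard
  let A : Matrix (Fin d) (Fin d) ℝ := Matrix.of fun r => (e r : Fin d → ℝ)
  have hAind : LinearIndependent ℝ A.row := by
    have := hBind.linearIndependent.comp e e.injective
    exact this
  have hAdet : A.det ≠ 0 := by
    have := Matrix.linearIndependent_rows_iff_isUnit.1 hAind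
    exact ((Matrix.isUnit_iff_isUnit_det A).1 this).ne_zero
  have hint : ∀ r, ∃ y : Fin d → ℤ, ∀ j, A r j = y j := by
    intro r
    rcases hBt (e r).2 with ⟨i, hi⟩ | ⟨j, hj⟩
    · exact ⟨z i, fun j => (congrFun hi j).symm⟩
    · refine ⟨Pi.single j 1, fun l => ?_⟩
      rw [show A r l = (e r : Fin d → ℝ) l from rfl, ← hj]
      by_cases h : l = j
      · subst h; simp
      · simp [h]
  choose Z hZ using hint
  have hAdet1 : 1 ≤ |A.det| := by
    have h1 : A = (Matrix.of Z).map (Int.cast : ℤ → ℝ) := by ext r j; simp [hZ]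
    have h2 : A.det = ((Matrix.of Z).det : ℝ) := by
      rw [h1]; exact (Int.cast_det _).symm
    rw [h2] at hAdet ⊢
    have : (Matrix.of Z).det ≠ 0 := by exact_mod_cast hAdet
    exact_mod_cast Int.one_le_abs this
  let f : Fin k → Fin d := fun i => e.symm ⟨w i, hsB ⟨i, rfl⟩⟩
  have hf : ∀ i, A (f i) = w i := by
    intro i
    exact congrArg Subtype.val (e.apply_symm_apply ⟨w i, hsB ⟨i, rfl⟩⟩)
  have hfinj : Function.Injective f := fun i j h => by
    apply hwinj; rw [← hf i, ← hf j, h]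
  let c' : Fin d → ℝ := fun r => ∑ i, if f i = r then c i else 0
  have hc' : ∀ i, c' (f i) = c i := by
    intro i
    simp [c', hfinj.eq_iff]
  set v : Fin d → ℝ := ∑ r, c' r • A r with hv
  have hveq : v = ∑ i, c i • w i := by
    simp only [hv, c', Finset.sum_smul]
    rw [Finset.sum_comm]
    refine Finset.sum_congr rfl fun i _ => ?_
    simp [ite_smul, hf]
  have hvV : ∀ j, |v j| ≤ V := by
    intro j
    rw [hveq]
    simpa [Finset.sum_apply, hw] using hV j
  have hV0 : 0 ≤ V := by
    by_cases hd : Nonempty (Fin d)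
    · exact (abs_nonneg _).trans (hV hd.some)
    · exact absurd ⟨f i⟩ hd
  have hdet : (A.updateRow (f i) v).det = c i * A.det := by
    rw [hv, Matrix.det_updateRow_sum, hc', smul_eq_mul]
  let β : Fin d → ℝ := fun r => if r = f i then V else
    if r ∈ Finset.univ.image f then R else 1
  have hβ : ∀ r j, |A.updateRow (f i) v r j| ≤ β r := by
    intro r j
    by_cases hr : r = f i
    · subst hr
      simpa [β] using hvV j
    · rw [Matrix.updateRow_ne hr]
      simp only [β, hr, if_false]
      split_ifs with hrf
      · obtain ⟨l, -, rfl⟩ := Finset.mem_image.1 hrf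
        rw [hf]
        exact hzR l j
      · rcases hBt (e r).2 with ⟨l, hl⟩ | ⟨l, hl⟩
        · refine absurd (Finset.mem_image.2 ⟨l, Finset.mem_univ _, ?_⟩) hrf
          rw [Equiv.symm_apply_eq]
          exact Subtype.ext hl
        · rw [show A r j = (e r : Fin d → ℝ) j from rfl, ← hl]
          by_cases h : j = l
          · subst h; simp
          · simp [h]
  have hβprod : ∏ r, β r = V * R ^ (k - 1) := by
    rw [← Finset.mul_prod_erase _ _ (Finset.mem_univ (f i))]
    have h1 : ∀ r ∈ Finset.univ.erase (f i),
        β r = if r ∈ Finset.univ.image f then R else 1 := by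
      intro r hr
      simp only [β, Finset.ne_of_mem_erase hr, if_false]
    rw [Finset.prod_congr rfl h1, Finset.prod_ite]
    have h2 : (Finset.univ.erase (f i)).filter (· ∈ Finset.univ.image f) =
        (Finset.univ.image f).erase (f i) := by
      ext r; simp [and_comm]
    rw [h2, Finset.prod_const, Finset.prod_const_one, mul_one,
      Finset.card_erase_of_mem (Finset.mem_image_of_mem _ (Finset.mem_univ _)),
      Finset.card_image_of_injective _ hfinj]
    simp [β]
  have hbound : |(A.updateRow (f i) v).det| ≤ d.factorial * (V * R ^ (k - 1)) := by
    rw [Matrix.det_apply]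
    refine (Finset.abs_sum_le_sum_abs _ _).trans ?_
    have : ∀ σ ∈ (Finset.univ : Finset (Equiv.Perm (Fin d))),
        |Equiv.Perm.sign σ • ∏ j, A.updateRow (f i) v (σ j) j| ≤ V * R ^ (k - 1) := by
      intro σ _
      have hs : |Equiv.Perm.sign σ • ∏ j, A.updateRow (f i) v (σ j) j| =
          |∏ j, A.updateRow (f i) v (σ j) j| := by
        rcases Int.units_eq_one_or (Equiv.Perm.sign σ) with h | h <;> simp [h]
      rw [hs, Finset.abs_prod, ← hβprod, ← Equiv.prod_comp σ β]
      exact Finset.prod_le_prod (fun _ _ => abs_nonneg _) fun j _ => hβ _ _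
    refine (Finset.sum_le_sum this).trans ?_
    simp [Finset.card_univ, Fintype.card_perm]
  rw [hdet, abs_mul] at hbound
  exact (le_mul_of_one_le_right (abs_nonneg _) hAdet1).trans hbound

variable {d : ℕ} (b : Module.Basis (Fin d) ℝ (Space d))

/-- The coordinates `(x, bᵢ) / 2π`, which are integers exactly on the dual lattice. -/
noncomputable def coordMap : Space d →ₗ[ℝ] (Fin d → ℝ) :=
  LinearMap.pi fun i => (2 * Real.pi)⁻¹ • (innerₗ (Space d) (b i))

theorem coordMap_apply (x : Space d) (i : Fin d) :
    coordMap b x i = (2 * Real.pi)⁻¹ * inner ℝ (b i) x := rfl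

theorem coordMap_dualVec (n : Fin d → ℤ) (i : Fin d) : coordMap b (dualVec b n) i = n i := by
  rw [coordMap_apply, real_inner_comm, inner_dualVec_basis, inv_mul_cancel_left₀ Real.two_pi_pos.ne']

theorem coordMap_injective : Function.Injective (coordMap b) := by
  intro x y h
  refine eq_of_inner_basis b fun i => ?_
  have := congrFun h i
  rw [coordMap_apply, coordMap_apply] at this
  rw [real_inner_comm, real_inner_comm (b i) y]
  exact mul_left_cancel₀ (inv_ne_zero Real.two_pi_pos.ne') this

theorem abs_coordMap_le (x : Space d) (i : Fin d) : |coordMap b x i| ≤ coordConst b * ‖x‖ := by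
  have h2 : ‖b i‖ ≤ coordConst b := by
    have := Finset.single_le_sum (f := fun i => ‖b i‖) (fun i _ => norm_nonneg _)
      (Finset.mem_univ i)
    simp only [coordConst]; linarith
  have h3 : (2 * Real.pi)⁻¹ ≤ 1 := inv_le_one_of_one_le₀ (by linarith [Real.pi_gt_three])
  rw [coordMap_apply, abs_mul, abs_of_pos (inv_pos.2 Real.two_pi_pos)]
  calc _ ≤ 1 * (‖b i‖ * ‖x‖) := by
        gcongr; exact abs_real_inner_le_norm _ _
    _ ≤ _ := by rw [one_mul]; gcongr

/-- If the inner products of `x` with linearly independent dual vectors of length at most `R` are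
at most `M`, then `x` is nearly orthogonal to their span. -/
theorem exists_abs_inner_le_of_mem_span : ∃ C : ℝ, 0 < C ∧ ∀ (k : ℕ) (g : Fin k → Space d)
    (R M : ℝ) (x v : Space d), 1 ≤ R → (∀ i, g i ∈ dualLattice b) → (∀ i, ‖g i‖ ≤ R) →
    LinearIndependent ℝ g → (∀ i, |inner ℝ x (g i)| ≤ M) →
    v ∈ Submodule.span ℝ (Set.range g) → |inner ℝ x v| ≤ C * (R ^ (k - 1) * M * ‖v‖) := by
  have hc := coordConst_pos b
  set C₀ := coordConst b with hC₀
  have hC1 : 1 ≤ C₀ := by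
    rw [hC₀, coordConst]; linarith [Finset.sum_nonneg fun i (_ : i ∈ Finset.univ) => norm_nonneg (b i)]
  refine ⟨(d + 1) * (d.factorial * C₀ ^ (d + 1)), by positivity, ?_⟩
  intro k g R M x v hR hg hgR hind hM hv
  choose z hz using fun i => exists_dualVec_eq b (hg i)
  obtain ⟨c, rfl⟩ := (Submodule.mem_span_range_iff_exists_fun ℝ).1 hv
  have hkd : k ≤ d := by
    simpa using hind.fintype_card_le_finrank
  set v := ∑ i, c i • g i with hvdef
  have hcoord : ∀ i j, coordMap b (g i) j = z i j := fun i j => by rw [← hz i, coordMap_dualVec]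
  have hind' : LinearIndependent ℝ (fun i j => (z i j : ℝ)) := by
    have := hind.map' (coordMap b) (LinearMap.ker_eq_bot.2 (coordMap_injective b))
    have heq : coordMap b ∘ g = fun i j => (z i j : ℝ) := by
      funext i j
      exact hcoord i j
    rwa [heq] at this
  have hcR : ∀ i, |c i| ≤ d.factorial * C₀ ^ (d + 1) * (‖v‖ * R ^ (k - 1)) := by
    intro i
    have h := abs_coeff_le_of_linearIndependent_int z hind' (R := C₀ * R) (V := C₀ * ‖v‖)
      (fun i j => by
        rw [← hcoord]
        exact (abs_coordMap_le b _ _).trans (by gcongr; exact hgR i))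
      c (fun j => by
        have : ∑ i, c i * (z i j : ℝ) = coordMap b v j := by
          simp [hvdef, map_sum, Finset.sum_apply, hcoord]
        rw [this]
        exact abs_coordMap_le b _ _) i
    refine h.trans ?_
    rw [mul_pow, mul_assoc (d.factorial : ℝ)]
    refine mul_le_mul_of_nonneg_left ?_ (by positivity)
    have : C₀ * C₀ ^ (k - 1) ≤ C₀ ^ (d + 1) := by
      rw [← pow_succ']
      exact pow_le_pow_right₀ hC1 (by omega)
    calc _ = (C₀ * C₀ ^ (k - 1)) * (‖v‖ * R ^ (k - 1)) := by ring
      _ ≤ _ := by gcongr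
  rw [inner_sum]
  refine (Finset.abs_sum_le_sum_abs _ _).trans ?_
  have hterm : ∀ i ∈ (Finset.univ : Finset (Fin k)), |inner ℝ x (c i • g i)| ≤
      d.factorial * C₀ ^ (d + 1) * (‖v‖ * R ^ (k - 1)) * M := by
    intro i _
    rw [inner_smul_right, abs_mul]
    exact mul_le_mul (hcR i) (hM i) (abs_nonneg _) ((abs_nonneg _).trans (hcR i))
  refine (Finset.sum_le_sum hterm).trans ?_
  rw [Finset.sum_const, Finset.card_univ, Fintype.card_fin, nsmul_eq_mul]
  by_cases hk : k = 0
  · subst hk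
    simp [hvdef]
  · have hM0 : 0 ≤ M := (abs_nonneg _).trans (hM ⟨0, by omega⟩)
    have hkd' : (k : ℝ) ≤ d + 1 := by exact_mod_cast (by omega : k ≤ d + 1)
    calc _ ≤ ((d : ℝ) + 1) * (d.factorial * C₀ ^ (d + 1) * (‖v‖ * R ^ (k - 1)) * M) := by gcongr
      _ = _ := by ring

/-- The lattice sum `∑_γ |γ|^{-r}` converges for `r > d`. -/
theorem summable_norm_dualVec_rpow [NeZero d] {r : ℝ} (hr : (d : ℝ) < r) :
    Summable fun n : Fin d → ℤ => ‖dualVec b n‖ ^ (-r) := by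
  let L := Submodule.span ℤ (Set.range (Pi.basisFun ℝ (Fin d)))
  have hrank : Module.finrank ℤ L = d := by
    rw [ZLattice.rank ℝ L]; simp
  have h1 := ZLattice.summable_norm_rpow L (-r) (by rw [hrank]; linarith)
  have hmem : ∀ n : Fin d → ℤ, (fun i => (n i : ℝ)) ∈ L := by
    intro n
    have : (fun i => (n i : ℝ)) = ∑ i, n i • Pi.basisFun ℝ (Fin d) i := by
      funext j
      simp [Finset.sum_apply, Pi.single_apply]
    rw [this]
    exact Submodule.sum_mem _ fun i _ => Submodule.smul_mem _ _ (Submodule.subset_span ⟨i, rfl⟩)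
  have h2 := h1.comp_injective (i := fun n : Fin d → ℤ => (⟨_, hmem n⟩ : L)) (by
    intro m n h
    funext i
    have h3 : (m i : ℝ) = n i := congrFun (congrArg Subtype.val h) i
    exact_mod_cast h3)
  have hd0 : (0 : ℝ) < d := by exact_mod_cast NeZero.pos d
  refine Summable.of_nonneg_of_le (fun n => by positivity) (fun n => ?_)
    (h2.mul_left (coordConst b ^ r))
  by_cases hn : n = 0
  · subst hn
    have : dualVec b 0 = 0 := eq_of_inner_basis b fun i => by rw [inner_dualVec_basis]; simp
    rw [this, norm_zero, Real.zero_rpow (by linarith)]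
    have := coordConst_pos b
    exact mul_nonneg (by positivity) (Real.rpow_nonneg (norm_nonneg _) _)
  · have hle : ‖(fun i => (n i : ℝ))‖ ≤ coordConst b * ‖dualVec b n‖ := by
      rw [pi_norm_le_iff_of_nonneg (by have := coordConst_pos b; positivity)]
      exact fun i => abs_coord_le b n i
    have hpos : 0 < ‖(fun i => (n i : ℝ))‖ := by
      rw [norm_pos_iff]
      intro h
      refine hn (funext fun i => ?_)
      have h3 : (n i : ℝ) = 0 := congrFun h i
      exact_mod_cast h3
    have hc := coordConst_pos b
    have hv : 0 < ‖dualVec b n‖ := pos_of_mul_pos_right (hpos.trans_le hle) hc.le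
    have := Real.rpow_le_rpow_of_nonpos hpos hle (by linarith : -r ≤ 0)
    rw [Real.mul_rpow hc.le hv.le, Real.rpow_neg hc.le, inv_mul_le_iff₀ (by positivity)] at this
    exact this

end

section

/-! ### Fourier series on the fundamental domain -/

variable {d : ℕ} (b : Module.Basis (Fin d) ℝ (Space d))

/-- The plane wave `x ↦ e^{i(ξ,x)}`. -/
noncomputable def planeWave (ξ x : Space d) : ℂ :=
  Complex.exp (Complex.I * ((inner ℝ ξ x : ℝ) : ℂ))

theorem planeWave_neg (ξ x : Space d) :
    planeWave (-ξ) x = Complex.exp (-(Complex.I * ((inner ℝ ξ x : ℝ) : ℂ))) := by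
  simp [planeWave, inner_neg_left]

theorem planeWave_add (ξ η x : Space d) :
    planeWave (ξ + η) x = planeWave ξ x * planeWave η x := by
  simp [planeWave, inner_add_left, mul_add, Complex.exp_add]

theorem norm_planeWave (ξ x : Space d) : ‖planeWave ξ x‖ = 1 := by
  rw [planeWave, mul_comm]; exact Complex.norm_exp_ofReal_mul_I _

theorem conj_planeWave (ξ x : Space d) : (starRingEnd ℂ) (planeWave ξ x) = planeWave (-ξ) x := by
  simp [planeWave, ← Complex.exp_conj, inner_neg_left]

theorem continuous_planeWave (ξ : Space d) : Continuous (planeWave ξ) := by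
  unfold planeWave; fun_prop

/-- The Lebesgue measure on the fundamental domain `F`. -/
noncomputable abbrev cellMeasure : Measure (Space d) :=
  volume.restrict (ZSpan.fundamentalDomain b)

theorem planeWaveCoeff_eq (f : Space d → ℂ) (ξ : Space d) :
    planeWaveCoeff b f ξ = ∫ x, f x * planeWave (-ξ) x ∂cellMeasure b := by
  simp only [planeWaveCoeff, planeWave_neg]

/-- The measurable section of the projection of `ℝᵈ` onto the torus with values in `F`. -/
noncomputable def torusSection (y : UnitAddTorus (Fin d)) : Space d :=
  b.equivFun.symm fun i => (AddCircle.equivIco 1 0 (y i) : ℝ)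

/-- The projection of `ℝᵈ` onto the torus, in the coordinates given by `b`. -/
noncomputable def torusProj (x : Space d) : UnitAddTorus (Fin d) :=
  fun i => (b.repr x i : UnitAddCircle)

theorem torusProj_section (y : UnitAddTorus (Fin d)) : torusProj b (torusSection b y) = y := by
  funext i
  have : b.repr (torusSection b y) i = (AddCircle.equivIco 1 0 (y i) : ℝ) := by
    rw [← b.equivFun_apply, torusSection, LinearEquiv.apply_symm_apply]
  rw [torusProj, this]
  exact (AddCircle.equivIco 1 0).symm_apply_apply (y i)

theorem mFourier_torusProj (n : Fin d → ℤ) (x : Space d) :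
    UnitAddTorus.mFourier n (torusProj b x) = planeWave (dualVec b n) x := by
  simp only [UnitAddTorus.mFourier, ContinuousMap.coe_mk, torusProj, planeWave, inner_dualVec,
    fourier_coe_apply]
  rw [← Complex.exp_sum]
  congr 1
  push_cast
  rw [Finset.mul_sum, Finset.mul_sum]
  exact Finset.sum_congr rfl fun i _ => by ring

-- The Fourier series of `UnitAddTorus` are stated for the normalized Haar measure.
attribute [local instance] instMeasureSpaceUnitAddCircle

local instance : IsProbabilityMeasure (volume : Measure UnitAddCircle) :=
  inferInstanceAs (IsProbabilityMeasure AddCircle.haarAddCircle)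

theorem torusSection_proj {x : Space d} (hx : x ∈ ZSpan.fundamentalDomain b) :
    torusSection b (torusProj b x) = x := by
  have : (fun i => (AddCircle.equivIco 1 0 (torusProj b x i) : ℝ)) = b.equivFun x := by
    funext i
    rw [torusProj, AddCircle.coe_equivIco_mk_apply]
    have h := hx i
    simp only [div_one, mul_one, Module.Basis.equivFun_apply]
    exact Int.fract_eq_self.2 ⟨h.1, h.2⟩
  rw [torusSection, this, LinearEquiv.symm_apply_apply]

theorem measurePreserving_equivIco :
    MeasurePreserving (fun y : UnitAddCircle => (AddCircle.equivIco 1 0 y : ℝ)) volume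
      (volume.restrict (Set.Ico (0 : ℝ) 1)) := by
  have hf : Measurable (fun y : UnitAddCircle => (AddCircle.equivIco 1 0 y : ℝ)) :=
    measurable_subtype_coe.comp (AddCircle.measurableEquivIco 1 0).measurable
  refine ⟨hf, ?_⟩
  have h1 : (volume : Measure UnitAddCircle) =
      (volume.restrict (Set.Ico (0 : ℝ) 1)).map (fun x : ℝ => (x : UnitAddCircle)) := by
    have h2 := (AddCircle.measurePreserving_mk 1 0).map_eq
    rw [AddCircle.volume_eq_smul_haarAddCircle] at h2
    rw [zero_add, ENNReal.ofReal_one, one_smul,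
      ← Measure.restrict_congr_set (Ico_ae_eq_Ioc (a := (0 : ℝ)) (b := 1))] at h2
    exact h2.symm
  rw [h1, Measure.map_map hf AddCircle.measurable_mk']
  conv_rhs => rw [← Measure.map_id (μ := volume.restrict (Set.Ico (0 : ℝ) 1))]
  refine Measure.map_congr ?_
  filter_upwards [ae_restrict_mem measurableSet_Ico] with x hx
  simp only [Function.comp_apply, id]
  rw [AddCircle.coe_equivIco_mk_apply]
  simp only [div_one, mul_one]
  exact Int.fract_eq_self.2 hx

variable {b}

/-- Normalization of the cell makes the section of the torus measure preserving. -/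
theorem measurePreserving_torusSection (hvol : volume (ZSpan.fundamentalDomain b) = 1) :
    MeasurePreserving (torusSection b) volume (cellMeasure b) := by
  have h1 : MeasurePreserving (fun (y : UnitAddTorus (Fin d)) i => (AddCircle.equivIco 1 0 (y i) : ℝ))
      volume (volume.restrict (Set.univ.pi fun _ => Set.Ico (0 : ℝ) 1)) := by
    have := measurePreserving_pi (fun _ : Fin d => (volume : Measure UnitAddCircle))
      (fun _ : Fin d => volume.restrict (Set.Ico (0 : ℝ) 1)) (fun _ => measurePreserving_equivIco)
    rw [← Measure.restrict_pi_pi] at this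
    exact this
  let L : (Fin d → ℝ) ≃L[ℝ] Space d := b.equivFun.symm.toContinuousLinearEquiv
  have hpre : L ⁻¹' (ZSpan.fundamentalDomain b) = Set.univ.pi fun _ => Set.Ico (0 : ℝ) 1 := by
    ext c
    have : ∀ i, b.repr (L c) i = c i := fun i => by
      rw [← b.equivFun_apply]; exact congrFun (b.equivFun.apply_symm_apply c) i
    simp only [Set.mem_preimage, ZSpan.mem_fundamentalDomain, this, Set.mem_univ_pi]
  have hLm : Measurable L := L.continuous.measurable
  have hF : MeasurableSet (ZSpan.fundamentalDomain b) := ZSpan.fundamentalDomain_measurableSet b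
  have hmap : Measure.map L volume = (volume : Measure (Space d)) := by
    have : (Measure.map L (volume : Measure (Fin d → ℝ))).IsAddHaarMeasure :=
      L.isAddHaarMeasure_map _
    have h2 := Measure.isAddLeftInvariant_eq_smul (Measure.map L volume)
      (volume : Measure (Space d))
    have h3 : Measure.map L volume (ZSpan.fundamentalDomain b) = 1 := by
      rw [Measure.map_apply hLm hF, hpre, volume_pi_pi]
      simp
    rw [h2, Measure.smul_apply, hvol] at h3
    rw [h2]
    have h5 : Measure.addHaarScalarFactor (Measure.map L volume) (volume : Measure (Space d)) = 1 := by
      simpa [ENNReal.smul_def] using h3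
    rw [h5, one_smul]
  have h2 : MeasurePreserving L (volume.restrict (Set.univ.pi fun _ => Set.Ico (0 : ℝ) 1))
      (cellMeasure b) := by
    rw [← hpre]
    exact (⟨hLm, hmap⟩ : MeasurePreserving L volume volume).restrict_preimage hF
  exact h2.comp h1

theorem measurePreserving_torusProj (hvol : volume (ZSpan.fundamentalDomain b) = 1) :
    MeasurePreserving (torusProj b) (cellMeasure b) volume := by
  have hm : Measurable (torusProj b) := by
    refine measurable_pi_lambda _ fun i => AddCircle.measurable_mk'.comp ?_
    exact (LinearMap.continuous_of_finiteDimensional (b.coord i)).measurable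
  have hs := measurePreserving_torusSection hvol
  refine ⟨hm, ?_⟩
  rw [← hs.map_eq, Measure.map_map hm hs.measurable]
  have : torusProj b ∘ torusSection b = id := funext (torusProj_section b)
  rw [this, Measure.map_id]

theorem integral_comp_torusSection (hvol : volume (ZSpan.fundamentalDomain b) = 1)
    {G : Type*} [NormedAddCommGroup G] [NormedSpace ℝ G] {f : Space d → G}
    (hf : AEStronglyMeasurable f (cellMeasure b)) :
    ∫ y, f (torusSection b y) = ∫ x, f x ∂cellMeasure b := by
  have hs := measurePreserving_torusSection hvol
  rw [← hs.map_eq, integral_map hs.aemeasurable (by rwa [hs.map_eq])]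

theorem mFourierCoeff_comp_torusSection (hvol : volume (ZSpan.fundamentalDomain b) = 1)
    {f : Space d → ℂ} (hf : AEStronglyMeasurable f (cellMeasure b)) (n : Fin d → ℤ) :
    UnitAddTorus.mFourierCoeff (f ∘ torusSection b) n = planeWaveCoeff b f (dualVec b n) := by
  have hneg : dualVec b (-n) = -dualVec b n := eq_of_inner_basis b fun i => by
    rw [inner_neg_left, inner_dualVec_basis, inner_dualVec_basis]; simp
  have h := integral_comp_torusSection hvol
    (hf.mul (continuous_planeWave (-dualVec b n)).aestronglyMeasurable)
  simp only [Pi.mul_apply] at h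
  rw [planeWaveCoeff_eq, ← h]
  unfold UnitAddTorus.mFourierCoeff
  refine integral_congr_ae (Filter.Eventually.of_forall fun y => ?_)
  simp only [Function.comp_apply, smul_eq_mul]
  rw [mul_comm, ← hneg, ← mFourier_torusProj, torusProj_section]

/-- Parseval's identity on the fundamental domain. -/
theorem hasSum_sq_planeWaveCoeff (hvol : volume (ZSpan.fundamentalDomain b) = 1)
    {f : Space d → ℂ} (hf : MemLp f 2 (cellMeasure b)) :
    HasSum (fun n => ‖planeWaveCoeff b f (dualVec b n)‖ ^ 2) (∫ x, ‖f x‖ ^ 2 ∂cellMeasure b) := by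
  have hs := measurePreserving_torusSection hvol
  have hfs : MemLp (f ∘ torusSection b) 2 volume := hf.comp_measurePreserving hs
  have h := UnitAddTorus.hasSum_sq_mFourierCoeff hfs.toLp
  have h1 : ∀ n, UnitAddTorus.mFourierCoeff hfs.toLp n = planeWaveCoeff b f (dualVec b n) := by
    intro n
    rw [← mFourierCoeff_comp_torusSection hvol hf.1]
    refine integral_congr_ae ?_
    filter_upwards [hfs.coeFn_toLp] with y hy
    rw [hy]
  have h2 : ∫ y, ‖(hfs.toLp : UnitAddTorus (Fin d) → ℂ) y‖ ^ 2 = ∫ x, ‖f x‖ ^ 2 ∂cellMeasure b := by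
    have h3 := integral_comp_torusSection hvol (hf.1.norm.pow 2)
    simp only [Pi.pow_apply] at h3
    rw [← h3]
    refine integral_congr_ae ?_
    filter_upwards [hfs.coeFn_toLp] with y hy
    rw [hy]; rfl
  simp only [h1] at h
  rwa [h2] at h

/-- A function with summable Fourier coefficients is almost everywhere the sum of its Fourier
series. -/
theorem ae_eq_tsum_planeWave (hvol : volume (ZSpan.fundamentalDomain b) = 1)
    {f : Space d → ℂ} (hf : MemLp f 2 (cellMeasure b))
    (hsum : Summable fun n => planeWaveCoeff b f (dualVec b n)) :
    ∀ᵐ x ∂cellMeasure b,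
      f x = ∑' n, planeWaveCoeff b f (dualVec b n) * planeWave (dualVec b n) x := by
  have hs := measurePreserving_torusSection hvol
  have hfs : MemLp (f ∘ torusSection b) 2 volume := hf.comp_measurePreserving hs
  set c := fun n => planeWaveCoeff b f (dualVec b n) with hc
  have h1 : ∀ n, UnitAddTorus.mFourierCoeff hfs.toLp n = c n := by
    intro n
    rw [show c n = planeWaveCoeff b f (dualVec b n) from rfl,
      ← mFourierCoeff_comp_torusSection hvol hf.1]
    refine integral_congr_ae ?_
    filter_upwards [hfs.coeFn_toLp] with y hy
    rw [hy]
  have h2 := UnitAddTorus.hasSum_mFourier_series_L2 hfs.toLp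
  simp only [h1] at h2
  have hsumC : Summable fun n => c n • UnitAddTorus.mFourier (d := Fin d) n := by
    refine Summable.of_norm ?_
    simpa [norm_smul, UnitAddTorus.mFourier_norm] using hsum.norm
  obtain ⟨G, hG⟩ := hsumC
  have h3 := (ContinuousMap.toLp (E := ℂ) 2 (volume : Measure (UnitAddTorus (Fin d))) ℂ).hasSum hG
  simp only [map_smul] at h3
  have h4 : hfs.toLp = ContinuousMap.toLp (E := ℂ) 2 volume ℂ G := h2.unique h3
  have h5 : f ∘ torusSection b =ᵐ[volume] G := by
    refine hfs.coeFn_toLp.symm.trans ?_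
    rw [h4]
    exact ContinuousMap.coeFn_toLp volume G
  have h6 := (measurePreserving_torusProj hvol).quasiMeasurePreserving.ae h5
  filter_upwards [h6, ae_restrict_mem (ZSpan.fundamentalDomain_measurableSet b)] with x hx hxF
  rw [Function.comp_apply, torusSection_proj b hxF] at hx
  rw [hx]
  have h7 := (ContinuousMap.evalCLM ℂ (torusProj b x)).hasSum hG
  have h8 : G (torusProj b x) = ∑' n, (ContinuousMap.evalCLM ℂ (torusProj b x))
      (c n • UnitAddTorus.mFourier n) := h7.tsum_eq.symm
  rw [h8]
  refine tsum_congr fun n => ?_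
  rw [← mFourier_torusProj]
  rfl

end

section

/-! ### The equations for the Fourier coefficients of a Bloch function -/

variable {d : ℕ} {b : Module.Basis (Fin d) ℝ (Space d)}

theorem hasFDerivAt_planeWave (ξ x : Space d) :
    HasFDerivAt (planeWave ξ)
      (planeWave ξ x • (Complex.I • (Complex.ofRealCLM.comp (innerSL ℝ ξ)))) x := by
  have h1 : HasFDerivAt (fun x : Space d => ((inner ℝ ξ x : ℝ) : ℂ))
      (Complex.ofRealCLM.comp (innerSL ℝ ξ)) x :=
    (Complex.ofRealCLM.comp (innerSL ℝ ξ)).hasFDerivAt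
  exact (h1.const_mul Complex.I).cexp

theorem contDiff_planeWave (ξ : Space d) : ContDiff ℝ (⊤ : ℕ∞) (planeWave ξ) := by
  have h1 : ContDiff ℝ (⊤ : ℕ∞) (fun x : Space d => ((inner ℝ ξ x : ℝ) : ℂ)) :=
    (Complex.ofRealCLM.comp (innerSL ℝ ξ)).contDiff
  exact (contDiff_const.mul h1).cexp

theorem laplacian_planeWave (ξ x : Space d) :
    Laplacian.laplacian (planeWave ξ) x = -((‖ξ‖ ^ 2 : ℝ) : ℂ) * planeWave ξ x := by
  rw [InnerProductSpace.laplacian_eq_iteratedFDeriv_stdOrthonormalBasis]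
  set ℓ : Space d →L[ℝ] ℂ := Complex.I • (Complex.ofRealCLM.comp (innerSL ℝ ξ)) with hℓ
  have h1 : fderiv ℝ (planeWave ξ) = fun x => planeWave ξ x • ℓ :=
    funext fun x => (hasFDerivAt_planeWave ξ x).fderiv
  have h2 : fderiv ℝ (fderiv ℝ (planeWave ξ)) x = (planeWave ξ x • ℓ).smulRight ℓ := by
    rw [h1]
    exact ((hasFDerivAt_planeWave ξ x).smul_const ℓ).fderiv
  simp only [iteratedFDeriv_two_apply, h2]
  have h3 : ∀ v, ℓ v = Complex.I * ((inner ℝ ξ v : ℝ) : ℂ) := fun v => by simp [hℓ]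
  have h4 := (stdOrthonormalBasis ℝ (Space d)).sum_sq_norm_inner_left ξ
  simp only [ContinuousLinearMap.smulRight_apply, smul_apply, smul_eq_mul, h3,
    Matrix.cons_val_zero, Matrix.cons_val_one]
  rw [← h4]
  push_cast
  rw [← Finset.sum_neg_distrib, Finset.sum_mul]
  refine Finset.sum_congr rfl fun i _ => ?_
  rw [Real.norm_eq_abs, ← Complex.ofReal_pow, sq_abs]
  push_cast
  linear_combination (planeWave ξ x) * ((inner ℝ ξ (stdOrthonormalBasis ℝ (Space d) i) : ℝ) : ℂ) ^ 2 *
    Complex.I_sq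

theorem isQuasiperiodic_planeWave {γ t : Space d} (hγ : γ ∈ dualLattice b) :
    IsQuasiperiodic b t (planeWave (γ + t)) := by
  intro x ω hω
  obtain ⟨n, hn⟩ := hγ ω hω
  have h1 : planeWave (γ + t) (x + ω) = planeWave (γ + t) ω * planeWave (γ + t) x := by
    simp only [planeWave, inner_add_right]
    push_cast
    rw [← Complex.exp_add]; ring_nf
  have h2 : planeWave γ ω = 1 := by
    rw [planeWave, hn, Complex.exp_eq_one_iff]
    exact ⟨n, by push_cast; ring⟩
  rw [h1, planeWave_add, h2, one_mul, planeWave]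

theorem planeWaveCoeff_mul_planeWave (f : Space d → ℂ) (t γ : Space d) :
    planeWaveCoeff b (fun x => f x * planeWave (-t) x) γ = planeWaveCoeff b f (γ + t) := by
  rw [planeWaveCoeff_eq, planeWaveCoeff_eq]
  refine integral_congr_ae (Filter.Eventually.of_forall fun x => ?_)
  simp only [neg_add, planeWave_add]; ring

theorem isFiniteMeasure_cellMeasure (hvol : volume (ZSpan.fundamentalDomain b) = 1) :
    IsFiniteMeasure (cellMeasure b) := ⟨by simp [hvol]⟩

theorem memLp_mul_planeWave {f : Space d → ℂ} (hf : MemLp f 2 (cellMeasure b)) (ξ : Space d) :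
    MemLp (fun x => f x * planeWave ξ x) 2 (cellMeasure b) :=
  hf.of_le (hf.1.mul (continuous_planeWave ξ).aestronglyMeasurable)
    (Filter.Eventually.of_forall fun x => by simp [norm_planeWave])

theorem integrable_mul_planeWave {f : Space d → ℂ} (hf : Integrable f (cellMeasure b))
    (ξ : Space d) : Integrable (fun x => f x * planeWave ξ x) (cellMeasure b) :=
  Integrable.mono hf (hf.1.mul (continuous_planeWave ξ).aestronglyMeasurable)
    (Filter.Eventually.of_forall fun x => by simp [norm_planeWave])

/-- Parseval's identity for quasiperiodic functions. -/
theorem hasSum_sq_planeWaveCoeff_add (hvol : volume (ZSpan.fundamentalDomain b) = 1)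
    {f : Space d → ℂ} (hf : MemLp f 2 (cellMeasure b)) (t : Space d) :
    HasSum (fun γ : dualLattice b => ‖planeWaveCoeff b f (γ + t)‖ ^ 2)
      (∫ x, ‖f x‖ ^ 2 ∂cellMeasure b) := by
  have h := hasSum_sq_planeWaveCoeff hvol (memLp_mul_planeWave hf (-t))
  simp only [planeWaveCoeff_mul_planeWave, norm_mul, norm_planeWave, mul_one] at h
  exact (dualEquiv b).hasSum_iff.1 h

variable {s : ℝ} {q : Space d → ℝ}

theorem IsPotential.coeff_zero (hq : IsPotential b s q) : potCoeff b q 0 = 0 := by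
  have h := hq.mean_zero
  simp only [potCoeff, planeWaveCoeff, inner_zero_left, Complex.ofReal_zero, mul_zero, neg_zero,
    Complex.exp_zero, mul_one]
  rw [integral_complex_ofReal, h, Complex.ofReal_zero]

theorem potCoeff_neg (γ : Space d) :
    potCoeff b q (-γ) = (starRingEnd ℂ) (potCoeff b q γ) := by
  rw [potCoeff, potCoeff, planeWaveCoeff_eq, planeWaveCoeff_eq, ← integral_conj]
  refine integral_congr_ae (Filter.Eventually.of_forall fun x => ?_)
  simp [conj_planeWave]

theorem IsPotential.summable_norm_mul_rpow [NeZero d] (hq : IsPotential b s q) :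
    Summable fun γ : dualLattice b => ‖potCoeff b q γ‖ * ‖(γ : Space d)‖ ^ (pOf d s) := by
  have hd : (0 : ℝ) < d := by exact_mod_cast NeZero.pos d
  have h1 : Summable fun γ : dualLattice b => ‖(γ : Space d)‖ ^ (-(2 * d : ℝ)) :=
    (dualEquiv b).summable_iff.1 (summable_norm_dualVec_rpow b (by linarith))
  refine Summable.of_nonneg_of_le (fun γ => by positivity) (fun γ => ?_) (hq.sobolev.add h1)
  by_cases h0 : (γ : Space d) = 0
  · rw [h0, hq.coeff_zero]
    simp only [norm_zero, zero_mul]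
    positivity
  · have hpos : 0 < ‖(γ : Space d)‖ := norm_pos_iff.2 h0
    set y := ‖(γ : Space d)‖
    set c := ‖potCoeff b q γ‖
    have e1 : y ^ pOf d s = y ^ s * y ^ (-(d : ℝ)) := by
      rw [← Real.rpow_add hpos]; rfl
    have e2 : y ^ (2 * s) = (y ^ s) ^ 2 := by
      rw [← Real.rpow_natCast, ← Real.rpow_mul hpos.le]; congr 1; push_cast; ring
    have e3 : y ^ (-(2 * d : ℝ)) = (y ^ (-(d : ℝ))) ^ 2 := by
      rw [← Real.rpow_natCast, ← Real.rpow_mul hpos.le]; congr 1; push_cast; ring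
    rw [e1, e2, e3]
    have : 0 ≤ c := norm_nonneg _
    nlinarith [sq_nonneg (c * y ^ s - y ^ (-(d : ℝ))), sq_nonneg c, sq_nonneg (c * y ^ s),
      sq_nonneg (y ^ (-(d : ℝ)))]

theorem IsPotential.summable_norm [NeZero d] (hq : IsPotential b s q) (hp : 0 ≤ pOf d s) :
    Summable fun γ : dualLattice b => ‖potCoeff b q γ‖ := by
  obtain ⟨δ, hδ, hsep⟩ := exists_norm_lower_bound b
  refine Summable.of_nonneg_of_le (fun γ => norm_nonneg _) (fun γ => ?_)
    (hq.summable_norm_mul_rpow.mul_right (δ ^ pOf d s)⁻¹)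
  by_cases h0 : (γ : Space d) = 0
  · rw [h0, hq.coeff_zero]; simp
  · rw [mul_assoc, ← div_eq_mul_inv]
    refine le_mul_of_one_le_right (norm_nonneg _) ?_
    rw [one_le_div (by positivity)]
    exact Real.rpow_le_rpow hδ.le (hsep γ γ.2 h0) hp

theorem IsPotential.ae_eq_tsum [NeZero d] (hvol : volume (ZSpan.fundamentalDomain b) = 1)
    (hq : IsPotential b s q) (hp : 0 ≤ pOf d s) :
    ∀ᵐ x ∂cellMeasure b,
      (q x : ℂ) = ∑' γ : dualLattice b, potCoeff b q γ * planeWave γ x := by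
  have h := ae_eq_tsum_planeWave hvol (f := fun x => (q x : ℂ)) hq.memLp.ofReal
    ((dualEquiv b).summable_iff.2 (hq.summable_norm hp).of_norm)
  filter_upwards [h] with x hx
  rw [hx, ← (dualEquiv b).tsum_eq]
  rfl

/-- The potential is essentially bounded by the sum of the moduli of its Fourier coefficients. -/
theorem IsPotential.ae_norm_le [NeZero d] (hvol : volume (ZSpan.fundamentalDomain b) = 1)
    (hq : IsPotential b s q) (hp : 0 ≤ pOf d s) :
    ∀ᵐ x ∂cellMeasure b, ‖(q x : ℂ)‖ ≤ ∑' γ : dualLattice b, ‖potCoeff b q γ‖ := by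
  filter_upwards [hq.ae_eq_tsum hvol hp] with x hx
  rw [hx]
  refine (norm_tsum_le_tsum_norm ?_).trans_eq ?_
  · simpa [norm_planeWave] using hq.summable_norm hp
  · simp [norm_planeWave]

/-- Multiplication by the potential convolves Fourier coefficients. -/
theorem IsPotential.hasSum_mul_planeWaveCoeff [NeZero d]
    (hvol : volume (ZSpan.fundamentalDomain b) = 1)
    (hq : IsPotential b s q) (hp : 0 ≤ pOf d s) {Ψ : Space d → ℂ}
    (hΨ : Integrable Ψ (cellMeasure b)) (ξ : Space d) :
    HasSum (fun γ : dualLattice b => potCoeff b q γ * planeWaveCoeff b Ψ (ξ - γ))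
      (planeWaveCoeff b (fun x => (q x : ℂ) * Ψ x) ξ) := by
  have : Countable (dualLattice b) := Countable.of_equiv _ (dualEquiv b)
  let F : dualLattice b → Space d → ℂ := fun γ x =>
    potCoeff b q γ * (Ψ x * planeWave (-(ξ - (γ : Space d))) x)
  have hF : ∀ γ, Integrable (F γ) (cellMeasure b) := fun γ =>
    (integrable_mul_planeWave hΨ _).const_mul _
  have hsum : Summable fun γ => ∫ x, ‖F γ x‖ ∂cellMeasure b := by
    simp only [F, norm_mul, norm_planeWave, mul_one, integral_const_mul]
    exact (hq.summable_norm hp).mul_right _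
  have h := hasSum_integral_of_summable_integral_norm hF hsum
  have h1 : ∀ γ : dualLattice b, ∫ x, F γ x ∂cellMeasure b =
      potCoeff b q γ * planeWaveCoeff b Ψ (ξ - γ) := by
    intro γ
    rw [planeWaveCoeff_eq, ← integral_const_mul]
  have h2 : ∫ x, ∑' γ, F γ x ∂cellMeasure b = planeWaveCoeff b (fun x => (q x : ℂ) * Ψ x) ξ := by
    rw [planeWaveCoeff_eq]
    refine integral_congr_ae ?_
    filter_upwards [hq.ae_eq_tsum hvol hp] with x hx
    rw [hx, mul_assoc, ← tsum_mul_right]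
    refine tsum_congr fun γ => ?_
    simp only [F]
    rw [show -(ξ - (γ : Space d)) = γ + -ξ by abel, planeWave_add]
    ring
  simp only [h1] at h
  rwa [h2] at h

variable {t : Space d} {Λ : ℝ} {Ψ : Space d → ℂ}

theorem IsBlochFunction.integrable (hvol : volume (ZSpan.fundamentalDomain b) = 1)
    (hΨ : IsBlochFunction b q t Λ Ψ) : Integrable Ψ (cellMeasure b) := by
  have := isFiniteMeasure_cellMeasure hvol
  exact hΨ.memLp.integrable one_le_two

/-- Testing the eigenvalue equation against a plane wave. -/
theorem IsBlochFunction.coeff_eq (hvol : volume (ZSpan.fundamentalDomain b) = 1)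
    (hq : IsPotential b s q) (hΨ : IsBlochFunction b q t Λ Ψ) {γ : Space d}
    (hγ : γ ∈ dualLattice b) :
    planeWaveCoeff b (fun x => (q x : ℂ) * Ψ x) (γ + t) =
      ((Λ - ‖γ + t‖ ^ 2 : ℝ) : ℂ) * planeWaveCoeff b Ψ (γ + t) := by
  set ξ := γ + t
  have h := hΨ.weak_eq (planeWave ξ) (contDiff_planeWave ξ) (isQuasiperiodic_planeWave hγ)
  have hq2 : MemLp (fun x => (q x : ℂ)) 2 (cellMeasure b) := hq.memLp.ofReal
  have hqΨ : Integrable (fun x => (q x : ℂ) * Ψ x) (cellMeasure b) := hq2.integrable_mul hΨ.memLp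
  have i1 := integrable_mul_planeWave hqΨ (-ξ)
  have i2 := (integrable_mul_planeWave (hΨ.integrable hvol) (-ξ)).const_mul ((‖ξ‖ ^ 2 : ℝ) : ℂ)
  have hL : ∫ x in ZSpan.fundamentalDomain b, Ψ x * (starRingEnd ℂ)
      (-(Laplacian.laplacian (planeWave ξ) x) + (q x : ℂ) * planeWave ξ x) =
      ((‖ξ‖ ^ 2 : ℝ) : ℂ) * planeWaveCoeff b Ψ ξ +
        planeWaveCoeff b (fun x => (q x : ℂ) * Ψ x) ξ := by
    rw [planeWaveCoeff_eq, planeWaveCoeff_eq, ← integral_const_mul, ← integral_add i2 i1]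
    refine integral_congr_ae (Filter.Eventually.of_forall fun x => ?_)
    simp only [laplacian_planeWave, map_add, map_mul, map_neg, Complex.conj_ofReal, conj_planeWave]
    ring
  have hR : ∫ x in ZSpan.fundamentalDomain b, Ψ x * (starRingEnd ℂ) (planeWave ξ x) =
      planeWaveCoeff b Ψ ξ := by
    rw [planeWaveCoeff_eq]; simp only [conj_planeWave]
  rw [hL, hR] at h
  push_cast at h ⊢
  linear_combination h

/-- The data that the perturbation argument uses: coefficients `a γ` of modulus at most `1`
satisfying the eigenvalue equation in Fourier space, with `V` the Fourier coefficients of the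
potential. The constants `Q` and `T` bound `∑ |V γ|` and `∑ |V γ| |γ|^p`. -/
structure IsCoeffSystem (b : Module.Basis (Fin d) ℝ (Space d)) (V a : Space d → ℂ) (t : Space d)
    (Λ p Q T : ℝ) : Prop where
  conv : ∀ γ ∈ dualLattice b, HasSum (fun γ' : dualLattice b => V γ' * a (γ - γ'))
    (((Λ - ‖γ + t‖ ^ 2 : ℝ) : ℂ) * a γ)
  norm_le_one : ∀ γ ∈ dualLattice b, ‖a γ‖ ≤ 1
  V_zero : V 0 = 0
  summable : Summable fun γ : dualLattice b => ‖V γ‖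
  tsum_le : ∑' γ : dualLattice b, ‖V γ‖ ≤ Q
  summable_rpow : Summable fun γ : dualLattice b => ‖V γ‖ * ‖(γ : Space d)‖ ^ p
  tsum_rpow_le : ∑' γ : dualLattice b, ‖V γ‖ * ‖(γ : Space d)‖ ^ p ≤ T

theorem IsBlochFunction.isCoeffSystem [NeZero d] (hvol : volume (ZSpan.fundamentalDomain b) = 1)
    (hq : IsPotential b s q) (hp : 0 ≤ pOf d s) (hΨ : IsBlochFunction b q t Λ Ψ) :
    IsCoeffSystem b (potCoeff b q) (fun γ => planeWaveCoeff b Ψ (γ + t)) t Λ (pOf d s)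
      (∑' γ : dualLattice b, ‖potCoeff b q γ‖)
      (∑' γ : dualLattice b, ‖potCoeff b q γ‖ * ‖(γ : Space d)‖ ^ (pOf d s)) where
  conv γ hγ := by
    rw [← hΨ.coeff_eq hvol hq hγ]
    simpa only [add_sub_right_comm] using
      hq.hasSum_mul_planeWaveCoeff hvol hp (hΨ.integrable hvol) (γ + t)
  norm_le_one γ hγ := by
    have h := hasSum_sq_planeWaveCoeff_add hvol hΨ.memLp t
    rw [hΨ.normalized] at h
    have h1 := le_hasSum h ⟨γ, hγ⟩ fun _ _ => sq_nonneg _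
    exact (sq_le_one_iff₀ (norm_nonneg _)).1 h1
  V_zero := hq.coeff_zero
  summable := hq.summable_norm hp
  tsum_le := le_rfl
  summable_rpow := hq.summable_norm_mul_rpow
  tsum_rpow_le := le_rfl

/-- Truncation of the eigenvalue equation: the terms outside `S` are small, either because the
coefficient `a` is small or because the Fourier coefficient of the potential is. -/
theorem IsCoeffSystem.norm_sub_sum_le {V a : Space d → ℂ} {p Q T : ℝ}
    (h : IsCoeffSystem b V a t Λ p Q T) (hp : 0 ≤ p) {γ : Space d} (hγ : γ ∈ dualLattice b)
    {S : Finset (Space d)} (hS : ∀ γ' ∈ S, γ' ∈ dualLattice b) {r β : ℝ} (hr : 0 < r)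
    (hβ0 : 0 ≤ β) (hβ : ∀ γ' ∈ dualLattice b, γ' ∉ S → 0 < ‖γ'‖ → ‖γ'‖ < r → ‖a (γ - γ')‖ ≤ β) :
    ‖((Λ - ‖γ + t‖ ^ 2 : ℝ) : ℂ) * a γ - ∑ γ' ∈ S, V γ' * a (γ - γ')‖ ≤ Q * β + T * r ^ (-p) := by
  classical
  let S' : Finset (dualLattice b) := S.subtype (· ∈ dualLattice b)
  have hsum : ∑ γ' ∈ S, V γ' * a (γ - γ') = ∑ γ' ∈ S', V γ' * a (γ - γ') := by
    rw [Finset.sum_subtype_of_mem (fun γ' => V γ' * a (γ - γ')) hS]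
  have hfin : HasSum (fun γ' : dualLattice b => if γ' ∈ S' then V γ' * a (γ - γ') else 0)
      (∑ γ' ∈ S, V γ' * a (γ - γ')) := by
    rw [hsum]
    have : HasSum (fun γ' : dualLattice b => if γ' ∈ S' then V γ' * a (γ - γ') else 0)
        (∑ γ' ∈ S', if γ' ∈ S' then V γ' * a (γ - γ') else 0) :=
      hasSum_sum_of_ne_finset_zero fun γ' hγ' => if_neg hγ'
    rwa [Finset.sum_congr rfl fun γ' hγ' => if_pos hγ'] at this
  have h1 := (h.conv γ hγ).sub hfin
  rw [← h1.tsum_eq]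
  have hmaj := (h.summable.hasSum.mul_right β).add (h.summable_rpow.hasSum.mul_right (r ^ (-p)))
  have h2 : ‖∑' γ' : dualLattice b, (V γ' * a (γ - γ') -
      if γ' ∈ S' then V γ' * a (γ - γ') else 0)‖ ≤
      (∑' γ' : dualLattice b, ‖V γ'‖) * β +
        (∑' γ' : dualLattice b, ‖V γ'‖ * ‖(γ' : Space d)‖ ^ p) * r ^ (-p) := by
    refine tsum_of_norm_bounded hmaj fun γ' => ?_
    split_ifs with hmem
    · rw [sub_self, norm_zero]; positivity
    · rw [sub_zero, norm_mul]
      by_cases h0 : (γ' : Space d) = 0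
      · rw [h0, h.V_zero, norm_zero]; simp
      · have hpos : 0 < ‖(γ' : Space d)‖ := norm_pos_iff.2 h0
        by_cases hlt : ‖(γ' : Space d)‖ < r
        · have := hβ γ' γ'.2 (by simpa [S'] using hmem) hpos hlt
          have h3 : ‖V γ'‖ * ‖a (γ - γ')‖ ≤ ‖V γ'‖ * β := by gcongr
          have h4 : 0 ≤ ‖V γ'‖ * ‖(γ' : Space d)‖ ^ p * r ^ (-p) := by positivity
          linarith
        · have h3 : 1 ≤ ‖(γ' : Space d)‖ ^ p * r ^ (-p) := by
            rw [Real.rpow_neg hr.le, ← div_eq_mul_inv, one_le_div (by positivity)]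
            exact Real.rpow_le_rpow hr.le (not_lt.1 hlt) hp
          have h4 : ‖V γ'‖ * ‖a (γ - γ')‖ ≤ ‖V γ'‖ * (‖(γ' : Space d)‖ ^ p * r ^ (-p)) := by
            gcongr
            exact (h.norm_le_one _ (sub_mem_dualLattice hγ γ'.2)).trans h3
          have h5 : 0 ≤ ‖V γ'‖ * β := by positivity
          linarith
  refine h2.trans ?_
  have := h.tsum_le
  have := h.tsum_rpow_le
  gcongr

theorem IsCoeffSystem.sum_norm_le {V a : Space d → ℂ} {p Q T : ℝ}
    (h : IsCoeffSystem b V a t Λ p Q T) {S : Finset (Space d)}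
    (hS : ∀ γ' ∈ S, γ' ∈ dualLattice b) : ∑ γ' ∈ S, ‖V γ'‖ ≤ Q := by
  classical
  rw [← Finset.sum_subtype_of_mem (fun γ' => ‖V γ'‖) hS]
  exact (h.summable.sum_le_tsum _ fun _ _ => norm_nonneg _).trans h.tsum_le

end

section

/-! ### Perturbation of Hermitian matrices -/

/-- A Hermitian matrix has an eigenvalue near every approximate eigenvalue. -/
theorem exists_isMatrixEigenvalue_near {ι : Type*} [Fintype ι] [DecidableEq ι] {M : Matrix ι ι ℂ}
    (hM : M.IsHermitian) {Λ η κ : ℝ} (hη : 0 ≤ η) (hκ : 0 < κ) {v : ι → ℂ} {i₀ : ι}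
    (hv : κ ≤ ‖v i₀‖) (hres : ∀ i, ‖(Λ : ℂ) * v i - M.mulVec v i‖ ≤ η) :
    ∃ μ : ℝ, IsMatrixEigenvalue M μ ∧ |Λ - μ| ≤ √(Fintype.card ι) * η / κ := by
  let e := hM.eigenvectorBasis
  let u : EuclideanSpace ℂ ι := WithLp.toLp 2 v
  let w : EuclideanSpace ℂ ι := WithLp.toLp 2 fun i => (Λ : ℂ) * v i - M.mulVec v i
  have heig : ∀ i, IsMatrixEigenvalue M (hM.eigenvalues i) := by
    intro i
    refine ⟨e i, ?_, ?_⟩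
    · intro h
      exact e.toBasis.ne_zero i (by ext j; simpa using congrFun h j)
    · have := hM.mulVec_eigenvectorBasis i
      rw [this]
      ext j
      simp
      left; rfl
  have hsym := Matrix.isSymmetric_toEuclideanLin_iff.mpr hM
  have hTe : ∀ i, M.toEuclideanLin (e i) = (hM.eigenvalues i : ℂ) • e i := by
    intro i
    ext j
    have := congrFun (hM.mulVec_eigenvectorBasis i) j
    simpa [Matrix.toLpLin_apply] using this
  have hw : w = (Λ : ℂ) • u - M.toEuclideanLin u := by
    ext j
    simp [w, u, Matrix.toLpLin_apply]
  have hinner : ∀ i, inner ℂ (e i) w = ((Λ - hM.eigenvalues i : ℝ) : ℂ) * inner ℂ (e i) u := by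
    intro i
    rw [hw, inner_sub_right, inner_smul_right, ← hsym, hTe, inner_smul_left]
    simp; ring
  by_contra! hcon
  set ε := √(Fintype.card ι) * η / κ with hε
  have hε0 : 0 ≤ ε := by positivity
  have hu : κ ^ 2 ≤ ‖u‖ ^ 2 := by
    rw [EuclideanSpace.norm_sq_eq]
    refine le_trans ?_ (Finset.single_le_sum (f := fun i => ‖u i‖ ^ 2) (fun i _ => sq_nonneg _)
      (Finset.mem_univ i₀))
    exact pow_le_pow_left₀ hκ.le hv 2
  have hwn : ‖w‖ ^ 2 ≤ Fintype.card ι * η ^ 2 := by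
    rw [EuclideanSpace.norm_sq_eq]
    refine (Finset.sum_le_sum (g := fun _ => η ^ 2) fun i _ =>
      pow_le_pow_left₀ (norm_nonneg _) (hres i) 2).trans ?_
    simp
  have hlt : ε ^ 2 * ‖u‖ ^ 2 < ‖w‖ ^ 2 := by
    rw [← e.sum_sq_norm_inner_right u, ← e.sum_sq_norm_inner_right w, Finset.mul_sum]
    have hterm : ∀ i, ‖inner ℂ (e i) w‖ ^ 2 =
        |Λ - hM.eigenvalues i| ^ 2 * ‖inner ℂ (e i) u‖ ^ 2 := by
      intro i
      rw [hinner, norm_mul, mul_pow, Complex.norm_real, Real.norm_eq_abs]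
    have hsq : ∀ i, ε ^ 2 < |Λ - hM.eigenvalues i| ^ 2 := fun i =>
      pow_lt_pow_left₀ (hcon _ (heig i)) hε0 two_ne_zero
    apply Finset.sum_lt_sum
    · intro i _
      rw [hterm]
      exact mul_le_mul_of_nonneg_right (hsq i).le (sq_nonneg _)
    · by_contra! hall
      have h0 : ∀ i, ‖inner ℂ (e i) u‖ ^ 2 = 0 := by
        intro i
        have h1 := hall i (Finset.mem_univ i)
        rw [hterm] at h1
        have h2 := hsq i
        have h3 := sq_nonneg ‖inner ℂ (e i) u‖
        by_contra hne
        have h4 : 0 < ‖inner ℂ (e i) u‖ ^ 2 := lt_of_le_of_ne h3 (Ne.symm hne)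
        nlinarith
      have := e.sum_sq_norm_inner_right u
      simp only [h0, Finset.sum_const_zero] at this
      have : 0 < κ ^ 2 := by positivity
      linarith
  have h1 : ε ^ 2 * κ ^ 2 = Fintype.card ι * η ^ 2 := by
    rw [hε, div_pow, mul_pow, Real.sq_sqrt (by positivity), div_mul_cancel₀ _ (by positivity)]
  have h2 : ε ^ 2 * κ ^ 2 ≤ ε ^ 2 * ‖u‖ ^ 2 := by gcongr
  linarith

theorem resonanceMatrix_isHermitian {d : ℕ} (b : Module.Basis (Fin d) ℝ (Space d))
    (q : Space d → ℝ) (s ρ : ℝ) {k : ℕ} (g : Fin k → Space d) (γ t : Space d) :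
    (resonanceMatrix b q s ρ g γ t).IsHermitian := by
  ext i j
  rw [Matrix.conjTranspose_apply]
  simp only [resonanceMatrix, Matrix.of_apply]
  by_cases h : i = j
  · subst h
    simp only [if_true]
    exact Complex.conj_ofReal _
  · rw [if_neg h, if_neg (Ne.symm h), ← neg_sub, potCoeff_neg]
    exact Complex.conj_conj _

/-! ### Geometry of the resonance domains -/

variable {d : ℕ}

theorem kap_pos (d : ℕ) : 0 < kap d := by unfold kap; positivity

theorem alpha_pos (d : ℕ) : 0 < alpha d := one_div_pos.2 (kap_pos d)

/-- All powers of `ρ` occurring in the resonance domains are integer powers of `ρ^{α/2}`. -/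
noncomputable def rootScale (d : ℕ) (ρ : ℝ) : ℝ := ρ ^ (alpha d / 2)

theorem rootScale_pow {ρ : ℝ} (hρ : 0 ≤ ρ) (n : ℕ) :
    rootScale d ρ ^ n = ρ ^ (alpha d / 2 * n) := by
  rw [rootScale, ← Real.rpow_natCast, ← Real.rpow_mul hρ]

theorem rpow_alpha {ρ : ℝ} (hρ : 0 ≤ ρ) : ρ ^ alpha d = rootScale d ρ ^ 2 := by
  rw [rootScale_pow hρ]; congr 1; push_cast; ring

theorem rpow_alphaK {ρ : ℝ} (hρ : 0 ≤ ρ) (k : ℕ) :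
    ρ ^ alphaK d k = rootScale d ρ ^ (2 * 3 ^ k) := by
  rw [rootScale_pow hρ, alphaK]; congr 1; push_cast; ring

theorem rpow_half_alphaK {ρ : ℝ} (hρ : 0 ≤ ρ) (k : ℕ) :
    ρ ^ (1 / 2 * alphaK d k) = rootScale d ρ ^ (3 ^ k) := by
  rw [rootScale_pow hρ, alphaK]; congr 1; push_cast; ring

theorem exists_le_rootScale (d : ℕ) (N : ℝ) : ∃ ρ₀ : ℝ, 1 ≤ ρ₀ ∧ ∀ ρ, ρ₀ ≤ ρ → N ≤ rootScale d ρ := by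
  have h := tendsto_rpow_atTop (half_pos (alpha_pos d))
  obtain ⟨ρ₀, h0⟩ := Filter.eventually_atTop.1 (h.eventually_ge_atTop N)
  exact ⟨max ρ₀ 1, le_max_right _ _, fun ρ hρ => h0 ρ ((le_max_left _ _).trans hρ)⟩

theorem norm_add_sq_sub (x w : Space d) : ‖x + w‖ ^ 2 - ‖x‖ ^ 2 = 2 * inner ℝ x w + ‖w‖ ^ 2 := by
  rw [norm_add_sq_real]; ring

/-- A point of the resonance domains of `g₁, …, g_k` is nearly orthogonal to their span. -/
theorem exists_abs_inner_le_of_resonance (b : Module.Basis (Fin d) ℝ (Space d)) {p : ℝ}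
    (hp : 1 ≤ p) : ∃ C : ℝ, 0 < C ∧ ∀ (ρ : ℝ) (k : ℕ) (g : Fin k → Space d) (x v : Space d),
    0 ≤ ρ → 1 ≤ rootScale d ρ → 1 ≤ k → (∀ i, g i ∈ dualBall b (p * ρ ^ alpha d)) →
    LinearIndependent ℝ g → (∀ i, x ∈ resonanceDomain ρ (ρ ^ alphaK d k) (g i)) →
    v ∈ Submodule.span ℝ (Set.range g) →
    |inner ℝ x v| ≤ C * rootScale d ρ ^ (2 * 3 ^ k + 2 * (k - 1)) * ‖v‖ := by
  obtain ⟨C, hC, h⟩ := exists_abs_inner_le_of_mem_span b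
  refine ⟨C * (p ^ d * (1 + p ^ 2)), by positivity, ?_⟩
  intro ρ k g x v hρ ha hk hg hind hx hv
  set a := rootScale d ρ with haa
  have hkd : k ≤ d := by simpa using hind.fintype_card_le_finrank
  have hA : ρ ^ alpha d = a ^ 2 := rpow_alpha hρ
  have hgn : ∀ i, ‖g i‖ ≤ p * a ^ 2 := fun i => by rw [← hA]; exact (hg i).2.2.le
  have hM : ∀ i, |inner ℝ x (g i)| ≤ (1 + p ^ 2) * a ^ (2 * 3 ^ k) := by
    intro i
    have h1 := (hx i).1
    rw [Set.mem_ofPred_eq, rpow_alphaK hρ, abs_sub_comm, norm_add_sq_sub, ← haa] at h1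
    have h2 : ‖g i‖ ^ 2 ≤ p ^ 2 * a ^ (2 * 3 ^ k) := by
      calc _ ≤ (p * a ^ 2) ^ 2 := by gcongr; exact hgn i
        _ = p ^ 2 * a ^ 4 := by ring
        _ ≤ _ := by
          have : 3 ^ 1 ≤ 3 ^ k := Nat.pow_le_pow_right (by norm_num) hk
          gcongr
          omega
    rw [abs_le] at h1 ⊢
    have : 0 ≤ a ^ (2 * 3 ^ k) := by positivity
    constructor <;> nlinarith [h1.1, h1.2, sq_nonneg ‖g i‖]
  have := h k g (p * a ^ 2) _ x v (one_le_mul_of_one_le_of_one_le hp (one_le_pow₀ ha))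
    (fun i => (hg i).1) hgn hind hM hv
  refine this.trans ?_
  have hpk : p ^ (k - 1) ≤ p ^ d := pow_le_pow_right₀ hp (by omega)
  calc _ = C * (p ^ (k - 1) * (1 + p ^ 2)) * a ^ (2 * 3 ^ k + 2 * (k - 1)) * ‖v‖ := by
        rw [mul_pow, ← pow_mul, pow_add]; ring
    _ ≤ _ := by gcongr

/-- Far from the block: near a point `x` of order-`k` resonance, all vectors `x + v + w` outside
the block have energies at distance of order `ρ^{α_{k+1}}` from the energy of `x`. Transversally to
the resonance plane this is because `x` is not in a resonance domain of order `k + 1`, along the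
plane because `x` is nearly orthogonal to it. -/
theorem exists_energy_gap (b : Module.Basis (Fin d) ℝ (Space d)) {s : ℝ} (hp : 1 ≤ pOf d s) :
    ∃ N : ℝ, 1 ≤ N ∧ ∀ (ρ : ℝ) (k : ℕ) (g : Fin k → Space d) (x v w : Space d), 0 ≤ ρ →
    N ≤ rootScale d ρ → 1 ≤ k → (∀ i, g i ∈ dualBall b (pOf d s * ρ ^ alpha d)) →
    LinearIndependent ℝ g → (∀ i, x ∈ resonanceDomain ρ (ρ ^ alphaK d k) (g i)) →
    x ∉ resonanceUnion b s ρ (k + 1) → v ∈ resonanceBlock b ρ g → w ∈ dualLattice b →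
    ‖w‖ < pOf d s * ρ ^ alpha d → v + w ∉ resonanceBlock b ρ g →
    6 / 25 * ρ ^ alphaK d (k + 1) ≤ |‖x + v + w‖ ^ 2 - ‖x‖ ^ 2| := by
  obtain ⟨C, hC, h⟩ := exists_abs_inner_le_of_resonance b hp
  set p := pOf d s with hpdef
  refine ⟨1 + 100 * (C + p), by linarith, ?_⟩
  intro ρ k g x v w hρ hN hk hg hind hx hxE hv hw hwn hvw
  have ha : 1 ≤ rootScale d ρ := by linarith
  have hinner := fun u hu => h ρ k g x u hρ ha hk hg hind hx hu
  have hA : ρ ^ alpha d = rootScale d ρ ^ 2 := rpow_alpha hρ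
  have hD : ρ ^ alphaK d (k + 1) = rootScale d ρ ^ (2 * 3 ^ (k + 1)) := rpow_alphaK hρ _
  have hr : ρ ^ (1 / 2 * alphaK d (k + 1)) = rootScale d ρ ^ (3 ^ (k + 1)) := rpow_half_alphaK hρ _
  have hDk : ρ ^ alphaK d k = rootScale d ρ ^ (2 * 3 ^ k) := rpow_alphaK hρ _
  rw [hA] at hwn hg
  obtain ⟨hv1, hv2, hv3⟩ := hv
  simp only [resonanceBlock, Set.mem_ofPred_eq, not_and, not_lt] at hvw
  rw [hr] at hv3 hvw
  set a := rootScale d ρ with haa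
  set m := 3 ^ (k + 1) with hm
  have h3 : 3 ^ (k + 1) = 3 * 3 ^ k := pow_succ' 3 k
  have h3k : 2 * k + 1 ≤ 3 ^ k := by
    clear * - hk
    induction k, hk using Nat.le_induction with
    | base => norm_num
    | succ n hn ih => rw [pow_succ]; omega
  set e := 2 * 3 ^ k + 2 * (k - 1) with he
  have hem : e + 1 ≤ m := by omega
  have hm2 : 2 + 1 ≤ m := by omega
  -- the two error terms, each smaller than the gap by a factor `a`
  have hsm : (C + p) * a ^ (m - 1) ≤ a ^ m / 100 := by
    have : a ^ m = a * a ^ (m - 1) := by rw [← pow_succ']; congr 1; omega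
    rw [this]
    have h0 : 0 ≤ a ^ (m - 1) := by positivity
    nlinarith
  have hCe : C * a ^ e ≤ C * a ^ (m - 1) := by gcongr; omega
  have hpe : p * a ^ 2 ≤ p * a ^ (m - 1) := by gcongr; omega
  have ham : 0 < a ^ m := by positivity
  have hmm : a ^ (2 * m) = a ^ m * a ^ m := by rw [two_mul, pow_add]
  rw [hD, hmm]
  have hvn := norm_nonneg v
  by_cases hsp : w ∈ Submodule.span ℝ (Set.range g)
  · have hu : v + w ∈ Submodule.span ℝ (Set.range g) := Submodule.add_mem _ hv2 hsp
    have hun := hvw (add_mem_dualLattice hv1 hw) hu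
    have h1 := hinner _ hu
    rw [add_assoc, norm_add_sq_sub]
    refine le_trans ?_ (le_abs_self _)
    have h2 := (abs_le.1 h1).1
    set U := ‖v + w‖
    have hU : 0 ≤ U := norm_nonneg _
    have h4 : C * a ^ e * U ≤ a ^ m / 100 * U := by
      refine mul_le_mul_of_nonneg_right ?_ hU
      have : (0 : ℝ) ≤ p * a ^ (m - 1) := by positivity
      linarith
    nlinarith
  · have hgap : a ^ m * a ^ m < |‖x + w‖ ^ 2 - ‖x‖ ^ 2| := by
      by_contra! hcon
      apply hxE
      refine ⟨Fin.snoc g w, ?_, linearIndependent_finSnoc.2 ⟨hind, hsp⟩, ?_⟩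
      · intro i
        refine Fin.lastCases ?_ (fun i => ?_) i
        · rw [Fin.snoc_last, ← hpdef, hA]
          refine ⟨hw, norm_pos_iff.2 ?_, hwn⟩
          rintro rfl
          exact hsp (Submodule.zero_mem _)
        · rw [Fin.snoc_castSucc, ← hpdef, hA]
          exact hg i
      · intro i
        refine Fin.lastCases ?_ (fun i => ?_) i
        · rw [Fin.snoc_last]
          refine ⟨?_, (hx ⟨0, hk⟩).2⟩
          rw [Set.mem_ofPred_eq, hD, hmm, abs_sub_comm]
          exact hcon
        · rw [Fin.snoc_castSucc]
          refine ⟨?_, (hx i).2⟩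
          refine (hx i).1.out.trans ?_
          rw [hD, hDk]
          exact pow_le_pow_right₀ ha (by omega)
    have hexp : ‖x + v + w‖ ^ 2 - ‖x‖ ^ 2 =
        (‖x + w‖ ^ 2 - ‖x‖ ^ 2) + (‖v‖ ^ 2 + 2 * inner ℝ x v + 2 * inner ℝ v w) := by
      rw [add_assoc, norm_add_sq_sub, norm_add_sq_sub, norm_add_sq_real, inner_add_right]; ring
    have h1 := hinner v hv2
    have h2 : |inner ℝ v w| ≤ p * a ^ 2 * ‖v‖ :=
      (abs_real_inner_le_norm v w).trans (by rw [mul_comm]; gcongr)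
    have h4 : |‖v‖ ^ 2 + 2 * inner ℝ x v + 2 * inner ℝ v w| ≤ 19 / 25 * (a ^ m * a ^ m) := by
      have h5 : (C * a ^ e + p * a ^ 2) * ‖v‖ ≤ a ^ m / 100 * (1 / 2 * a ^ m) := by
        refine mul_le_mul (by linarith) hv3.le hvn (by positivity)
      have h6 : ‖v‖ ^ 2 ≤ (1 / 2 * a ^ m) ^ 2 := pow_le_pow_left₀ hvn hv3.le 2
      have h7 : 0 < a ^ m * a ^ m := by positivity
      rw [abs_le] at h1 h2 ⊢
      constructor <;> nlinarith [sq_nonneg ‖v‖]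
    rw [hexp]
    have h5 := abs_sub_abs_le_abs_sub (‖x + w‖ ^ 2 - ‖x‖ ^ 2)
      (-(‖v‖ ^ 2 + 2 * inner ℝ x v + 2 * inner ℝ v w))
    rw [abs_neg, sub_neg_eq_add] at h5
    linarith

end

section

/-! ### Numerical parameters -/

variable {d : ℕ}

theorem le_pOf {s : ℝ} (hs : sZero d ≤ s) :
    (3 * d - 1) / 2 * kap d + d * 3 ^ d / 4 + 6 ≤ pOf d s := by
  unfold sZero at hs
  unfold pOf kap
  linarith

theorem nine_le_pOf (hd : 2 ≤ d) {s : ℝ} (hs : sZero d ≤ s) : 9 ≤ pOf d s := by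
  have h := le_pOf hs
  have hd' : (2 : ℝ) ≤ d := by exact_mod_cast hd
  have hk : 4 ≤ kap d := by
    unfold kap
    have : (0 : ℝ) ≤ 3 ^ d := by positivity
    linarith
  have h2 : (0 : ℝ) ≤ d * 3 ^ d / 4 := by positivity
  nlinarith

theorem pOf_lt_pOne {s : ℝ} : pOf d s < 3 * pOne d s := by
  have := Nat.lt_floor_add_one (pOf d s / 3)
  unfold pOne
  push_cast
  linarith

theorem two_mul_pOne_add_one_le {s : ℝ} (hp : 9 ≤ pOf d s) :
    2 * (pOne d s : ℝ) + 1 ≤ pOf d s := by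
  have := Nat.floor_le (a := pOf d s / 3) (by linarith)
  unfold pOne
  push_cast
  linarith

theorem norm_pos_of_mem_shell {ρ : ℝ} (hρ : 0 < ρ) {x : Space d} (hx : x ∈ shell d ρ) :
    0 < ‖x‖ := by
  have h2 := hx.2
  rw [mem_ball_zero_iff, not_lt] at h2
  linarith

theorem rpow_neg_le_of_mem_shell {ρ e : ℝ} (hρ : 0 < ρ) (he : 0 ≤ e) {x : Space d}
    (hx : x ∈ shell d ρ) : ρ ^ (-e) ≤ (3 / 2) ^ e * ‖x‖ ^ (-e) := by
  have h1 := hx.1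
  rw [mem_ball_zero_iff] at h1
  have h0 := norm_pos_of_mem_shell hρ hx
  have h3 := Real.rpow_le_rpow_of_nonpos h0 h1.le (by linarith : -e ≤ 0)
  rw [Real.mul_rpow (by norm_num) hρ.le, Real.rpow_neg (by norm_num : (0 : ℝ) ≤ 3 / 2),
    inv_mul_le_iff₀ (by positivity)] at h3
  exact h3

/-! ### The resonance estimate -/

variable {b : Module.Basis (Fin d) ℝ (Space d)}

theorem mem_dualLattice_of_mem_indexSet {s ρ : ℝ} {k : ℕ} {g : Fin k → Space d} {γ h : Space d}
    (hγ : γ ∈ dualLattice b) (hh : h ∈ indexSet b s ρ g γ) : h ∈ dualLattice b := by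
  obtain ⟨v, hv, a, ha, -, rfl⟩ := hh
  exact add_mem_dualLattice (add_mem_dualLattice hγ hv.1) ha

/-- Coefficients adjacent to the block, but outside it, are of order `ρ^{-pα}`: each of `p₁`
successive uses of the eigenvalue equation gains the inverse of the energy gap. -/
theorem exists_norm_coeff_le_off_block (b : Module.Basis (Fin d) ℝ (Space d)) {s : ℝ}
    (hp : 9 ≤ pOf d s) {Q T : ℝ} (hQ : 0 ≤ Q) (hT : 0 ≤ T) :
    ∃ N : ℝ, 1 ≤ N ∧ ∀ (ρ : ℝ) (k : ℕ) (g : Fin k → Space d) (γ t : Space d) (Λ : ℝ)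
      (V a : Space d → ℂ), 0 < ρ →
    N ≤ rootScale d ρ → 1 ≤ k → (∀ i, g i ∈ dualBall b (pOf d s * ρ ^ alpha d)) →
    LinearIndependent ℝ g → γ ∈ dualLattice b →
    (∀ i, γ + t ∈ resonanceDomain ρ (ρ ^ alphaK d k) (g i)) →
    γ + t ∉ resonanceUnion b s ρ (k + 1) → |Λ - ‖γ + t‖ ^ 2| < 1 / 2 * ρ ^ alphaK d 1 →
    IsCoeffSystem b V a t Λ (pOf d s) Q T →
    ∀ h ∈ indexSet b s ρ g γ, ∀ γ' ∈ dualLattice b, ‖γ'‖ < ρ ^ alpha d →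
      h - γ' ∉ indexSet b s ρ g γ →
      ‖a (h - γ')‖ ≤ ((5 * Q) ^ pOne d s + T) * (ρ ^ alpha d) ^ (-pOf d s) := by
  obtain ⟨N, hN1, hgap⟩ := exists_energy_gap b (s := s) (by linarith)
  refine ⟨N + 2 + 5 * (Q + 1), by linarith, ?_⟩
  intro ρ k g γ t Λ V a hρ hN hk hg hind hγ hx hxE hΛ hsys h hh γ' hγ' hγ'n hnot
  have hroot : 2 ≤ rootScale d ρ := by linarith
  have hA : ρ ^ alpha d = rootScale d ρ ^ 2 := rpow_alpha hρ.le
  have hD : ρ ^ alphaK d (k + 1) = rootScale d ρ ^ (2 * 3 ^ (k + 1)) := rpow_alphaK hρ.le _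
  have hD1 : ρ ^ alphaK d 1 = rootScale d ρ ^ 6 := by rw [rpow_alphaK hρ.le]; norm_num
  have hgap' := fun v w => hgap ρ k g (γ + t) v w hρ.le (by linarith) hk hg hind hx hxE
  set p := pOf d s with hpdef
  set P := pOne d s with hP
  set A := ρ ^ alpha d with hAdef
  set D := ρ ^ alphaK d (k + 1) with hDdef
  have hA0 : 0 < A := by positivity
  have hA1 : 1 ≤ A := by rw [hA]; exact one_le_pow₀ (by linarith)
  have h9 : 9 ≤ 3 ^ (k + 1) := by
    calc 9 = 3 ^ 2 := by norm_num
      _ ≤ _ := Nat.pow_le_pow_right (by norm_num) (by omega)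
  have hD18 : rootScale d ρ ^ 18 ≤ D := by
    rw [hD]; exact pow_le_pow_right₀ (by linarith) (by omega)
  have hD0 : 0 < D := by rw [hD]; positivity
  have hDQ : 5 * (Q + 1) ≤ D := by
    refine le_trans ?_ hD18
    refine le_trans ?_ (le_self_pow₀ (by linarith) (by norm_num))
    linarith
  have hDA : A ^ 3 ≤ D := by
    rw [hA, ← pow_mul]
    exact (pow_le_pow_right₀ (by linarith) (by norm_num)).trans hD18
  have hDhalf : 1 / 2 * ρ ^ alphaK d 1 ≤ 1 / 25 * D := by
    rw [hD1]
    have h1 : (2 : ℝ) ^ 12 ≤ rootScale d ρ ^ 12 := by gcongr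
    have h2 : rootScale d ρ ^ 18 = rootScale d ρ ^ 6 * rootScale d ρ ^ 12 := by ring
    have h3 : 0 < rootScale d ρ ^ 6 := by positivity
    nlinarith
  obtain ⟨v, hv, w, hw, hwn, rfl⟩ := hh
  set θ := 5 / D with hθ
  have hθ0 : 0 ≤ θ := by positivity
  have hθQ : θ * (Q + 1) ≤ 1 := by
    rw [hθ, div_mul_eq_mul_div, div_le_one hD0]; exact hDQ
  set ε := T * A ^ (-p) with hε
  have hε0 : 0 ≤ ε := by positivity
  -- backward induction along paths issuing from the boundary of the block
  have key : ∀ n : ℕ, n ≤ P → ∀ τ ∈ dualLattice b, ‖τ‖ ≤ (P - n : ℝ) * A →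
      ‖a (γ + v + w - γ' - τ)‖ ≤ (θ * Q) ^ n + ε := by
    intro n
    induction n with
    | zero =>
      intro _ τ hτ _
      have := hsys.norm_le_one (γ + v + w - γ' - τ) (sub_mem_dualLattice (sub_mem_dualLattice
        (add_mem_dualLattice (add_mem_dualLattice hγ hv.1) hw) hγ') hτ)
      rw [pow_zero]; linarith
    | succ n ih =>
      intro hn τ hτ hτn
      have hnP : (n + 1 : ℝ) ≤ P := by exact_mod_cast hn
      have hτP : ‖τ‖ < P * A := by
        refine hτn.trans_lt ?_
        push_cast
        nlinarith [(Nat.cast_nonneg n : (0 : ℝ) ≤ n)]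
      set y := γ + v + w - γ' - τ with hy
      have hyΓ : y ∈ dualLattice b := sub_mem_dualLattice (sub_mem_dualLattice
        (add_mem_dualLattice (add_mem_dualLattice hγ hv.1) hw) hγ') hτ
      have hwΓ : w - γ' - τ ∈ dualLattice b := sub_mem_dualLattice (sub_mem_dualLattice hw hγ') hτ
      have hwN : ‖w - γ' - τ‖ < p * A := by
        have h1 := norm_sub_le (w - γ') τ
        have h2 := norm_sub_le w γ'
        have h3 := mul_le_mul_of_nonneg_right (two_mul_pOne_add_one_le hp) hA0.le
        rw [← hP, ← hpdef] at h3
        linarith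
      have hnB : v + (w - γ' - τ) ∉ resonanceBlock b ρ g := by
        intro hB
        exact hnot ⟨_, hB, τ, hτ, hτP, by abel⟩
      have hfar := hgap' v (w - γ' - τ) hv hwΓ hwN hnB
      have hyt : γ + t + v + (w - γ' - τ) = y + t := by rw [hy]; abel
      rw [hyt] at hfar
      have hlow : 1 / 5 * D ≤ |Λ - ‖y + t‖ ^ 2| := by
        have := abs_sub_abs_le_abs_sub (‖y + t‖ ^ 2 - ‖γ + t‖ ^ 2) (Λ - ‖γ + t‖ ^ 2)
        rw [sub_sub_sub_cancel_right, abs_sub_comm _ Λ] at this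
        linarith
      have heq := hsys.norm_sub_sum_le (by linarith) hyΓ (S := ∅) (by simp) (r := A)
        (β := (θ * Q) ^ n + ε) hA0 (by positivity) (by
          intro γ'' hγ'' _ _ hlt
          have := ih (by omega) (τ + γ'') (add_mem_dualLattice hτ hγ'') (by
            refine (norm_add_le _ _).trans ?_
            push_cast at hτn
            linarith)
          rwa [← sub_sub] at this)
      rw [Finset.sum_empty, sub_zero, norm_mul, Complex.norm_real, Real.norm_eq_abs] at heq
      have h1 : 1 / 5 * D * ‖a y‖ ≤ Q * ((θ * Q) ^ n + ε) + ε :=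
        (mul_le_mul_of_nonneg_right hlow (norm_nonneg _)).trans heq
      have h2 : ‖a y‖ ≤ θ * (Q * ((θ * Q) ^ n + ε) + ε) := by
        rw [hθ, div_mul_eq_mul_div, le_div_iff₀ hD0]
        linarith
      calc _ ≤ _ := h2
        _ = (θ * Q) ^ (n + 1) + θ * (Q + 1) * ε := by ring
        _ ≤ (θ * Q) ^ (n + 1) + 1 * ε := by gcongr
        _ = _ := by ring
  have h1 := key P le_rfl 0 zero_mem_dualLattice (by simp)
  rw [sub_zero] at h1
  refine h1.trans ?_
  rw [add_mul]
  refine add_le_add_left ?_ _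
  rw [hθ, div_mul_eq_mul_div, div_pow, div_eq_mul_inv]
  refine mul_le_mul_of_nonneg_left ?_ (by positivity)
  rw [Real.rpow_neg hA0.le]
  refine inv_anti₀ (by positivity) ?_
  calc A ^ p ≤ A ^ ((3 * P : ℕ) : ℝ) :=
        Real.rpow_le_rpow_of_exponent_le hA1 (by push_cast; exact pOf_lt_pOne.le)
    _ = (A ^ 3) ^ P := by rw [Real.rpow_natCast, pow_mul]
    _ ≤ D ^ P := by gcongr

theorem exists_card_indexFinset_le (b : Module.Basis (Fin d) ℝ (Space d)) (hd : 2 ≤ d) (s : ℝ) :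
    ∃ C N : ℝ, 0 < C ∧ 1 ≤ N ∧ ∀ (ρ : ℝ) (k : ℕ) (g : Fin k → Space d) (γ : Space d), 0 < ρ →
    N ≤ rootScale d ρ →
    ((indexFinset b s ρ g γ).card : ℝ) ≤ C * (rootScale d ρ ^ 3 ^ (k + 1)) ^ d := by
  have : NeZero d := ⟨by omega⟩
  classical
  obtain ⟨C, hC, hcard⟩ := exists_card_ball_le b
  refine ⟨C, 1 + 2 * pOne d s, hC, by linarith [(Nat.cast_nonneg (pOne d s) : (0 : ℝ) ≤ _)], ?_⟩
  intro ρ k g γ hρ hN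
  have hr : ρ ^ (1 / 2 * alphaK d (k + 1)) = rootScale d ρ ^ (3 ^ (k + 1)) :=
    rpow_half_alphaK hρ.le _
  have hA : ρ ^ alpha d = rootScale d ρ ^ 2 := rpow_alpha hρ.le
  set a := rootScale d ρ
  set P := pOne d s
  have hP0 : (0 : ℝ) ≤ P := Nat.cast_nonneg _
  have ha1 : 1 ≤ a := by linarith
  have h3 : 3 ≤ 3 ^ (k + 1) := le_self_pow₀ (by norm_num) (by omega)
  have := hcard (a ^ 3 ^ (k + 1)) (one_le_pow₀ ha1) ((indexFinset b s ρ g γ).image (· - γ)) (by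
    simp only [Finset.mem_image, indexFinset, Set.Finite.mem_toFinset]
    rintro _ ⟨h, ⟨v, hv, w, hw, hwn, rfl⟩, rfl⟩
    have he : γ + v + w - γ = v + w := by abel
    rw [he]
    refine ⟨add_mem_dualLattice hv.1 hw, (norm_add_le _ _).trans ?_⟩
    have hvn := hv.2.2
    rw [hr] at hvn
    rw [hA] at hwn
    have h4 : P * a ^ 2 ≤ 1 / 2 * a ^ 3 ^ (k + 1) := by
      have h5 : a ^ 3 ≤ a ^ 3 ^ (k + 1) := pow_le_pow_right₀ ha1 h3
      have h6 : a ^ 3 = a * a ^ 2 := by ring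
      nlinarith [sq_nonneg a]
    linarith)
  rwa [Finset.card_image_of_injective _ (sub_left_injective)] at this

/-- The vector of coefficients `a h`, with `h` in the block, is an approximate eigenvector of the
resonance matrix. -/
theorem IsCoeffSystem.norm_residual_le {q : Space d → ℝ} {a : Space d → ℂ} {t : Space d}
    {Λ p Q T s ρ : ℝ} (hsys : IsCoeffSystem b (potCoeff b q) a t Λ p Q T) (hp : 0 ≤ p) {k : ℕ}
    {g : Fin k → Space d} {γ : Space d} (hγ : γ ∈ dualLattice b) {r β : ℝ} (hr : 0 < r)
    (hβ0 : 0 ≤ β)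
    (hβ : ∀ h ∈ indexSet b s ρ g γ, ∀ γ' ∈ dualLattice b, ‖γ'‖ < r →
      h - γ' ∉ indexSet b s ρ g γ → ‖a (h - γ')‖ ≤ β) (h : indexFinset b s ρ g γ) :
    ‖(Λ : ℂ) * a h - (resonanceMatrix b q s ρ g γ t).mulVec (fun h => a h) h‖ ≤
      Q * β + T * r ^ (-p) := by
  classical
  have hmem : ∀ {h : Space d}, h ∈ indexFinset b s ρ g γ ↔ h ∈ indexSet b s ρ g γ := by
    intro h; simp [indexFinset]
  have hΓ : ∀ h ∈ indexFinset b s ρ g γ, h ∈ dualLattice b := fun h hh =>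
    mem_dualLattice_of_mem_indexSet hγ (hmem.1 hh)
  have hmul : (resonanceMatrix b q s ρ g γ t).mulVec (fun h => a h) h =
      ((‖(h : Space d) + t‖ ^ 2 : ℝ) : ℂ) * a h +
        ∑ γ' ∈ (indexFinset b s ρ g γ).image (h.1 - ·), potCoeff b q γ' * a (h - γ') := by
    rw [Finset.sum_image fun x _ y _ hxy => sub_right_injective hxy]
    simp only [sub_sub_cancel]
    rw [← Finset.sum_coe_sort (indexFinset b s ρ g γ)
      (fun h' => potCoeff b q (h.1 - h') * a h')]
    have hent : ∀ h' : indexFinset b s ρ g γ, resonanceMatrix b q s ρ g γ t h h' =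
        (if h = h' then ((‖(h : Space d) + t‖ ^ 2 : ℝ) : ℂ) else 0) + potCoeff b q (h.1 - h') := by
      intro h'
      simp only [resonanceMatrix, Matrix.of_apply]
      split_ifs with he
      · subst he
        rw [sub_self, hsys.V_zero, add_zero]
      · rw [zero_add]
    simp only [Matrix.mulVec, dotProduct, hent, add_mul, Finset.sum_add_distrib, ite_mul, zero_mul,
      Finset.sum_ite_eq, Finset.mem_univ, if_true]
  have := hsys.norm_sub_sum_le hp (hΓ h h.2) (S := (indexFinset b s ρ g γ).image (h.1 - ·))
    (by
      intro γ' hγ'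
      obtain ⟨h', hh', rfl⟩ := Finset.mem_image.1 hγ'
      exact sub_mem_dualLattice (hΓ h h.2) (hΓ h' hh')) hr hβ0
    (by
      intro γ' hγ' hnS _ hlt
      refine hβ h (hmem.1 h.2) γ' hγ' hlt fun hin => hnS ?_
      exact Finset.mem_image.2 ⟨h - γ', hmem.2 hin, by abel⟩)
  rw [hmul]
  convert! this using 2
  push_cast
  ring

/-- The resonance formula, for coefficient systems. -/
theorem exists_resonance_estimate (hd : 2 ≤ d) (b : Module.Basis (Fin d) ℝ (Space d)) {s : ℝ}
    (hp : 9 ≤ pOf d s) (q : Space d → ℝ) {Q T : ℝ} (hQ : 0 ≤ Q) (hT : 0 ≤ T) {c c₅ : ℝ}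
    (hc : c < pOf d s - d * 3 ^ d / 4) (hc₅ : 0 < c₅) :
    ∃ K ρ₀ : ℝ, 0 < K ∧ 0 < ρ₀ ∧ ∀ ρ : ℝ, ρ₀ ≤ ρ → ∀ (k : ℕ), 1 ≤ k → k ≤ d - 1 →
      ∀ g : Fin k → Space d, (∀ i, g i ∈ dualBall b (pOf d s * ρ ^ alpha d)) →
      LinearIndependent ℝ g → ∀ t : Space d, ∀ γ ∈ dualLattice b,
      (∀ i, γ + t ∈ resonanceDomain ρ (ρ ^ alphaK d k) (g i)) →
      γ + t ∉ resonanceUnion b s ρ (k + 1) → ∀ (Λ : ℝ) (a : Space d → ℂ),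
      IsCoeffSystem b (potCoeff b q) a t Λ (pOf d s) Q T →
      |Λ - ‖γ + t‖ ^ 2| < 1 / 2 * ρ ^ alphaK d 1 → c₅ * ρ ^ (-(c * alpha d)) < ‖a γ‖ →
      ∃ μ : ℝ, IsMatrixEigenvalue (resonanceMatrix b q s ρ g γ t) μ ∧
        |Λ - μ| ≤ K * ‖γ + t‖ ^ (-((pOf d s - c - d * 3 ^ d / 4) * alpha d)) := by
  classical
  obtain ⟨N₁, hN₁, hoff⟩ := exists_norm_coeff_le_off_block b hp hQ hT
  obtain ⟨C, N₂, hC, hN₂, hcard⟩ := exists_card_indexFinset_le b hd s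
  obtain ⟨ρ₀, hρ₀, hroot⟩ := exists_le_rootScale d (max N₁ N₂)
  set p := pOf d s with hpdef
  set K₁ := Q * ((5 * Q) ^ pOne d s + T) + T with hK₁
  have hK₁0 : 0 ≤ K₁ := by positivity
  set e := (p - c - d * 3 ^ d / 4) * alpha d with he
  have hα := alpha_pos d
  have he0 : 0 ≤ e := mul_nonneg (by linarith) hα.le
  refine ⟨√C * K₁ / c₅ * (3 / 2) ^ e + 1, ρ₀, by positivity, by linarith, ?_⟩
  intro ρ hρρ k hk hkd g hg hind t γ hγ hx hxE Λ a hsys hΛ haγ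
  have hρ1 : 1 ≤ ρ := hρ₀.trans hρρ
  have hρ : 0 < ρ := by linarith
  have hN := hroot ρ hρρ
  have hA0 : 0 < ρ ^ alpha d := by positivity
  set β := ((5 * Q) ^ pOne d s + T) * (ρ ^ alpha d) ^ (-p) with hβ
  have hres := hsys.norm_residual_le (by linarith) (s := s) (ρ := ρ) (g := g) hγ hA0 (β := β)
    (by positivity)
    (hoff ρ k g γ t Λ _ a hρ ((le_max_left _ _).trans hN) hk hg hind hγ hx hxE hΛ hsys)
  have hη : Q * β + T * (ρ ^ alpha d) ^ (-p) = K₁ * ρ ^ (-(p * alpha d)) := by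
    rw [hβ, ← Real.rpow_mul hρ.le, show alpha d * -p = -(p * alpha d) by ring]; ring
  rw [hη] at hres
  have hmem : γ ∈ indexFinset b s ρ g γ := by
    simp only [indexFinset, Set.Finite.mem_toFinset]
    refine ⟨0, ⟨zero_mem_dualLattice, Submodule.zero_mem _, ?_⟩, 0, zero_mem_dualLattice, ?_,
      by simp⟩
    · rw [norm_zero]; positivity
    · rw [norm_zero]
      have : 0 < pOne d s := Nat.succ_pos _
      positivity
  obtain ⟨μ, hμ, hle⟩ := exists_isMatrixEigenvalue_near
    (resonanceMatrix_isHermitian b q s ρ g γ t) (Λ := Λ) (η := K₁ * ρ ^ (-(p * alpha d)))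
    (κ := c₅ * ρ ^ (-(c * alpha d))) (by positivity) (by positivity)
    (v := fun h => a h) (i₀ := ⟨γ, hmem⟩) haγ.le hres
  refine ⟨μ, hμ, hle.trans ?_⟩
  have hsqrt : √(Fintype.card (indexFinset b s ρ g γ)) ≤ √C * ρ ^ (d * 3 ^ d / 4 * alpha d) := by
    rw [Fintype.card_coe]
    have h1 := hcard ρ k g γ hρ ((le_max_right _ _).trans hN)
    rw [← pow_mul, rootScale_pow hρ.le] at h1
    have h2 : ρ ^ (alpha d / 2 * ((3 ^ (k + 1) * d : ℕ) : ℝ)) ≤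
        (ρ ^ (d * 3 ^ d / 4 * alpha d)) ^ 2 := by
      rw [← Real.rpow_natCast, ← Real.rpow_mul hρ.le]
      refine Real.rpow_le_rpow_of_exponent_le hρ1 ?_
      have h3 : (3 : ℝ) ^ (k + 1) ≤ 3 ^ d := pow_le_pow_right₀ (by norm_num) (by omega)
      push_cast
      have h4 : (3 : ℝ) ^ (k + 1) * (alpha d * d) ≤ 3 ^ d * (alpha d * d) := by gcongr
      linarith
    calc √((indexFinset b s ρ g γ).card : ℝ)
        ≤ √(C * (ρ ^ (d * 3 ^ d / 4 * alpha d)) ^ 2) := by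
          refine Real.sqrt_le_sqrt (h1.trans ?_)
          gcongr
      _ = _ := by rw [Real.sqrt_mul hC.le, Real.sqrt_sq (by positivity)]
  have hsh := rpow_neg_le_of_mem_shell hρ he0 (hx ⟨0, hk⟩).2
  have hexp : ρ ^ (d * 3 ^ d / 4 * alpha d) * ρ ^ (-(p * alpha d)) / ρ ^ (-(c * alpha d)) =
      ρ ^ (-e) := by
    rw [← Real.rpow_add hρ, ← Real.rpow_sub hρ]
    congr 1
    rw [he]; ring
  have hx0 : 0 ≤ ‖γ + t‖ ^ (-e) := by positivity
  calc _ ≤ √C * ρ ^ (d * 3 ^ d / 4 * alpha d) * (K₁ * ρ ^ (-(p * alpha d))) /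
        (c₅ * ρ ^ (-(c * alpha d))) := by gcongr
    _ = √C * K₁ / c₅ * (ρ ^ (d * 3 ^ d / 4 * alpha d) * ρ ^ (-(p * alpha d)) /
        ρ ^ (-(c * alpha d))) := by
          field_simp
    _ = √C * K₁ / c₅ * ρ ^ (-e) := by rw [hexp]
    _ ≤ √C * K₁ / c₅ * ((3 / 2) ^ e * ‖γ + t‖ ^ (-e)) := by gcongr
    _ ≤ _ := by rw [add_mul, mul_assoc (√C * K₁ / c₅)]; linarith

end

section

/-! ### Sums over paths in the dual lattice -/

variable {d : ℕ}

open Classical in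
/-- The `k`-tuples of steps in `D` all of whose partial sums are nonzero. -/
noncomputable def paths (D : Finset (Space d)) (k : ℕ) : Finset (Fin k → Space d) :=
  (Fintype.piFinset fun _ => D).filter fun g => ∀ j, ∑ i ∈ Finset.Iic j, g i ≠ 0

theorem mem_paths {D : Finset (Space d)} {k : ℕ} {g : Fin k → Space d} :
    g ∈ paths D k ↔ (∀ i, g i ∈ D) ∧ ∀ j, ∑ i ∈ Finset.Iic j, g i ≠ 0 := by
  simp [paths]

theorem sum_Iic_castSucc {k : ℕ} (g : Fin (k + 1) → Space d) (j : Fin k) :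
    ∑ i ∈ Finset.Iic j.castSucc, g i = ∑ i ∈ Finset.Iic j, g i.castSucc := by
  rw [← Fin.map_castSuccEmb_Iic, Finset.sum_map]; rfl

theorem sum_Iic_last {k : ℕ} (g : Fin (k + 1) → Space d) :
    ∑ i ∈ Finset.Iic (Fin.last k), g i = ∑ i, g i := by
  congr 1
  ext i
  simp [Fin.le_last]

open Classical in
/-- A path of length `k + 1` is a path of length `k` followed by one more step. -/
theorem sum_paths_succ {M : Type*} [AddCommMonoid M] (D : Finset (Space d)) (k : ℕ)
    (f : (Fin (k + 1) → Space d) → M) :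
    ∑ g ∈ paths D (k + 1), f g =
      ∑ g ∈ paths D k, ∑ y ∈ D.filter (fun y => ∑ i, g i + y ≠ 0), f (Fin.snoc g y) := by
  rw [Finset.sum_sigma']
  refine Finset.sum_bij' (fun g _ => ⟨Fin.init g, g (Fin.last k)⟩) (fun z _ => Fin.snoc z.1 z.2)
    ?_ ?_ ?_ ?_ ?_
  · intro g hg
    obtain ⟨h1, h2⟩ := mem_paths.1 hg
    simp only [Finset.mem_sigma, Finset.mem_filter, mem_paths]
    refine ⟨⟨fun i => h1 _, fun j => ?_⟩, h1 _, ?_⟩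
    · have := h2 j.castSucc
      rwa [sum_Iic_castSucc] at this
    · have := h2 (Fin.last k)
      rwa [sum_Iic_last, Fin.sum_univ_castSucc] at this
  · rintro ⟨g, y⟩ hz
    simp only [Finset.mem_sigma, Finset.mem_filter, mem_paths] at hz
    obtain ⟨⟨h1, h2⟩, h3, h4⟩ := hz
    rw [mem_paths]
    constructor
    · intro i
      refine Fin.lastCases ?_ (fun i => ?_) i
      · rwa [Fin.snoc_last]
      · rw [Fin.snoc_castSucc]; exact h1 i
    · intro j
      refine Fin.lastCases ?_ (fun j => ?_) j
      · rw [sum_Iic_last, Fin.sum_univ_castSucc]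
        simpa only [Fin.snoc_castSucc, Fin.snoc_last] using h4
      · rw [sum_Iic_castSucc]
        simpa only [Fin.snoc_castSucc] using h2 j
  · intro g _
    exact Fin.snoc_init_self g
  · rintro ⟨g, y⟩ _
    simp
  · intro g _
    rw [Fin.snoc_init_self]

theorem norm_sum_paths_le {D : Finset (Space d)} {V : Space d → ℂ} {Q B : ℝ}
    (hV : ∑ y ∈ D, ‖V y‖ ≤ Q) (hB : 0 ≤ B) {k : ℕ} {f : (Fin k → Space d) → ℂ}
    (hf : ∀ g ∈ paths D k, ‖f g‖ ≤ (∏ i, ‖V (g i)‖) * B) :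
    ‖∑ g ∈ paths D k, f g‖ ≤ Q ^ k * B := by
  classical
  refine (norm_sum_le_of_le _ hf).trans ?_
  rw [← Finset.sum_mul]
  refine mul_le_mul_of_nonneg_right ?_ hB
  calc _ ≤ ∑ g ∈ Fintype.piFinset fun _ : Fin k => D, ∏ i, ‖V (g i)‖ :=
        Finset.sum_le_sum_of_subset_of_nonneg (Finset.filter_subset _ _) fun g _ _ =>
          Finset.prod_nonneg fun i _ => norm_nonneg _
    _ = (∑ y ∈ D, ‖V y‖) ^ k := by
        rw [Finset.sum_pow']
    _ ≤ Q ^ k := pow_le_pow_left₀ (Finset.sum_nonneg fun _ _ => norm_nonneg _) hV k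

theorem norm_prod_le_pow_card {ι : Type*} (S : Finset ι) {u : ι → ℂ} {θ : ℝ}
    (hu : ∀ i ∈ S, ‖u i‖ ≤ θ) : ‖∏ i ∈ S, u i‖ ≤ θ ^ S.card := by
  rw [norm_prod, ← Finset.prod_const]
  exact Finset.prod_le_prod (fun _ _ => norm_nonneg _) hu

theorem norm_prod_inv_sub_prod_inv_le {ι : Type*} (S : Finset ι) {u v : ι → ℂ} {θ η : ℝ}
    (hu : ∀ i ∈ S, u i ≠ 0 ∧ ‖(u i)⁻¹‖ ≤ θ) (hv : ∀ i ∈ S, v i ≠ 0 ∧ ‖(v i)⁻¹‖ ≤ θ)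
    (hθ : 0 ≤ θ) (hη : ∀ i ∈ S, ‖u i - v i‖ ≤ η) :
    ‖∏ i ∈ S, (u i)⁻¹ - ∏ i ∈ S, (v i)⁻¹‖ ≤ S.card * (θ ^ (S.card + 1) * η) := by
  classical
  induction S using Finset.induction_on with
  | empty => simp
  | insert j S hj ih =>
    have ih' := ih (fun i hi => hu i (by simp [hi])) (fun i hi => hv i (by simp [hi]))
      (fun i hi => hη i (by simp [hi]))
    obtain ⟨hu0, hu1⟩ := hu j (by simp)
    obtain ⟨hv0, hv1⟩ := hv j (by simp)
    have hη1 := hη j (by simp)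
    have hη0 : 0 ≤ η := (norm_nonneg _).trans hη1
    rw [Finset.prod_insert hj, Finset.prod_insert hj, Finset.card_insert_of_notMem hj]
    set P := ∏ i ∈ S, (u i)⁻¹
    set P' := ∏ i ∈ S, (v i)⁻¹
    have hP'n : ‖P'‖ ≤ θ ^ S.card := by
      exact norm_prod_le_pow_card S fun i hi => (hv i (by simp [hi])).2
    have hdiff : ‖(u j)⁻¹ - (v j)⁻¹‖ ≤ θ * θ * η := by
      rw [inv_sub_inv hu0 hv0, div_eq_mul_inv, mul_inv, norm_mul, norm_mul, norm_sub_rev, mul_comm]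
      gcongr
    have : (u j)⁻¹ * P - (v j)⁻¹ * P' = (u j)⁻¹ * (P - P') + ((u j)⁻¹ - (v j)⁻¹) * P' := by ring
    rw [this]
    refine (norm_add_le _ _).trans ?_
    rw [norm_mul, norm_mul]
    calc _ ≤ θ * (S.card * (θ ^ (S.card + 1) * η)) + θ * θ * η * θ ^ S.card := by gcongr
      _ = _ := by push_cast; ring

/-! ### The non-resonance estimate -/

variable (b : Module.Basis (Fin d) ℝ (Space d))

theorem dualBall_finite (r : ℝ) : (dualBall b r).Finite :=
  (dualLattice_ball_finite b r).subset fun _ h => ⟨h.1, h.2.2⟩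

/-- The vectors of `Γ(r)` as a finite set. -/
noncomputable def dualBallFinset (r : ℝ) : Finset (Space d) := (dualBall_finite b r).toFinset

variable {b}

theorem mem_dualBallFinset {r : ℝ} {y : Space d} :
    y ∈ dualBallFinset b r ↔ y ∈ dualLattice b ∧ 0 < ‖y‖ ∧ ‖y‖ < r := by
  rw [dualBallFinset, Set.Finite.mem_toFinset]
  exact Iff.rfl

variable {q : Space d → ℝ}

theorem corrS_eq_sum_paths (ρ : ℝ) (k : ℕ) (z : ℂ) (x : Space d) :
    corrS b q ρ k z x = ∑ g ∈ paths (dualBallFinset b (ρ ^ alpha d)) k,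
      ((∏ i, potCoeff b q (g i)) * potCoeff b q (-∑ i, g i)) /
        ∏ j, (z - ((‖x - ∑ i ∈ Finset.Iic j, g i‖ ^ 2 : ℝ) : ℂ)) := by
  rw [corrS, ← finsum_mem_coe_finset]
  congr 1
  funext g
  have : g ∈ {g : Fin k → Space d | (∀ i, g i ∈ dualBall b (ρ ^ alpha d)) ∧
      ∀ j, ∑ i ∈ Finset.Iic j, g i ≠ 0} ↔
      g ∈ (paths (dualBallFinset b (ρ ^ alpha d)) k : Set (Fin k → Space d)) := by
    rw [Finset.mem_coe, mem_paths]
    simp only [mem_dualBallFinset]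
    rfl
  simp only [this]

/-- The partial sums along a path are short nonzero dual vectors. -/
theorem partial_sum_mem {A : ℝ} {k : ℕ} {g : Fin k → Space d} (hg : g ∈ paths (dualBallFinset b A) k)
    (j : Fin k) : ∑ i ∈ Finset.Iic j, g i ∈ dualLattice b ∧ ∑ i ∈ Finset.Iic j, g i ≠ 0 ∧
      ‖∑ i ∈ Finset.Iic j, g i‖ ≤ k * A := by
  obtain ⟨h1, h2⟩ := mem_paths.1 hg
  simp only [mem_dualBallFinset] at h1
  refine ⟨sum_mem_dualLattice _ fun i _ => (h1 i).1, h2 j, ?_⟩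
  have hA : 0 ≤ A := (h1 j).2.1.le.trans (h1 j).2.2.le
  refine (norm_sum_le_of_le _ fun i _ => (h1 i).2.2.le).trans ?_
  rw [Finset.sum_const, nsmul_eq_mul]
  gcongr
  exact (Finset.card_le_univ (Finset.Iic j)).trans_eq (Fintype.card_fin k)

theorem norm_prod_div_le {A δ R : ℝ} {z : ℂ} {x : Space d} (hδ : 0 < δ)
    (hz : ∀ σ ∈ dualLattice b, σ ≠ 0 → ‖σ‖ < R → δ ≤ ‖z - ((‖x - σ‖ ^ 2 : ℝ) : ℂ)‖)
    {k : ℕ} (hk : k * A < R) {g : Fin k → Space d} (hg : g ∈ paths (dualBallFinset b A) k)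
    (j : Fin k) : z - ((‖x - ∑ i ∈ Finset.Iic j, g i‖ ^ 2 : ℝ) : ℂ) ≠ 0 ∧
      ‖(z - ((‖x - ∑ i ∈ Finset.Iic j, g i‖ ^ 2 : ℝ) : ℂ))⁻¹‖ ≤ δ⁻¹ := by
  obtain ⟨h1, h2, h3⟩ := partial_sum_mem hg j
  have := hz _ h1 h2 (h3.trans_lt hk)
  exact ⟨norm_pos_iff.1 (hδ.trans_le this), by rw [norm_inv]; exact inv_anti₀ hδ this⟩

theorem norm_corrS_le {Q δ R ρ : ℝ} {z : ℂ} {x : Space d} (hδ : 0 < δ)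
    (hQ : ∀ S : Finset (Space d), (∀ y ∈ S, y ∈ dualLattice b) → ∑ y ∈ S, ‖potCoeff b q y‖ ≤ Q)
    (hz : ∀ σ ∈ dualLattice b, σ ≠ 0 → ‖σ‖ < R → δ ≤ ‖z - ((‖x - σ‖ ^ 2 : ℝ) : ℂ)‖)
    {k : ℕ} (hk : k * ρ ^ alpha d < R) :
    ‖corrS b q ρ k z x‖ ≤ Q ^ k * (δ⁻¹ ^ k * Q) := by
  have hQ0 : 0 ≤ Q := by simpa using hQ ∅ (by simp)
  rw [corrS_eq_sum_paths]
  refine norm_sum_paths_le (hQ _ fun y hy => (mem_dualBallFinset.1 hy).1) (by positivity)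
    fun g hg => ?_
  have h1 : ‖potCoeff b q (-∑ i, g i)‖ ≤ Q := by
    have := hQ {-∑ i, g i} (by
      simp only [Finset.mem_singleton, forall_eq]
      exact neg_mem_dualLattice (sum_mem_dualLattice _ fun i _ =>
        (mem_dualBallFinset.1 ((mem_paths.1 hg).1 i)).1))
    simpa using this
  rw [div_eq_mul_inv, norm_mul, norm_mul, norm_prod, mul_assoc, ← Finset.prod_inv_distrib,
    mul_comm ‖potCoeff b q (-∑ i, g i)‖]
  have h2 := norm_prod_le_pow_card Finset.univ fun j _ => (norm_prod_div_le hδ hz hk hg j).2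
  rw [Finset.card_univ, Fintype.card_fin] at h2
  have h3 : 0 ≤ ∏ i, ‖potCoeff b q (g i)‖ := Finset.prod_nonneg fun _ _ => norm_nonneg _
  gcongr

theorem norm_corrS_sub_le {Q δ R ρ : ℝ} {z z' : ℂ} {x : Space d} (hδ : 0 < δ)
    (hQ : ∀ S : Finset (Space d), (∀ y ∈ S, y ∈ dualLattice b) → ∑ y ∈ S, ‖potCoeff b q y‖ ≤ Q)
    (hz : ∀ σ ∈ dualLattice b, σ ≠ 0 → ‖σ‖ < R → δ ≤ ‖z - ((‖x - σ‖ ^ 2 : ℝ) : ℂ)‖)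
    (hz' : ∀ σ ∈ dualLattice b, σ ≠ 0 → ‖σ‖ < R → δ ≤ ‖z' - ((‖x - σ‖ ^ 2 : ℝ) : ℂ)‖)
    {k : ℕ} (hk : k * ρ ^ alpha d < R) :
    ‖corrS b q ρ k z x - corrS b q ρ k z' x‖ ≤
      Q ^ k * (Q * (k * (δ⁻¹ ^ (k + 1) * ‖z - z'‖))) := by
  have hQ0 : 0 ≤ Q := by simpa using hQ ∅ (by simp)
  rw [corrS_eq_sum_paths, corrS_eq_sum_paths, ← Finset.sum_sub_distrib]
  refine norm_sum_paths_le (hQ _ fun y hy => (mem_dualBallFinset.1 hy).1) (by positivity)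
    fun g hg => ?_
  have h1 : ‖potCoeff b q (-∑ i, g i)‖ ≤ Q := by
    have := hQ {-∑ i, g i} (by
      simp only [Finset.mem_singleton, forall_eq]
      exact neg_mem_dualLattice (sum_mem_dualLattice _ fun i _ =>
        (mem_dualBallFinset.1 ((mem_paths.1 hg).1 i)).1))
    simpa using this
  rw [div_eq_mul_inv, div_eq_mul_inv, ← mul_sub, norm_mul, norm_mul, norm_prod, mul_assoc,
    ← Finset.prod_inv_distrib, ← Finset.prod_inv_distrib]
  have h2 := norm_prod_inv_sub_prod_inv_le (Finset.univ : Finset (Fin k))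
    (fun j _ => norm_prod_div_le hδ hz hk hg j) (fun j _ => norm_prod_div_le hδ hz' hk hg j)
    (inv_nonneg.2 hδ.le) (η := ‖z - z'‖) (fun j _ => by rw [sub_sub_sub_cancel_right])
  rw [Finset.card_univ, Fintype.card_fin] at h2
  have h3 : 0 ≤ ∏ i, ‖potCoeff b q (g i)‖ := Finset.prod_nonneg fun _ _ => norm_nonneg _
  gcongr

open Classical in
/-- The remainder after `k` substitutions of the eigenvalue equation into itself: the sum over
paths of length `k`, followed by one further step that does not return to the origin. -/
noncomputable def pathRemainder (D : Finset (Space d)) (V a : Space d → ℂ) (γ x : Space d) (Λ : ℂ)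
    (k : ℕ) : ℂ :=
  ∑ g ∈ paths D k, (∏ i, V (g i)) / (∏ j, (Λ - ((‖x - ∑ i ∈ Finset.Iic j, g i‖ ^ 2 : ℝ) : ℂ))) *
    ∑ y ∈ D.filter (fun y => ∑ i, g i + y ≠ 0), V y * a (γ - (∑ i, g i + y))

open Classical in
theorem pathRemainder_eq (D : Finset (Space d)) (V a : Space d → ℂ) (γ x : Space d) (Λ : ℂ) (k : ℕ) :
    pathRemainder D V a γ x Λ k = ∑ g ∈ paths D (k + 1), (∏ i, V (g i)) /
      (∏ j : Fin k, (Λ - ((‖x - ∑ i ∈ Finset.Iic j.castSucc, g i‖ ^ 2 : ℝ) : ℂ))) *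
        a (γ - ∑ i, g i) := by
  rw [sum_paths_succ, pathRemainder]
  refine Finset.sum_congr rfl fun g _ => ?_
  rw [Finset.mul_sum]
  refine Finset.sum_congr rfl fun y _ => ?_
  simp only [Fin.prod_univ_castSucc, Fin.sum_univ_castSucc, Fin.snoc_castSucc, Fin.snoc_last,
    sum_Iic_castSucc]
  ring

end

section

variable {d : ℕ} {b : Module.Basis (Fin d) ℝ (Space d)} {q : Space d → ℝ} {a : Space d → ℂ}
  {t γ : Space d} {Λ p Q T : ℝ}

open Classical in
/-- The eigenvalue equation at `γ - σ`, with the step back to `γ` separated from the others. -/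
theorem IsCoeffSystem.norm_step_le (hsys : IsCoeffSystem b (potCoeff b q) a t Λ p Q T) (hp : 0 ≤ p)
    {A : ℝ} (hA : 0 < A) (hγ : γ ∈ dualLattice b) {σ : Space d} (hσ : σ ∈ dualLattice b) :
    ‖((Λ - ‖γ + t - σ‖ ^ 2 : ℝ) : ℂ) * a (γ - σ) - (potCoeff b q (-σ) * a γ +
      ∑ y ∈ (dualBallFinset b A).filter (fun y => σ + y ≠ 0),
        potCoeff b q y * a (γ - (σ + y)))‖ ≤ T * A ^ (-p) := by
  set D := (dualBallFinset b A).filter (fun y => σ + y ≠ 0) with hD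
  have hnot : -σ ∉ D := by simp [hD]
  have h := hsys.norm_sub_sum_le hp (sub_mem_dualLattice hγ hσ) (S := insert (-σ) D) (r := A)
    (β := 0) (by
      intro y hy
      rcases Finset.mem_insert.1 hy with rfl | hy
      · exact neg_mem_dualLattice hσ
      · exact (mem_dualBallFinset.1 (Finset.mem_filter.1 hy).1).1) hA le_rfl (by
      intro y hy hyS h0 hlt
      refine absurd ?_ hyS
      by_cases hs : σ + y = 0
      · rw [← neg_eq_of_add_eq_zero_right hs]
        exact Finset.mem_insert_self _ _
      · exact Finset.mem_insert_of_mem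
          (Finset.mem_filter.2 ⟨mem_dualBallFinset.2 ⟨hy, h0, hlt⟩, hs⟩))
  rw [Finset.sum_insert hnot, mul_zero, zero_add] at h
  simpa only [sub_neg_eq_add, sub_add_cancel, sub_sub, add_sub_right_comm, neg_neg] using h

/-- The expansion obtained by substituting the eigenvalue equation `n` times into itself and
collecting the terms that return to `a γ`. -/
theorem IsCoeffSystem.norm_expansion_le {ρ δ R : ℝ}
    (hsys : IsCoeffSystem b (potCoeff b q) a t Λ p Q T) (hp : 0 ≤ p) (hρ : 0 < ρ)
    (hγ : γ ∈ dualLattice b) (hδ : 0 < δ) (hQδ : Q * δ⁻¹ ≤ 1)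
    (hfar : ∀ σ ∈ dualLattice b, σ ≠ 0 → ‖σ‖ < R →
      δ ≤ ‖(Λ : ℂ) - ((‖γ + t - σ‖ ^ 2 : ℝ) : ℂ)‖) (n : ℕ) (hn : n * ρ ^ alpha d < R) :
    ‖((Λ - ‖γ + t‖ ^ 2 : ℝ) : ℂ) * a γ -
      (∑ k ∈ Finset.Ioc 0 n, corrS b q ρ k Λ (γ + t)) * a γ -
      pathRemainder (dualBallFinset b (ρ ^ alpha d)) (potCoeff b q) a γ (γ + t) Λ n‖ ≤
      (n + 1) * (T * (ρ ^ alpha d) ^ (-p)) := by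
  classical
  have hA : 0 < ρ ^ alpha d := by positivity
  have hQ0 : 0 ≤ Q := (tsum_nonneg fun _ => norm_nonneg _).trans hsys.tsum_le
  set A := ρ ^ alpha d with hAdef
  have hε : 0 ≤ T * A ^ (-p) := (norm_nonneg _).trans
    (hsys.norm_step_le hp hA hγ (zero_mem_dualLattice (b := b)))
  set D := dualBallFinset b A with hD
  have hDQ : ∑ y ∈ D, ‖potCoeff b q y‖ ≤ Q :=
    hsys.sum_norm_le fun y hy => (mem_dualBallFinset.1 hy).1
  induction n with
  | zero =>
    have h := hsys.norm_step_le hp hA hγ (zero_mem_dualLattice (b := b))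
    have h0 : paths D 0 = {Fin.elim0} := by
      ext g
      simp only [mem_paths, Finset.mem_singleton, IsEmpty.forall_iff, and_self, true_iff]
      exact Subsingleton.elim _ _
    rw [pathRemainder, h0, Finset.sum_singleton]
    simpa [hsys.V_zero, ← hD] using h
  | succ n ih =>
    have hnn : (n : ℝ) * A < R := by
      refine lt_of_le_of_lt ?_ hn
      push_cast; nlinarith
    have ih' := ih hnn
    set x := γ + t with hx
    have hstep : ‖pathRemainder D (potCoeff b q) a γ x Λ n - (corrS b q ρ (n + 1) Λ x * a γ +
        pathRemainder D (potCoeff b q) a γ x Λ (n + 1))‖ ≤ T * A ^ (-p) := by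
      rw [pathRemainder_eq, corrS_eq_sum_paths, pathRemainder, Finset.sum_mul,
        ← Finset.sum_add_distrib, ← Finset.sum_sub_distrib]
      refine (norm_sum_paths_le (k := n + 1) hDQ (B := δ⁻¹ ^ (n + 1) * (T * A ^ (-p)))
        (by positivity) ?_).trans ?_
      · intro g hg
        have hσ : ∑ i, g i ∈ dualLattice b := sum_mem_dualLattice _ fun i _ =>
          (mem_dualBallFinset.1 ((mem_paths.1 hg).1 i)).1
        have hstep := hsys.norm_step_le hp hA hγ hσ
        have hden := norm_prod_div_le hδ hfar hn hg
        have hlast := (hden (Fin.last n)).1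
        rw [sum_Iic_last] at hlast
        rw [← hx] at hstep
        have e1 : ((Λ - ‖x - ∑ i, g i‖ ^ 2 : ℝ) : ℂ) =
            (Λ : ℂ) - ((‖x - ∑ i, g i‖ ^ 2 : ℝ) : ℂ) := by push_cast; ring
        rw [e1] at hstep
        have e2 : ∀ (P W q₀ a₀ a₁ S z : ℂ), z ≠ 0 →
            P / W * a₁ - (P * q₀ / (W * z) * a₀ + P / (W * z) * S) =
              P * (W * z)⁻¹ * (z * a₁ - (q₀ * a₀ + S)) := by
          intro P W q₀ a₀ a₁ S z hz
          by_cases hW : W = 0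
          · simp [hW]
          · field_simp
        have e3 := Fin.prod_univ_castSucc
          fun j : Fin (n + 1) => (Λ : ℂ) - ((‖x - ∑ i ∈ Finset.Iic j, g i‖ ^ 2 : ℝ) : ℂ)
        rw [sum_Iic_last] at e3
        have h2 := norm_prod_le_pow_card Finset.univ fun j _ => (hden j).2
        rw [Finset.card_univ, Fintype.card_fin, Finset.prod_inv_distrib, e3] at h2
        rw [e3, e2 _ _ _ _ _ _ _ hlast, norm_mul, norm_mul, norm_prod, mul_assoc]
        gcongr
      · have : Q ^ (n + 1) * (δ⁻¹ ^ (n + 1) * (T * A ^ (-p))) =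
            (Q * δ⁻¹) ^ (n + 1) * (T * A ^ (-p)) := by rw [mul_pow]; ring
        rw [this]
        exact mul_le_of_le_one_left hε (pow_le_one₀ (by positivity) hQδ)
    have hsum : ∑ k ∈ Finset.Ioc 0 (n + 1), corrS b q ρ k Λ x =
        ∑ k ∈ Finset.Ioc 0 n, corrS b q ρ k Λ x + corrS b q ρ (n + 1) Λ x := by
      rw [← Finset.sum_Ioc_consecutive _ (Nat.zero_le n) (Nat.le_succ n)]
      congr 1
      rw [Nat.Ioc_succ_singleton, Finset.sum_singleton]
    have htot := norm_add_le_of_le ih' hstep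
    rw [hsum]
    refine le_trans (le_of_eq ?_) (htot.trans_eq ?_)
    · congr 1; ring
    · push_cast; ring

theorem IsCoeffSystem.norm_pathRemainder_le {ρ δ R : ℝ}
    (hsys : IsCoeffSystem b (potCoeff b q) a t Λ p Q T)
    (hγ : γ ∈ dualLattice b) (hδ : 0 < δ)
    (hfar : ∀ σ ∈ dualLattice b, σ ≠ 0 → ‖σ‖ < R →
      δ ≤ ‖(Λ : ℂ) - ((‖γ + t - σ‖ ^ 2 : ℝ) : ℂ)‖) (n : ℕ) (hn : n * ρ ^ alpha d < R) :
    ‖pathRemainder (dualBallFinset b (ρ ^ alpha d)) (potCoeff b q) a γ (γ + t) Λ n‖ ≤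
      Q ^ n * (δ⁻¹ ^ n * Q) := by
  classical
  have hQ0 : 0 ≤ Q := (tsum_nonneg fun _ => norm_nonneg _).trans hsys.tsum_le
  have hΓ : ∀ y ∈ dualBallFinset b (ρ ^ alpha d), y ∈ dualLattice b :=
    fun y hy => (mem_dualBallFinset.1 hy).1
  refine norm_sum_paths_le (hsys.sum_norm_le hΓ) (by positivity) fun g hg => ?_
  have hσ : ∑ i, g i ∈ dualLattice b := sum_mem_dualLattice _ fun i _ => hΓ _ ((mem_paths.1 hg).1 i)
  have h2 := norm_prod_le_pow_card Finset.univ fun j _ => (norm_prod_div_le hδ hfar hn hg j).2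
  rw [Finset.card_univ, Fintype.card_fin, Finset.prod_inv_distrib] at h2
  have h3 : ‖∑ y ∈ (dualBallFinset b (ρ ^ alpha d)).filter (fun y => ∑ i, g i + y ≠ 0),
      potCoeff b q y * a (γ - (∑ i, g i + y))‖ ≤ Q := by
    refine le_trans ?_ (hsys.sum_norm_le (S := (dualBallFinset b (ρ ^ alpha d)).filter
      (fun y => ∑ i, g i + y ≠ 0)) fun y hy => hΓ y (Finset.mem_filter.1 hy).1)
    refine norm_sum_le_of_le _ fun y hy => ?_
    rw [norm_mul]
    exact mul_le_of_le_one_right (norm_nonneg _) (hsys.norm_le_one _ (sub_mem_dualLattice hγ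
      (add_mem_dualLattice hσ (hΓ y (Finset.mem_filter.1 hy).1))))
  rw [div_eq_mul_inv, norm_mul, norm_mul, norm_prod, mul_assoc]
  have h4 : 0 ≤ ∏ i, ‖potCoeff b q (g i)‖ := Finset.prod_nonneg fun _ _ => norm_nonneg _
  gcongr

/-- Fixed-point iteration: from an implicit equation for `Λ` to the explicit corrections `F_j`. -/
theorem norm_sub_corrF_le {ρ R D K : ℝ} {x : Space d} {m M : ℕ} (hD : 1 ≤ D) (hK : 0 ≤ K)
    (hmM : m ≤ M) (hρ : 0 ≤ ρ ^ alpha d) (hM : M * ρ ^ alpha d < R)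
    (hQ : ∀ S : Finset (Space d), (∀ y ∈ S, y ∈ dualLattice b) → ∑ y ∈ S, ‖potCoeff b q y‖ ≤ Q)
    (hfar : ∀ σ ∈ dualLattice b, σ ≠ 0 → ‖σ‖ < R →
      D / 2 ≤ ‖(Λ : ℂ) - ((‖x - σ‖ ^ 2 : ℝ) : ℂ)‖)
    (hmain : ‖((Λ - ‖x‖ ^ 2 : ℝ) : ℂ) - ∑ k ∈ Finset.Ioc 0 M, corrS b q ρ k Λ x‖ ≤ K * D⁻¹ ^ m)
    (hDL : 4 * (Q + 1) ≤ D) (hDM : 2 * (M * M * (4 * (Q + 1)) ^ 2) ≤ D)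
    (hDK : 4 * (2 * (K + M * (Q * (4 * (Q + 1)) ^ M))) ≤ D) (j : ℕ) (hj : j + 1 ≤ m) :
    ‖(Λ : ℂ) - (((‖x‖ ^ 2 : ℝ) : ℂ) + corrF b q ρ x j)‖ ≤
      2 * (K + M * (Q * (4 * (Q + 1)) ^ M)) * D⁻¹ ^ (j + 1) := by
  have hQ0 : 0 ≤ Q := by simpa using hQ ∅ (by simp)
  set L := 4 * (Q + 1) with hL
  set κ := 2 * (K + M * (Q * L ^ M)) with hκ
  have hL1 : 1 ≤ L := by linarith
  have hD0 : 0 < D := by linarith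
  set u := D⁻¹ with hu
  have hu0 : 0 < u := inv_pos.2 hD0
  have hu1 : u ≤ 1 := inv_le_one_of_one_le₀ hD
  have hLu : L * u ≤ 1 := by rw [hu, ← div_eq_mul_inv, div_le_one hD0]; exact hDL
  have hMu : M * M * L ^ 2 * u ≤ 1 / 2 := by
    rw [hu, ← div_eq_mul_inv, div_le_iff₀ hD0]; linarith
  have hκu : κ * u ≤ D / 4 := by
    have hκ0 : 0 ≤ κ := by positivity
    calc κ * u ≤ κ * 1 := by gcongr
      _ ≤ D / 4 := by linarith
  have hinv : (D / 4)⁻¹ = 4 * u := by rw [hu, inv_div, div_eq_mul_inv]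
  have hfar4 : ∀ σ ∈ dualLattice b, σ ≠ 0 → ‖σ‖ < R →
      D / 4 ≤ ‖(Λ : ℂ) - ((‖x - σ‖ ^ 2 : ℝ) : ℂ)‖ := fun σ h1 h2 h3 =>
    le_trans (by linarith) (hfar σ h1 h2 h3)
  have hkR : ∀ k ≤ M, (k : ℝ) * ρ ^ alpha d < R := fun k hk =>
    lt_of_le_of_lt (by gcongr) hM
  have h4Qu : 4 * Q * u ≤ L * u := by gcongr; linarith
  -- the truncation error of the expansion
  have htail : ∀ i, i + 1 ≤ m →
      ‖∑ k ∈ Finset.Ioc i M, corrS b q ρ k Λ x‖ ≤ M * (Q * L ^ M) * u ^ (i + 1) := by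
    intro i hi
    have hterm : ∀ k ∈ Finset.Ioc i M, ‖corrS b q ρ k Λ x‖ ≤ Q * L ^ M * u ^ (i + 1) := by
      intro k hk
      obtain ⟨hk1, hk2⟩ := Finset.mem_Ioc.1 hk
      refine (norm_corrS_le (by positivity) hQ hfar4 (hkR k hk2)).trans ?_
      rw [hinv]
      calc Q ^ k * ((4 * u) ^ k * Q) = (4 * Q * u) ^ k * Q := by rw [mul_pow, mul_pow, mul_pow]; ring
        _ ≤ (L * u) ^ k * Q := by gcongr
        _ ≤ (L * u) ^ (i + 1) * Q := by
            gcongr ?_ * Q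
            exact pow_le_pow_of_le_one (by positivity) hLu hk1
        _ ≤ (L ^ M * u ^ (i + 1)) * Q := by
            rw [mul_pow]
            gcongr ?_ * _ * _
            exact pow_le_pow_right₀ hL1 (by omega)
        _ = _ := by ring
    refine (norm_sum_le_of_le _ hterm).trans ?_
    rw [Finset.sum_const, nsmul_eq_mul, Nat.card_Ioc, ← mul_assoc]
    have : ((M - i : ℕ) : ℝ) ≤ M := by exact_mod_cast Nat.sub_le _ _
    have h0 : 0 ≤ Q * L ^ M * u ^ (i + 1) := by positivity
    nlinarith
  have hmain' : ∀ i, i + 1 ≤ m →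
      ‖((Λ - ‖x‖ ^ 2 : ℝ) : ℂ) - ∑ k ∈ Finset.Ioc 0 M, corrS b q ρ k Λ x‖ ≤ K * u ^ (i + 1) :=
    fun i hi => hmain.trans (by
      gcongr ?_ * ?_
      exact pow_le_pow_of_le_one hu0.le hu1 hi)
  induction j with
  | zero =>
    have h := norm_add_le_of_le (hmain' 0 hj) (htail 0 hj)
    rw [sub_add_cancel] at h
    simp only [corrF, add_zero]
    rw [← Complex.ofReal_sub]
    refine h.trans ?_
    have : 0 ≤ (K + M * (Q * L ^ M)) * u ^ (0 + 1) := by positivity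
    rw [hκ]; linarith
  | succ j ih =>
    have ih' := ih (by omega)
    set z : ℂ := ((‖x‖ ^ 2 : ℝ) : ℂ) + corrF b q ρ x j with hz
    have hzfar : ∀ σ ∈ dualLattice b, σ ≠ 0 → ‖σ‖ < R →
        D / 4 ≤ ‖z - ((‖x - σ‖ ^ 2 : ℝ) : ℂ)‖ := by
      intro σ h1 h2 h3
      have h4 := hfar σ h1 h2 h3
      have h5 := norm_sub_le_norm_sub_add_norm_sub (Λ : ℂ) z ((‖x - σ‖ ^ 2 : ℝ) : ℂ)
      have h6 : κ * u ^ (j + 1) ≤ κ * u := by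
        have hκ0 : 0 ≤ κ := by positivity
        gcongr
        exact pow_le_of_le_one hu0.le hu1 (by omega)
      linarith
    have hlip : ‖∑ k ∈ Finset.Ioc 0 (j + 1), (corrS b q ρ k Λ x - corrS b q ρ k z x)‖ ≤
        κ / 2 * u ^ (j + 2) := by
      have hterm : ∀ k ∈ Finset.Ioc 0 (j + 1), ‖corrS b q ρ k Λ x - corrS b q ρ k z x‖ ≤
          M * ((L * u) ^ 2 * (κ * u ^ (j + 1))) := by
        intro k hk
        obtain ⟨hk1, hk2⟩ := Finset.mem_Ioc.1 hk
        refine (norm_corrS_sub_le (by positivity) hQ hfar4 hzfar (hkR k (by omega))).trans ?_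
        rw [hinv]
        have hkM : (k : ℝ) ≤ M := by exact_mod_cast (by omega : k ≤ M)
        calc Q ^ k * (Q * (k * ((4 * u) ^ (k + 1) * ‖(Λ : ℂ) - z‖))) =
            k * ((4 * Q * u) ^ (k + 1) * ‖(Λ : ℂ) - z‖) := by
              rw [mul_pow, mul_pow, mul_pow]; ring
          _ ≤ M * ((L * u) ^ (k + 1) * (κ * u ^ (j + 1))) := by gcongr
          _ ≤ _ := by
            have hκ0 : 0 ≤ κ := by positivity
            gcongr _ * (?_ * _)
            exact pow_le_pow_of_le_one (by positivity) hLu (by omega)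
      refine (norm_sum_le_of_le _ hterm).trans ?_
      rw [Finset.sum_const, nsmul_eq_mul, Nat.card_Ioc]
      have hjM : ((j + 1 - 0 : ℕ) : ℝ) ≤ M := by exact_mod_cast (by omega : j + 1 - 0 ≤ M)
      have hκ0 : 0 ≤ κ := by positivity
      calc _ ≤ (M : ℝ) * (M * ((L * u) ^ 2 * (κ * u ^ (j + 1)))) := by gcongr
        _ = (M * M * L ^ 2 * u) * (κ * u ^ (j + 2)) := by ring
        _ ≤ 1 / 2 * (κ * u ^ (j + 2)) := by gcongr
        _ = _ := by ring
    have hF : corrF b q ρ x (j + 1) = ∑ k ∈ Finset.Ioc 0 (j + 1), corrS b q ρ k z x := rfl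
    have hdecomp : (Λ : ℂ) - (((‖x‖ ^ 2 : ℝ) : ℂ) + corrF b q ρ x (j + 1)) =
        (((Λ - ‖x‖ ^ 2 : ℝ) : ℂ) - ∑ k ∈ Finset.Ioc 0 M, corrS b q ρ k Λ x) +
        ∑ k ∈ Finset.Ioc (j + 1) M, corrS b q ρ k Λ x +
        ∑ k ∈ Finset.Ioc 0 (j + 1), (corrS b q ρ k Λ x - corrS b q ρ k z x) := by
      rw [hF, Finset.sum_sub_distrib,
        ← Finset.sum_Ioc_consecutive _ (Nat.zero_le (j + 1)) (by omega : j + 1 ≤ M)]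
      push_cast
      ring
    rw [hdecomp]
    refine (norm_add_le_of_le (norm_add_le_of_le (hmain' (j + 1) hj) (htail (j + 1) hj)) hlip).trans ?_
    rw [hκ]
    apply le_of_eq
    ring

theorem exists_le_rpow_alphaK (d : ℕ) (N : ℝ) :
    ∃ ρ₀ : ℝ, 1 ≤ ρ₀ ∧ ∀ ρ, ρ₀ ≤ ρ → N ≤ ρ ^ alphaK d 1 := by
  obtain ⟨ρ₀, h1, h2⟩ := exists_le_rootScale d (max N 1)
  refine ⟨ρ₀, h1, fun ρ hρ => ?_⟩
  rw [rpow_alphaK (by linarith)]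
  have h3 := h2 ρ hρ
  exact ((le_max_left _ _).trans h3).trans
    (le_self_pow₀ ((le_max_right _ _).trans h3) (by norm_num))

/-- In the non-resonance domain the energies of all nearby vectors are far from `|x|²`. -/
theorem lt_abs_of_mem_nonresonanceDomain {s ρ : ℝ} {x σ : Space d}
    (hx : x ∈ nonresonanceDomain b s ρ) (hσ : σ ∈ dualLattice b) (h0 : σ ≠ 0)
    (hσn : ‖σ‖ < pOf d s * ρ ^ alpha d) : ρ ^ alphaK d 1 < |‖x‖ ^ 2 - ‖x - σ‖ ^ 2| := by
  by_contra! hcon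
  refine hx.2 ⟨fun _ => -σ, fun _ => ⟨neg_mem_dualLattice hσ, ?_, ?_⟩, ?_, fun _ => ⟨?_, hx.1⟩⟩
  · rw [norm_neg]; exact norm_pos_iff.2 h0
  · rwa [norm_neg]
  · rw [linearIndependent_unique_iff]
    simpa using h0
  · rw [Set.mem_ofPred_eq, ← sub_eq_add_neg]
    exact hcon

/-- The non-resonance formula, for coefficient systems. -/
theorem exists_nonresonance_estimate (b : Module.Basis (Fin d) ℝ (Space d)) {s : ℝ}
    (hp : 9 ≤ pOf d s) (q : Space d → ℝ) {Q T : ℝ} (hQ : 0 ≤ Q) (hT : 0 ≤ T) {c c₅ : ℝ}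
    (hc0 : 0 ≤ c) (hc₅ : 0 < c₅) {m : ℕ} (hm1 : 1 ≤ m) (hm : 3 * (m : ℝ) ≤ pOf d s - c) :
    ∃ K ρ₀ : ℝ, 0 < K ∧ 0 < ρ₀ ∧ ∀ ρ : ℝ, ρ₀ ≤ ρ → ∀ t : Space d, ∀ γ ∈ dualLattice b,
      γ + t ∈ nonresonanceDomain b s ρ → ∀ (Λ : ℝ) (a : Space d → ℂ),
      IsCoeffSystem b (potCoeff b q) a t Λ (pOf d s) Q T →
      |Λ - ‖γ + t‖ ^ 2| < 1 / 2 * ρ ^ alphaK d 1 → c₅ * ρ ^ (-(c * alpha d)) < ‖a γ‖ →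
      ‖(Λ : ℂ) - (((‖γ + t‖ ^ 2 : ℝ) : ℂ) + corrF b q ρ (γ + t) (m - 1))‖ ≤
        K * ‖γ + t‖ ^ (-(m * alphaK d 1)) := by
  set p := pOf d s with hpdef
  set M := pOne d s with hMdef
  have hpM : p < 3 * M := pOf_lt_pOne
  have hMp : 2 * (M : ℝ) + 1 ≤ p := two_mul_pOne_add_one_le hp
  have hM0 : (0 : ℝ) ≤ M := Nat.cast_nonneg M
  have hmM : m ≤ M := by
    have : (m : ℝ) < M := by linarith
    exact_mod_cast this.le
  set K₂ := (M + 1) * T + (2 * Q) ^ M * Q with hK₂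
  have hK₂0 : 0 ≤ K₂ := by positivity
  set K₃ := K₂ / c₅ with hK₃
  have hK₃0 : 0 ≤ K₃ := by positivity
  set κ := 2 * (K₃ + M * (Q * (4 * (Q + 1)) ^ M)) with hκ
  have hκ0 : 0 ≤ κ := by positivity
  set W := 2 * (M * M * (4 * (Q + 1)) ^ 2) with hW
  have hW0 : 0 ≤ W := by positivity
  obtain ⟨ρ₀, hρ₀, hbig⟩ := exists_le_rpow_alphaK d
    (4 * (Q + 1) + W + 4 * κ)
  have hα := alpha_pos d
  have hα1 : alphaK d 1 = 3 * alpha d := by rw [alphaK]; norm_num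
  have he0 : 0 ≤ m * alphaK d 1 := by rw [hα1]; positivity
  refine ⟨κ * (3 / 2) ^ (m * alphaK d 1) + 1, ρ₀, by positivity, by linarith, ?_⟩
  intro ρ hρρ t γ hγ hx Λ a hsys hΛ haγ
  have hρ1 : 1 ≤ ρ := hρ₀.trans hρρ
  have hρ : 0 < ρ := by linarith
  have hD := hbig ρ hρρ
  set D := ρ ^ alphaK d 1 with hDdef
  have hA0 : 0 < ρ ^ alpha d := by positivity
  have hDQ : 4 * (Q + 1) ≤ D := by linarith only [hD, hW0, hκ0]
  have hDW : W ≤ D := by linarith only [hD, hQ, hκ0]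
  have hDκ : 4 * κ ≤ D := by linarith only [hD, hQ, hW0]
  have hD1 : 1 ≤ D := by linarith only [hDQ, hQ]
  have hD0 : 0 < D := by linarith
  set x := γ + t with hxdef
  have hfar : ∀ σ ∈ dualLattice b, σ ≠ 0 → ‖σ‖ < p * ρ ^ alpha d →
      D / 2 ≤ ‖(Λ : ℂ) - ((‖x - σ‖ ^ 2 : ℝ) : ℂ)‖ := by
    intro σ hσ h0 hσn
    have h1 := lt_abs_of_mem_nonresonanceDomain hx hσ h0 hσn
    rw [← Complex.ofReal_sub, Complex.norm_real, Real.norm_eq_abs]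
    have h2 := abs_sub_le (‖x‖ ^ 2) Λ (‖x - σ‖ ^ 2)
    rw [abs_sub_comm _ Λ] at h2
    linarith
  have hMA : M * ρ ^ alpha d < p * ρ ^ alpha d := by gcongr; linarith
  have hQδ : Q * (D / 2)⁻¹ ≤ 1 := by
    rw [← div_eq_mul_inv, div_le_one (by positivity)]; linarith only [hDQ, hQ]
  have h1 := hsys.norm_expansion_le (by linarith) hρ hγ (half_pos hD0) hQδ hfar M hMA
  have h2 := hsys.norm_pathRemainder_le (ρ := ρ) hγ (half_pos hD0) hfar M hMA
  have hAp : (ρ ^ alpha d) ^ (-p) = ρ ^ (-(p * alpha d)) := by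
    rw [← Real.rpow_mul hρ.le]; congr 1; ring
  have hDM : D⁻¹ ^ M ≤ ρ ^ (-(p * alpha d)) := by
    rw [hDdef, ← Real.rpow_neg hρ.le, ← Real.rpow_natCast, ← Real.rpow_mul hρ.le]
    refine Real.rpow_le_rpow_of_exponent_le hρ1 ?_
    rw [hα1]
    linarith only [mul_le_mul_of_nonneg_right hpM.le hα.le]
  have h3 : Q ^ M * ((D / 2)⁻¹ ^ M * Q) ≤ (2 * Q) ^ M * Q * ρ ^ (-(p * alpha d)) := by
    have : Q ^ M * ((D / 2)⁻¹ ^ M * Q) = (2 * Q) ^ M * Q * D⁻¹ ^ M := by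
      rw [inv_div, div_eq_mul_inv, mul_pow, mul_pow]; ring
    rw [this]
    gcongr
  have h4 := norm_add_le_of_le h1 (h2.trans h3)
  rw [sub_add_cancel, ← sub_mul, norm_mul, hAp] at h4
  have hmain : ‖((Λ - ‖x‖ ^ 2 : ℝ) : ℂ) - ∑ k ∈ Finset.Ioc 0 M, corrS b q ρ k Λ x‖ ≤
      K₃ * D⁻¹ ^ m := by
    set y := ‖((Λ - ‖x‖ ^ 2 : ℝ) : ℂ) - ∑ k ∈ Finset.Ioc 0 M, corrS b q ρ k Λ x‖ with hy
    have h5 : y * (c₅ * ρ ^ (-(c * alpha d))) ≤ K₂ * ρ ^ (-(p * alpha d)) := by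
      calc _ ≤ y * ‖a γ‖ := by gcongr
        _ ≤ _ := h4
        _ = _ := by rw [hK₂]; ring
    have h6 : ρ ^ (-(p * alpha d)) ≤ D⁻¹ ^ m * ρ ^ (-(c * alpha d)) := by
      rw [hDdef, ← Real.rpow_neg hρ.le, ← Real.rpow_natCast, ← Real.rpow_mul hρ.le,
        ← Real.rpow_add hρ]
      refine Real.rpow_le_rpow_of_exponent_le hρ1 ?_
      rw [hα1]
      linarith only [mul_le_mul_of_nonneg_right hm hα.le]
    have h7 : 0 < ρ ^ (-(c * alpha d)) := by positivity
    have h8 : y * c₅ ≤ K₂ * D⁻¹ ^ m := by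
      refine le_of_mul_le_mul_right ?_ h7
      calc _ = y * (c₅ * ρ ^ (-(c * alpha d))) := by ring
        _ ≤ K₂ * ρ ^ (-(p * alpha d)) := h5
        _ ≤ K₂ * (D⁻¹ ^ m * ρ ^ (-(c * alpha d))) := by gcongr
        _ = _ := by ring
    rw [hK₃, div_mul_eq_mul_div, le_div_iff₀ hc₅]
    exact h8
  have h5 := norm_sub_corrF_le (Q := Q) hD1 hK₃0 hmM hA0.le hMA
    (fun S hS => hsys.sum_norm_le hS) hfar hmain hDQ hDW hDκ
    (m - 1) (by omega)
  rw [Nat.sub_add_cancel hm1] at h5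
  have h6 := rpow_neg_le_of_mem_shell hρ he0 hx.1
  have h7 : D⁻¹ ^ m = ρ ^ (-(m * alphaK d 1)) := by
    rw [hDdef, ← Real.rpow_neg hρ.le, ← Real.rpow_natCast, ← Real.rpow_mul hρ.le]
    congr 1; ring
  rw [h7] at h5
  have hx0 : 0 ≤ ‖x‖ ^ (-(m * alphaK d 1)) := by positivity
  calc _ ≤ _ := h5
    _ ≤ κ * ((3 / 2) ^ (m * alphaK d 1) * ‖x‖ ^ (-(m * alphaK d 1))) := by gcongr
    _ ≤ _ := by rw [add_mul, mul_assoc]; linarith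

end

section

/-! ### Every high-energy Bloch function has a large Fourier coefficient near its energy -/

variable {d : ℕ} {b : Module.Basis (Fin d) ℝ (Space d)} {q : Space d → ℝ} {s : ℝ}

theorem IsBlochFunction.hasSum_sq_coeff_mul [NeZero d]
    (hvol : volume (ZSpan.fundamentalDomain b) = 1)
    (hq : IsPotential b s q) (hp : 0 ≤ pOf d s) {t : Space d} {Λ : ℝ} {Ψ : Space d → ℂ}
    (hΨ : IsBlochFunction b q t Λ Ψ) :
    ∃ N ≤ (∑' γ : dualLattice b, ‖potCoeff b q γ‖) ^ 2,
      HasSum (fun γ : dualLattice b =>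
        ‖planeWaveCoeff b (fun x => (q x : ℂ) * Ψ x) (γ + t)‖ ^ 2) N := by
  have := isFiniteMeasure_cellMeasure hvol
  set Q := ∑' γ : dualLattice b, ‖potCoeff b q γ‖
  have hae := hq.ae_norm_le hvol hp
  have hle : ∀ᵐ x ∂cellMeasure b, ‖(q x : ℂ) * Ψ x‖ ≤ Q * ‖Ψ x‖ := by
    filter_upwards [hae] with x hx
    rw [norm_mul]; gcongr
  have hq2 : MemLp (fun x => (q x : ℂ)) 2 (cellMeasure b) := hq.memLp.ofReal
  have hmem : MemLp (fun x => (q x : ℂ) * Ψ x) 2 (cellMeasure b) :=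
    hΨ.memLp.of_le_mul (hq2.1.mul hΨ.memLp.1) hle
  refine ⟨_, ?_, hasSum_sq_planeWaveCoeff_add hvol hmem t⟩
  have h1 : ∫ x, ‖(q x : ℂ) * Ψ x‖ ^ 2 ∂cellMeasure b ≤ ∫ x, Q ^ 2 * ‖Ψ x‖ ^ 2 ∂cellMeasure b := by
    refine integral_mono_ae hmem.integrable_norm_pow' (hΨ.memLp.integrable_norm_pow'.const_mul _) ?_
    filter_upwards [hle] with x hx
    rw [← mul_pow]
    exact pow_le_pow_left₀ (norm_nonneg _) hx 2
  refine h1.trans_eq ?_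
  rw [integral_const_mul, hΨ.normalized, mul_one]

theorem rpow_alphaK_one_le {ρ : ℝ} (hρ : 1 ≤ ρ) : ρ ^ alphaK d 1 ≤ ρ := by
  conv_rhs => rw [← Real.rpow_one ρ]
  refine Real.rpow_le_rpow_of_exponent_le hρ ?_
  have h1 : (1 : ℝ) ≤ 3 ^ d := one_le_pow₀ (by norm_num)
  rw [alphaK, alpha, mul_one_div, div_le_one (kap_pos d), kap]
  linarith [(Nat.cast_nonneg d : (0 : ℝ) ≤ d)]

/-- By Parseval's identity, the coefficients at energies far from `Λ` carry little mass, and there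
are only `O(ρ^{d-1})` others. -/
theorem exists_large_coeff [NeZero d] (hvol : volume (ZSpan.fundamentalDomain b) = 1)
    (hq : IsPotential b s q) (hp : 0 ≤ pOf d s) :
    ∃ c₅ ρ₀ : ℝ, 0 < c₅ ∧ 1 ≤ ρ₀ ∧ ∀ ρ : ℝ, ρ₀ ≤ ρ → ∀ (t : Space d) (Λ : ℝ) (Ψ : Space d → ℂ),
      IsBlochFunction b q t Λ Ψ → 3 / 4 * ρ ^ 2 < Λ → Λ < 5 / 4 * ρ ^ 2 →
      ∃ γ ∈ dualLattice b, γ + t ∈ shell d ρ ∧ |Λ - ‖γ + t‖ ^ 2| < 1 / 2 * ρ ^ alphaK d 1 ∧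
        c₅ * ρ ^ (-(((d : ℝ) - 1) / 2)) < ‖planeWaveCoeff b Ψ (γ + t)‖ := by
  classical
  obtain ⟨C, hC, hcard⟩ := exists_card_shell_le b
  set Q := ∑' γ : dualLattice b, ‖potCoeff b q γ‖ with hQ
  have hQ0 : 0 ≤ Q := tsum_nonneg fun _ => norm_nonneg _
  obtain ⟨ρ₁, hρ₁, hbig⟩ := exists_le_rpow_alphaK d (4 * Q + 1)
  set B := C * 2 ^ (d - 1) with hB
  have hB0 : 0 < B := by positivity
  refine ⟨1 / (2 * (1 + B)), max ρ₁ 4, by positivity, hρ₁.trans (le_max_left _ _), ?_⟩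
  intro ρ hρρ t Λ Ψ hΨ hΛ1 hΛ2
  have hρ4 : 4 ≤ ρ := (le_max_right _ _).trans hρρ
  have hρ : 0 < ρ := by linarith
  have hD := hbig ρ ((le_max_left _ _).trans hρρ)
  have hDρ : ρ ^ alphaK d 1 ≤ ρ := rpow_alphaK_one_le (by linarith)
  set D := ρ ^ alphaK d 1 with hDdef
  have hD0 : 0 < D := by linarith
  have hρ2 : 4 * ρ ≤ ρ ^ 2 := by nlinarith
  set c₅ := 1 / (2 * (1 + B)) with hc₅
  set r := √(Λ - 1 / 2 * D) with hr
  have hrpos : 0 ≤ Λ - 1 / 2 * D := by nlinarith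
  have hr2 : r ^ 2 = Λ - 1 / 2 * D := Real.sq_sqrt hrpos
  have hr0 : 0 ≤ r := Real.sqrt_nonneg _
  have hrρ : 1 / 2 * ρ ≤ r := by
    rw [← abs_of_nonneg hr0, ← abs_of_nonneg (by positivity : 0 ≤ 1 / 2 * ρ), ← sq_le_sq, hr2]
    nlinarith
  have hrρ' : r + 1 ≤ 2 * ρ := by
    have : r ≤ 3 / 2 * ρ := by
      rw [← abs_of_nonneg hr0, ← abs_of_nonneg (by positivity : 0 ≤ 3 / 2 * ρ), ← sq_le_sq, hr2]
      nlinarith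
    linarith
  by_contra! hcon
  have hfin : {γ | γ ∈ dualLattice b ∧ |Λ - ‖γ + t‖ ^ 2| < 1 / 2 * D}.Finite := by
    refine (dualLattice_ball_finite b (r + 1 + ‖t‖ + 1)).subset ?_
    rintro γ ⟨hγ, hlt⟩
    refine ⟨hγ, ?_⟩
    have h1 : ‖γ + t‖ ≤ r + 1 := by
      rw [← abs_of_nonneg (norm_nonneg (γ + t)), ← abs_of_nonneg (by linarith : 0 ≤ r + 1),
        ← sq_le_sq]
      have := (abs_lt.1 hlt).1
      nlinarith
    have h2 : ‖γ‖ ≤ ‖γ + t‖ + ‖t‖ := by simpa using norm_sub_le (γ + t) t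
    linarith
  set S := hfin.toFinset with hS
  have hmemS : ∀ γ, γ ∈ S ↔ γ ∈ dualLattice b ∧ |Λ - ‖γ + t‖ ^ 2| < 1 / 2 * D := by
    intro γ; rw [hS, Set.Finite.mem_toFinset]; exact Iff.rfl
  have hScard : (S.card : ℝ) ≤ B * ρ ^ (d - 1) := by
    refine (hcard r hr0 t S fun γ hγ => ?_).trans ?_
    · obtain ⟨h1, h2⟩ := (hmemS γ).1 hγ
      have h3 := abs_lt.1 h2
      refine ⟨h1, ?_, ?_⟩
      · rw [← abs_of_nonneg hr0, ← abs_of_nonneg (norm_nonneg (γ + t)), ← sq_le_sq, hr2]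
        linarith
      · rw [← abs_of_nonneg (norm_nonneg (γ + t)), ← abs_of_nonneg (by linarith : 0 ≤ r + 1),
          ← sq_le_sq]
        nlinarith
    · calc C * (r + 1) ^ (d - 1) ≤ C * (2 * ρ) ^ (d - 1) := by gcongr
        _ = _ := by rw [hB, mul_pow]; ring
  have hSshell : ∀ γ ∈ S, γ + t ∈ shell d ρ := by
    intro γ hγ
    have h3 := abs_lt.1 ((hmemS γ).1 hγ).2
    constructor
    · rw [mem_ball_zero_iff, ← abs_of_nonneg (norm_nonneg (γ + t)),
        ← abs_of_nonneg (by positivity : 0 ≤ 3 / 2 * ρ), ← sq_lt_sq]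
      nlinarith
    · rw [mem_ball_zero_iff, not_lt, ← abs_of_nonneg (norm_nonneg (γ + t)),
        ← abs_of_nonneg (by positivity : 0 ≤ 1 / 2 * ρ), ← sq_le_sq]
      nlinarith
  obtain ⟨N, hN, hsumN⟩ := hΨ.hasSum_sq_coeff_mul hvol hq hp
  have hpars := hasSum_sq_planeWaveCoeff_add hvol hΨ.memLp t
  rw [hΨ.normalized] at hpars
  set ε := (c₅ * ρ ^ (-(((d : ℝ) - 1) / 2))) ^ 2 with hε
  have hindS : HasSum (fun γ : dualLattice b => if (γ : Space d) ∈ S then ε else 0)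
      (S.card * ε) := by
    have h1 : HasSum (fun γ : dualLattice b => if (γ : Space d) ∈ S then ε else 0)
        (∑ γ ∈ S.subtype (· ∈ dualLattice b), if (γ : Space d) ∈ S then ε else 0) :=
      hasSum_sum_of_ne_finset_zero fun γ hγ => if_neg (by simpa using hγ)
    rw [Finset.sum_subtype_of_mem (fun γ => if γ ∈ S then ε else 0)
      (fun γ hγ => ((hmemS γ).1 hγ).1), Finset.sum_congr rfl (fun γ hγ => if_pos hγ),
      Finset.sum_const, nsmul_eq_mul] at h1
    exact h1
  have htot := hasSum_le (fun γ => ?_) hpars (hindS.add (hsumN.mul_left ((2 / D) ^ 2)))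
  · have h1 : S.card * ε ≤ 1 / 4 := by
      have h2 : ε = c₅ ^ 2 * (ρ ^ (d - 1))⁻¹ := by
        rw [hε, mul_pow, ← Real.rpow_natCast (ρ ^ (-(((d : ℝ) - 1) / 2))), ← Real.rpow_mul hρ.le,
          ← Real.rpow_natCast ρ (d - 1), ← Real.rpow_neg hρ.le, Nat.cast_sub (NeZero.one_le)]
        congr 2
        push_cast; ring
      have h3 : B * c₅ ^ 2 ≤ 1 / 4 := by
        rw [hc₅, div_pow, one_pow, mul_one_div, div_le_div_iff₀ (by positivity) (by norm_num)]
        nlinarith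
      calc S.card * ε ≤ B * ρ ^ (d - 1) * (c₅ ^ 2 * (ρ ^ (d - 1))⁻¹) := by
            rw [h2]; gcongr
        _ = B * c₅ ^ 2 := by field_simp
        _ ≤ _ := h3
    have h4 : (2 / D) ^ 2 * N ≤ 1 / 4 := by
      calc (2 / D) ^ 2 * N ≤ (2 / D) ^ 2 * Q ^ 2 := by gcongr
        _ = (2 * Q / D) ^ 2 := by ring
        _ ≤ (1 / 2) ^ 2 := by
          refine pow_le_pow_left₀ (by positivity) ?_ 2
          rw [div_le_iff₀ hD0]; linarith
        _ = _ := by norm_num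
    linarith
  · by_cases hγS : (γ : Space d) ∈ S
    · rw [if_pos hγS]
      have h1 := hcon γ γ.2 (hSshell γ hγS) ((hmemS γ).1 hγS).2
      have h2 : ‖planeWaveCoeff b Ψ (γ + t)‖ ^ 2 ≤ ε := pow_le_pow_left₀ (norm_nonneg _) h1 2
      have h3 : 0 ≤ (2 / D) ^ 2 * ‖planeWaveCoeff b (fun x => (q x : ℂ) * Ψ x) (γ + t)‖ ^ 2 := by
        positivity
      linarith
    · rw [if_neg hγS, zero_add, ← mul_pow]
      refine pow_le_pow_left₀ (norm_nonneg _) ?_ 2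
      have h1 : 1 / 2 * D ≤ |Λ - ‖(γ : Space d) + t‖ ^ 2| := by
        by_contra! h
        exact hγS ((hmemS γ).2 ⟨γ.2, h⟩)
      rw [hΨ.coeff_eq hvol hq γ.2, norm_mul, Complex.norm_real, Real.norm_eq_abs,
        div_mul_eq_mul_div, le_div_iff₀ hD0]
      have h2 := mul_le_mul_of_nonneg_right h1 (norm_nonneg (planeWaveCoeff b Ψ (γ + t)))
      linarith only [h2]

/-! ### The resonance domains cover the complement of the non-resonance domain -/

/-- There are no points of order-`d` resonance: such a point would be nearly orthogonal to
everything, hence too short. -/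
theorem exists_resonanceUnion_top_eq_empty (b : Module.Basis (Fin d) ℝ (Space d)) (hd : 1 ≤ d)
    (hp : 1 ≤ pOf d s) :
    ∃ ρ₀ : ℝ, 1 ≤ ρ₀ ∧ ∀ ρ, ρ₀ ≤ ρ → ∀ x, x ∉ resonanceUnion b s ρ d := by
  obtain ⟨C, hC, h⟩ := exists_abs_inner_le_of_resonance b hp
  obtain ⟨ρ₀, hρ₀, hroot⟩ := exists_le_rootScale d (1 + 2 * C)
  refine ⟨ρ₀, hρ₀, ?_⟩
  rintro ρ hρρ x ⟨g, hg, hind, hx⟩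
  have hρ : 0 < ρ := by linarith
  have ha := hroot ρ hρρ
  have hspan : Submodule.span ℝ (Set.range g) = ⊤ := by
    have : Nonempty (Fin d) := ⟨⟨0, hd⟩⟩
    exact hind.span_eq_top_of_card_eq_finrank (by simp)
  have h1 := h ρ d g x x hρ.le (by linarith) hd hg hind hx (by rw [hspan]; trivial)
  have hxs := (hx ⟨0, hd⟩).2
  have hx0 := norm_pos_of_mem_shell hρ hxs
  have h2 := hxs.2
  rw [mem_ball_zero_iff, not_lt] at h2
  rw [real_inner_self_eq_norm_sq, abs_of_nonneg (sq_nonneg _), pow_two] at h1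
  have h3 := le_of_mul_le_mul_right h1 hx0
  have hρa : ρ = rootScale d ρ ^ (2 * 3 ^ d + 2 * (d - 1) + 6) := by
    conv_lhs => rw [← Real.rpow_one ρ]
    rw [rootScale_pow hρ.le]
    congr 1
    have := kap_pos d
    rw [show 2 * 3 ^ d + 2 * (d - 1) + 6 = 2 * (3 ^ d + d + 2) by omega, alpha]
    push_cast
    rw [← kap]
    field_simp
  set a := rootScale d ρ
  set e := 2 * 3 ^ d + 2 * (d - 1)
  rw [hρa, pow_add] at h2
  have he : 0 < a ^ e := pow_pos (by linarith) e
  have h6 : a ≤ a ^ 6 := le_self_pow₀ (by linarith) (by norm_num)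
  have h7 : a ^ e * a ^ 6 ≤ a ^ e * (2 * C) := by linarith only [h2, h3]
  have h8 := le_of_mul_le_mul_left h7 he
  linarith

theorem exists_resonance_order {ρ : ℝ} {x : Space d} (hd : 1 ≤ d)
    (hx1 : x ∈ resonanceUnion b s ρ 1) (hxd : x ∉ resonanceUnion b s ρ d) :
    ∃ k, 1 ≤ k ∧ k ≤ d - 1 ∧ x ∈ resonanceUnion b s ρ k ∧ x ∉ resonanceUnion b s ρ (k + 1) := by
  by_contra! hcon
  have : ∀ k, 1 ≤ k → k ≤ d → x ∈ resonanceUnion b s ρ k := by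
    intro k hk
    induction k, hk using Nat.le_induction with
    | base => exact fun _ => hx1
    | succ n hn ih => exact fun hle => hcon n hn (by omega) (ih (by omega))
  exact hxd (this d hd le_rfl)

end

end PeriodicSchrodinger

theorem theorem2p2 (d : ℕ) (hd : 2 ≤ d)
    (b : Module.Basis (Fin d) ℝ (EuclideanSpace ℝ (Fin d)))
    (hvol : MeasureTheory.volume (ZSpan.fundamentalDomain b) = 1)
    (s : ℝ) (hs : PeriodicSchrodinger.sZero d ≤ s)
    (q : EuclideanSpace ℝ (Fin d) → ℝ) (hq : PeriodicSchrodinger.IsPotential b s q) :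
    -- (a) the resonance formula
    (∀ c c₅ : ℝ, 0 ≤ c → c < PeriodicSchrodinger.pOf d s - d * 3 ^ d / 4 → 0 < c₅ →
      ∃ K ρ₀ : ℝ, 0 < K ∧ 0 < ρ₀ ∧ ∀ ρ : ℝ, ρ₀ ≤ ρ →
        ∀ (k : ℕ), 1 ≤ k → k ≤ d - 1 →
        ∀ g : Fin k → EuclideanSpace ℝ (Fin d),
          (∀ i, g i ∈ PeriodicSchrodinger.dualBall b
            (PeriodicSchrodinger.pOf d s * ρ ^ PeriodicSchrodinger.alpha d)) →
          LinearIndependent ℝ g →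
        ∀ t : EuclideanSpace ℝ (Fin d), ∀ γ ∈ PeriodicSchrodinger.dualLattice b,
          (∀ i, γ + t ∈ PeriodicSchrodinger.resonanceDomain ρ
            (ρ ^ PeriodicSchrodinger.alphaK d k) (g i)) →
          γ + t ∉ PeriodicSchrodinger.resonanceUnion b s ρ (k + 1) →
        ∀ (Λ : ℝ) (Ψ : EuclideanSpace ℝ (Fin d) → ℂ),
          PeriodicSchrodinger.IsBlochFunction b q t Λ Ψ →
          |Λ - ‖γ + t‖ ^ 2| < 1 / 2 * ρ ^ PeriodicSchrodinger.alphaK d 1 →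
          c₅ * ρ ^ (-(c * PeriodicSchrodinger.alpha d)) <
            ‖PeriodicSchrodinger.planeWaveCoeff b Ψ (γ + t)‖ →
          ∃ μ : ℝ,
            PeriodicSchrodinger.IsMatrixEigenvalue
              (PeriodicSchrodinger.resonanceMatrix b q s ρ g γ t) μ ∧
            |Λ - μ| ≤ K * ‖γ + t‖ ^
              (-((PeriodicSchrodinger.pOf d s - c - d * 3 ^ d / 4) *
                PeriodicSchrodinger.alpha d))) ∧
    -- (b) every large eigenvalue satisfies one of the two formulas
    (∃ K ρ₀ : ℝ, 0 < K ∧ 0 < ρ₀ ∧ ∀ ρ : ℝ, ρ₀ ≤ ρ →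
      ∀ (t : EuclideanSpace ℝ (Fin d)) (Λ : ℝ),
        PeriodicSchrodinger.IsBlochEigenvalue b q t Λ →
        3 / 4 * ρ ^ 2 < Λ → Λ < 5 / 4 * ρ ^ 2 →
        ∃ γ ∈ PeriodicSchrodinger.dualLattice b,
          (γ + t ∈ PeriodicSchrodinger.nonresonanceDomain b s ρ ∧
            ∃ m : ℕ, m = ⌊(PeriodicSchrodinger.pOf d s -
                PeriodicSchrodinger.kap d * (d - 1) / 2) / 3⌋₊ ∧
              ‖(Λ : ℂ) - (((‖γ + t‖ ^ 2 : ℝ) : ℂ) +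
                  PeriodicSchrodinger.corrF b q ρ (γ + t) (m - 1))‖ ≤
                K * ‖γ + t‖ ^ (-(m * PeriodicSchrodinger.alphaK d 1))) ∨
          (∃ k : ℕ, 1 ≤ k ∧ k ≤ d - 1 ∧
            ∃ g : Fin k → EuclideanSpace ℝ (Fin d),
              (∀ i, g i ∈ PeriodicSchrodinger.dualBall b
                (PeriodicSchrodinger.pOf d s * ρ ^ PeriodicSchrodinger.alpha d)) ∧
              LinearIndependent ℝ g ∧
              (∀ i, γ + t ∈ PeriodicSchrodinger.resonanceDomain ρ
                (ρ ^ PeriodicSchrodinger.alphaK d k) (g i)) ∧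
              γ + t ∉ PeriodicSchrodinger.resonanceUnion b s ρ (k + 1) ∧
              ∃ μ : ℝ,
                PeriodicSchrodinger.IsMatrixEigenvalue
                  (PeriodicSchrodinger.resonanceMatrix b q s ρ g γ t) μ ∧
                |Λ - μ| ≤ K * ‖γ + t‖ ^
                  (-((PeriodicSchrodinger.pOf d s -
                    PeriodicSchrodinger.kap d * (d - 1) / 2 - d * 3 ^ d / 4) *
                    PeriodicSchrodinger.alpha d)))) := by
  have hNe : NeZero d := ⟨by omega⟩
  have hp := PeriodicSchrodinger.nine_le_pOf hd hs
  have hp0 : 0 ≤ PeriodicSchrodinger.pOf d s := by linarith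
  have hQ : 0 ≤ ∑' γ : PeriodicSchrodinger.dualLattice b, ‖PeriodicSchrodinger.potCoeff b q γ‖ :=
    tsum_nonneg fun _ => norm_nonneg _
  have hT : 0 ≤ ∑' γ : PeriodicSchrodinger.dualLattice b, ‖PeriodicSchrodinger.potCoeff b q γ‖ *
      ‖(γ : EuclideanSpace ℝ (Fin d))‖ ^ PeriodicSchrodinger.pOf d s :=
    tsum_nonneg fun _ => by positivity
  constructor
  · intro c c₅ _ hc hc₅
    obtain ⟨K, ρ₀, hK, hρ₀, h⟩ :=
      PeriodicSchrodinger.exists_resonance_estimate hd b hp q hQ hT hc hc₅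
    exact ⟨K, ρ₀, hK, hρ₀, fun ρ hρ k hk hkd g hg hind t γ hγ hx hxE Λ Ψ hΨ hΛ hb =>
      h ρ hρ k hk hkd g hg hind t γ hγ hx hxE Λ _ (hΨ.isCoeffSystem hvol hq hp0) hΛ hb⟩
  · have hkap := PeriodicSchrodinger.kap_pos d
    have hpge := PeriodicSchrodinger.le_pOf hs
    have hd' : (2 : ℝ) ≤ d := by exact_mod_cast hd
    obtain ⟨c₅, ρ₁, hc₅, hρ₁, hlarge⟩ := PeriodicSchrodinger.exists_large_coeff hvol hq hp0
    -- with this `c`, the size `ρ^{-(d-1)/2}` of the large coefficient is `ρ^{-cα}`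
    set c := PeriodicSchrodinger.kap d * (d - 1) / 2 with hcdef
    have hc0 : 0 ≤ c := by
      have : (0 : ℝ) ≤ d - 1 := by linarith
      positivity
    have hcp : c + 3 ≤ PeriodicSchrodinger.pOf d s - d * 3 ^ d / 4 := by
      have : c ≤ (3 * d - 1) / 2 * PeriodicSchrodinger.kap d := by
        rw [hcdef]; nlinarith
      linarith
    have h3d : (0 : ℝ) ≤ d * 3 ^ d / 4 := by positivity
    have hcα : c * PeriodicSchrodinger.alpha d = ((d : ℝ) - 1) / 2 := by
      rw [hcdef, PeriodicSchrodinger.alpha]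
      field_simp
    set m := ⌊(PeriodicSchrodinger.pOf d s - c) / 3⌋₊ with hm
    have hm1 : 1 ≤ m := by
      rw [hm, Nat.one_le_floor_iff]
      linarith
    have hm3 : 3 * (m : ℝ) ≤ PeriodicSchrodinger.pOf d s - c := by
      have := Nat.floor_le (a := (PeriodicSchrodinger.pOf d s - c) / 3) (by linarith)
      rw [← hm] at this
      linarith
    obtain ⟨K₂, ρ₂, hK₂, -, hres⟩ := PeriodicSchrodinger.exists_resonance_estimate hd b hp q hQ hT
      (c := c) (by linarith) hc₅
    obtain ⟨K₃, ρ₃, hK₃, -, hnon⟩ := PeriodicSchrodinger.exists_nonresonance_estimate b hp q hQ hT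
      hc0 hc₅ hm1 hm3
    obtain ⟨ρ₄, -, hempty⟩ := PeriodicSchrodinger.exists_resonanceUnion_top_eq_empty b
      (by omega) (s := s) (by linarith)
    refine ⟨max K₂ K₃, max (max ρ₁ ρ₂) (max ρ₃ ρ₄), by positivity,
      lt_of_lt_of_le (by linarith) ((le_max_left ρ₁ ρ₂).trans (le_max_left _ _)), ?_⟩
    intro ρ hρ t Λ hΛ hlow hup
    obtain ⟨Ψ, hΨ⟩ := hΛ
    simp only [max_le_iff] at hρ
    obtain ⟨⟨hρ1, hρ2⟩, hρ3, hρ4⟩ := hρ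
    obtain ⟨γ, hγ, hsh, hnear, hb⟩ := hlarge ρ hρ1 t Λ Ψ hΨ hlow hup
    rw [← hcα] at hb
    have hsys := hΨ.isCoeffSystem hvol hq hp0
    refine ⟨γ, hγ, ?_⟩
    by_cases hx1 : γ + t ∈ PeriodicSchrodinger.resonanceUnion b s ρ 1
    · right
      obtain ⟨k, hk, hkd, ⟨g, hg, hind, hxg⟩, hxE⟩ :=
        PeriodicSchrodinger.exists_resonance_order (by omega) hx1 (hempty ρ hρ4 _)
      obtain ⟨μ, hμ, hle⟩ := hres ρ hρ2 k hk hkd g hg hind t γ hγ hxg hxE Λ _ hsys hnear hb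
      refine ⟨k, hk, hkd, g, hg, hind, hxg, hxE, μ, hμ, hle.trans ?_⟩
      gcongr
      exact le_max_left _ _
    · left
      refine ⟨⟨hsh, hx1⟩, m, rfl, ?_⟩
      refine (hnon ρ hρ3 t γ hγ ⟨hsh, hx1⟩ Λ _ hsys hnear hb).trans ?_
      gcongr
      exact le_max_right _ _
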